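/- Let $\gamma_0>0>\gamma_1$ and $\lambda_0,\lambda_1>0$. Let $\varepsilon=\varepsilon(t)\in\{0,1\}$, $t\ge 0$, be a two-state Markov process that leaves state $j$ at rate $\lambda_j$ (given $\varepsilon(0)$, the successive holding times are independent, and a holding time in state $j$ is exponential with parameter $\lambda_j$), with $P\{\varepsilon(0)=i\}>0$ for $i=0,1$. Put $P_i=P\{\,\cdot\mid\varepsilon(0)=i\}$, let $N(t)$ be the number of switchings up to time $t$, and let $\Gamma(t)=\int_0^t\gamma_{\varepsilon(s)}\,ds$ be the telegraph process. Let $m_t=\min_{[0,t]}\Gamma$, $M_t=\max_{[0,t]}\Gamma$, let $\zeta^m_t$, $\zeta^M_t\in[0,t]$ be the (first) times at which these extrema are reached, and let $\mathcal T(y)=\min\{t>0:\Gamma(t)=y\}\in(0,\infty]$. Define the (sub-probability) measures $$F_i(ds,y;n)=P_i\{\mathcal T(y)\in ds,\,N(\mathcal T(y))=n\},\qquad F_i(ds,y)=P_i\{\mathcal T(y)\in ds\}\quad\text{on }(0,\infty),$$ $$G^+(dx,t;n)=P_0\{\Gamma(t)\in dx,\,m_t=0,\,N(t)=n\},\qquad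 G^-(dx,t;n)=P_1\{\Gamma(t)\in dx,\,M_t=0,\,N(t)=n\},$$ $$G^+(dx,t)=P_0\{\Gamma(t)\in dx,\,m_t=0\},\qquad G^-(dx,t)=P_1\{\Gamma(t)\in dx,\,M_t=0\}.$$ Write $G^\pm(d(x-y),r;\cdot)$ for the image of $G^\pm(\cdot,r;\cdot)$ under $w\mapsto x=y+w$. Put $$\xi_0(t,x)=\frac{x-\gamma_1t}{\gamma_0-\gamma_1},\quad \xi_1(t,x)=\frac{\gamma_0t-x}{\gamma_0-\gamma_1},\quad z=\lambda_0\lambda_1\xi_0\xi_1,\quad \theta=\frac{e^{-\lambda_0\xi_0-\lambda_1\xi_1}}{\gamma_0-\gamma_1},\quad \mathcal I_0=I_0(2\sqrt z),\quad \mathcal I_1=\frac{I_1(2\sqrt z)}{\sqrt z},$$ where $I_0,I_1$ are modified Bessel functions. For $k\ge0$ let $f_i(t,y;n)$, $n\ge 1$, $y\ne0$, be given by $$f_1(t,y;2k+1)=\frac{\lambda_1}{\xi_0}\,\frac{z^k}{k!^2}\,\theta\,\Big(y-\frac{\gamma_1}{k+1}\xi_1\Big),\qquad f_0(t,y;2k+2)=\lambda_0\lambda_1\,y\,\frac{z^k}{k!(k+1)!}\,\theta\qquad(y>0,\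 t>y/\gamma_0),$$ $$f_0(t,y;2k+1)=\frac{\lambda_0}{\xi_1}\,\frac{z^k}{k!^2}\,\theta\,\Big(-y+\frac{\gamma_0}{k+1}\xi_0\Big),\qquad f_1(t,y;2k+2)=-\lambda_0\lambda_1\,y\,\frac{z^k}{k!(k+1)!}\,\theta\qquad(y<0,\ t>y/\gamma_1),$$ all functions $\xi_i,z,\theta$ being taken at $(t,y)$, and $f_i(t,y;n)=0$ in all other cases; set $f_i(t,y;0)=0$. Let $$f_0(t,y)=\lambda_0\lambda_1y\,\mathcal I_1\theta,\qquad f_1(t,y)=\frac{\lambda_1}{\xi_0}\big(y\,\mathcal I_0-\gamma_1\xi_1\mathcal I_1\big)\theta\qquad(y>0,\ t>y/\gamma_0),$$ $$f_0(t,y)=\frac{\lambda_0}{\xi_1}\big(-y\,\mathcal I_0+\gamma_0\xi_0\mathcal I_1\big)\theta,\qquad f_1(t,y)=-\lambda_0\lambda_1y\,\mathcal I_1\theta\qquad(y<0,\ t>y/\gamma_1),$$ and $f_i(t,y)=0$ otherwise. Then the following hold. **(1) Ingredients.** For $y\neq0$, $n\ge0$, $$F_i(dt,y;n)=\mathbf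 1_{\{n=0,\ y/\gamma_i>0\}}e^{-\lambda_iy/\gamma_i}\delta_{y/\gamma_i}(dt)+f_i(t,y;n)\,dt,\qquad F_i(dt,y)=\mathbf 1_{\{y/\gamma_i>0\}}e^{-\lambda_iy/\gamma_i}\delta_{y/\gamma_i}(dt)+f_i(t,y)\,dt .$$ For $t>0$: $G^+(dx,t;0)=e^{-\lambda_0t}\delta_{\gamma_0t}(dx)$ and $G^-(dx,t;0)=e^{-\lambda_1t}\delta_{\gamma_1t}(dx)$; for $n\ge1$ the measures $G^\pm(dx,t;n)$ have densities $g^\pm(t,x;n)$, where for $k\ge 0$, with $\xi_i,z,\theta$ taken at $(t,x)$, $$g^+(t,x;2k+1)=\frac{\lambda_0}{\gamma_0\xi_0}\frac{z^k}{k!^2}\theta\Big(x-\frac{\gamma_1}{k+1}\xi_1\Big),\qquad g^+(t,x;2k+2)=\frac{\lambda_0\lambda_1x}{\gamma_0}\frac{z^k}{k!(k+1)!}\theta\qquad(0<x<\gamma_0t),$$ $$g^-(t,x;2k+1)=\frac{\lambda_1}{\gamma_1\xi_1}\frac{z^k}{k!^2}\theta\Big(x-\frac{\gamma_0}{k+1}\xi_0\Big),\qquad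 g^-(t,x;2k+2)=\frac{\lambda_0\lambda_1x}{\gamma_1}\frac{z^k}{k!(k+1)!}\theta\qquad(\gamma_1t<x<0),$$ and they vanish elsewhere; moreover $$G^+(dx,t)=e^{-\lambda_0t}\delta_{\gamma_0t}(dx)+\frac{\lambda_0}{\gamma_0}\Big[\frac{x}{\xi_0}\mathcal I_0+\Big(\lambda_1x-\gamma_1\frac{\xi_1}{\xi_0}\Big)\mathcal I_1\Big]\theta\,\mathbf 1_{\{0<x<\gamma_0t\}}dx,$$ $$G^-(dx,t)=e^{-\lambda_1t}\delta_{\gamma_1t}(dx)+\frac{\lambda_1}{\gamma_1}\Big[\frac{x}{\xi_1}\mathcal I_0+\Big(\lambda_0x-\gamma_0\frac{\xi_0}{\xi_1}\Big)\mathcal I_1\Big]\theta\,\mathbf 1_{\{\gamma_1t<x<0\}}dx.$$ **(2) Joint laws with $N(t)=n$.** For $t>0$ and $n\ge0$, as measures in $(s,y,x)\in\mathbb R^3$, $$\begin{aligned} P_0\{\zeta^m_t\in ds,m_t\in dy,\Gamma(t)\in dx,N(t)=n\}&=\delta_0(ds)\delta_0(dy)G^+(dx,t;n)+\delta_t(ds)\delta_x(dy)\tfrac{f_0(t,x;n)}{-\gamma_1}\mathbf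 1_{\{x<0\}}dx\\ &\quad+\tfrac{\lambda_1}{-\gamma_1}\sum_{1\le k\le\lfloor n/2\rfloor}F_0(ds,y;2k-1)\,G^+(d(x-y),t-s;n-2k)\,dy\,\mathbf 1_{\{0<s<t,\,y<0\}},\\ P_1\{\zeta^m_t\in ds,m_t\in dy,\Gamma(t)\in dx,N(t)=n\}&=\delta_t(ds)\delta_x(dy)\Big(\mathbf 1_{\{n=0\}}e^{-\lambda_1t}\delta_{\gamma_1t}(dx)+\tfrac{f_1(t,x;n)}{-\gamma_1}\mathbf 1_{\{x<0\}}dx\Big)\\ &\quad+\tfrac{\lambda_1}{-\gamma_1}\sum_{k\ge0,\ 2k+1\le n}F_1(ds,y;2k)\,G^+(d(x-y),t-s;n-2k-1)\,dy\,\mathbf 1_{\{0<s<t,\,y<0\}},\\ P_0\{\zeta^M_t\in ds,M_t\in dy,\Gamma(t)\in dx,N(t)=n\}&=\delta_t(ds)\delta_x(dy)\Big(\mathbf 1_{\{n=0\}}e^{-\lambda_0t}\delta_{\gamma_0t}(dx)+\tfrac{f_0(t,x;n)}{\gamma_0}\mathbf 1_{\{x>0\}}dx\Big)\\ &\quad+\tfrac{\lambda_0}{\gamma_0}\sum_{k\ge0,\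 2k+1\le n}F_0(ds,y;2k)\,G^-(d(x-y),t-s;n-2k-1)\,dy\,\mathbf 1_{\{0<s<t,\,y>0\}},\\ P_1\{\zeta^M_t\in ds,M_t\in dy,\Gamma(t)\in dx,N(t)=n\}&=\delta_0(ds)\delta_0(dy)G^-(dx,t;n)+\delta_t(ds)\delta_x(dy)\tfrac{f_1(t,x;n)}{\gamma_0}\mathbf 1_{\{x>0\}}dx\\ &\quad+\tfrac{\lambda_0}{\gamma_0}\sum_{1\le k\le\lfloor n/2\rfloor}F_1(ds,y;2k-1)\,G^-(d(x-y),t-s;n-2k)\,dy\,\mathbf 1_{\{0<s<t,\,y>0\}}. \end{aligned}$$ **(3) Joint laws.** For $t>0$, $$\begin{aligned} P_0\{\zeta^m_t\in ds,m_t\in dy,\Gamma(t)\in dx\}&=\delta_0(ds)\delta_0(dy)G^+(dx,t)+\delta_t(ds)\delta_x(dy)\tfrac{f_0(t,x)}{-\gamma_1}\mathbf 1_{\{x<0\}}dx\\ &\quad+\tfrac{\lambda_1}{-\gamma_1}F_0(ds,y)\,G^+(d(x-y),t-s)\,dy\,\mathbf 1_{\{0<s<t,\,y<0\}},\\ P_1\{\zeta^m_t\in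 ds,m_t\in dy,\Gamma(t)\in dx\}&=\delta_t(ds)\delta_x(dy)\Big(e^{-\lambda_1t}\delta_{\gamma_1t}(dx)+\tfrac{f_1(t,x)}{-\gamma_1}\mathbf 1_{\{x<0\}}dx\Big)\\ &\quad+\tfrac{\lambda_1}{-\gamma_1}F_1(ds,y)\,G^+(d(x-y),t-s)\,dy\,\mathbf 1_{\{0<s<t,\,y<0\}},\\ P_0\{\zeta^M_t\in ds,M_t\in dy,\Gamma(t)\in dx\}&=\delta_t(ds)\delta_x(dy)\Big(e^{-\lambda_0t}\delta_{\gamma_0t}(dx)+\tfrac{f_0(t,x)}{\gamma_0}\mathbf 1_{\{x>0\}}dx\Big)\\ &\quad+\tfrac{\lambda_0}{\gamma_0}F_0(ds,y)\,G^-(d(x-y),t-s)\,dy\,\mathbf 1_{\{0<s<t,\,y>0\}},\\ P_1\{\zeta^M_t\in ds,M_t\in dy,\Gamma(t)\in dx\}&=\delta_0(ds)\delta_0(dy)G^-(dx,t)+\delta_t(ds)\delta_x(dy)\tfrac{f_1(t,x)}{\gamma_0}\mathbf 1_{\{x>0\}}dx\\ &\quad+\tfrac{\lambda_0}{\gamma_0}F_1(ds,y)\,G^-(d(x-y),t-s)\,dy\,\mathbf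 1_{\{0<s<t,\,y>0\}}. \end{aligned}$$ -/

import Mathlib

open MeasureTheory ProbabilityTheory Set
open scoped ENNReal Nat

noncomputable section

namespace Telegraph

/-! ### The two-state Markov process and the telegraph process -/

/-- The state in `{0, 1}` reached from `i` after `n` switchings. -/
def stateAfter (i : Fin 2) (n : ℕ) : Fin 2 := if Even n then i else 1 - i

/-- A two-state Markov process with switching rates `lam 0`, `lam 1` on `(Ω, P)`, given by its initial
state and its successive holding times: conditionally on starting from `i`, the holding times are
independent, and the holding time spent in state `j` is exponential with parameter `lam j`.
Both initial states have positive probability, so that both conditional laws `P_0`, `P_1` exist. -/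
structure SwitchingProcess {Ω : Type*} [MeasurableSpace Ω] (P : Measure Ω) (lam : Fin 2 → ℝ) where
  /-- the initial state -/
  init : Ω → Fin 2
  /-- the successive holding times -/
  hold : ℕ → Ω → ℝ
  measurable_init : Measurable init
  measurable_hold : ∀ k, Measurable (hold k)
  init_ne_zero : ∀ i, P (init ⁻¹' {i}) ≠ 0
  indep : ∀ i, iIndepFun hold (cond P (init ⁻¹' {i}))
  law : ∀ i k, (cond P (init ⁻¹' {i})).map (hold k) = expMeasure (lam (stateAfter i k))

namespace SwitchingProcess

variable {Ω : Type*} [MeasurableSpace Ω] {P : Measure Ω} {lam : Fin 2 → ℝ}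

/-- `P_i`, the conditional probability given that the initial state is `i`. -/
def prob (S : SwitchingProcess P lam) (i : Fin 2) : Measure Ω := cond P (S.init ⁻¹' {i})

/-- The switching times `τ_0 = 0`, `τ_1`, `τ_2`, … -/
def switchTime (S : SwitchingProcess P lam) (n : ℕ) (ω : Ω) : ℝ := ∑ k ∈ Finset.range n, S.hold k ω

/-- `N(t)`, the number of switchings that occur up to time `t`. -/
def switches (S : SwitchingProcess P lam) (t : ℝ) (ω : Ω) : ℕ :=
  {n : ℕ | 1 ≤ n ∧ S.switchTime n ω ≤ t}.ncard

/-- `ε(t)`, the state at time `t`. -/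
def state (S : SwitchingProcess P lam) (t : ℝ) (ω : Ω) : Fin 2 :=
  stateAfter (S.init ω) (S.switches t ω)

/-- The telegraph process `Γ(t) = ∫₀ᵗ γ_{ε(s)} ds` with velocities `v 0`, `v 1`. -/
def pos (S : SwitchingProcess P lam) (v : Fin 2 → ℝ) (t : ℝ) (ω : Ω) : ℝ :=
  ∫ s in (0 : ℝ)..t, v (S.state s ω)

/-- The running minimum `m_t`. -/
def runMin (S : SwitchingProcess P lam) (v : Fin 2 → ℝ) (t : ℝ) (ω : Ω) : ℝ :=
  sInf ((fun u => S.pos v u ω) '' Icc 0 t)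

/-- The running maximum `M_t`. -/
def runMax (S : SwitchingProcess P lam) (v : Fin 2 → ℝ) (t : ℝ) (ω : Ω) : ℝ :=
  sSup ((fun u => S.pos v u ω) '' Icc 0 t)

/-- The time in `[0, t]` at which the running minimum is reached. -/
def argMin (S : SwitchingProcess P lam) (v : Fin 2 → ℝ) (t : ℝ) (ω : Ω) : ℝ :=
  sInf {u | u ∈ Icc 0 t ∧ S.pos v u ω = S.runMin v t ω}

/-- The time in `[0, t]` at which the running maximum is reached. -/
def argMax (S : SwitchingProcess P lam) (v : Fin 2 → ℝ) (t : ℝ) (ω : Ω) : ℝ :=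
  sInf {u | u ∈ Icc 0 t ∧ S.pos v u ω = S.runMax v t ω}

/-- The level `y` is reached at some positive time, that is, the first passage time is finite. -/
def Hits (S : SwitchingProcess P lam) (v : Fin 2 → ℝ) (y : ℝ) (ω : Ω) : Prop :=
  ∃ u, 0 < u ∧ S.pos v u ω = y

/-- The first passage time through the level `y`, on the event that it is finite. -/
def hitTime (S : SwitchingProcess P lam) (v : Fin 2 → ℝ) (y : ℝ) (ω : Ω) : ℝ :=
  sInf {u | 0 < u ∧ S.pos v u ω = y}

/-- `F_i(ds, s, y; n)`: the law under `P_i` of the first passage time through `y`, on the event that it is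
finite and that exactly `n` switchings have occurred by then. -/
def passage (S : SwitchingProcess P lam) (v : Fin 2 → ℝ) (i : Fin 2) (y : ℝ) (n : ℕ) : Measure ℝ :=
  ((S.prob i).restrict {ω | S.Hits v y ω ∧ S.switches (S.hitTime v y ω) ω = n}).map (S.hitTime v y)

/-- `F_i(ds, s, y)`: the law under `P_i` of the first passage time through `y`, where it is finite. -/
def passageTotal (S : SwitchingProcess P lam) (v : Fin 2 → ℝ) (i : Fin 2) (y : ℝ) : Measure ℝ :=
  ((S.prob i).restrict {ω | S.Hits v y ω}).map (S.hitTime v y)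

/-- `G⁺(dx, t, x; n)`, the law of the positive meander with `n` switchings:
`P_0 {Γ(t) ∈ dx, m_t = 0, N(t) = n}`. -/
def meanderPos (S : SwitchingProcess P lam) (v : Fin 2 → ℝ) (t : ℝ) (n : ℕ) : Measure ℝ :=
  ((S.prob 0).restrict {ω | S.runMin v t ω = 0 ∧ S.switches t ω = n}).map (S.pos v t)

/-- `G⁺(dx, t, x) = P_0 {Γ(t) ∈ dx, m_t = 0}`. -/
def meanderPosTotal (S : SwitchingProcess P lam) (v : Fin 2 → ℝ) (t : ℝ) : Measure ℝ :=
  ((S.prob 0).restrict {ω | S.runMin v t ω = 0}).map (S.pos v t)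

/-- `G⁻(dx, t, x; n)`, the law of the negative meander with `n` switchings:
`P_1 {Γ(t) ∈ dx, M_t = 0, N(t) = n}`. -/
def meanderNeg (S : SwitchingProcess P lam) (v : Fin 2 → ℝ) (t : ℝ) (n : ℕ) : Measure ℝ :=
  ((S.prob 1).restrict {ω | S.runMax v t ω = 0 ∧ S.switches t ω = n}).map (S.pos v t)

/-- `G⁻(dx, t, x) = P_1 {Γ(t) ∈ dx, M_t = 0}`. -/
def meanderNegTotal (S : SwitchingProcess P lam) (v : Fin 2 → ℝ) (t : ℝ) : Measure ℝ :=
  ((S.prob 1).restrict {ω | S.runMax v t ω = 0}).map (S.pos v t)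

/-- `P_i {(ζ^m_t, m_t, Γ(t)) ∈ A, N(t) = n}`. -/
def minProb (S : SwitchingProcess P lam) (v : Fin 2 → ℝ) (i : Fin 2) (t : ℝ) (n : ℕ)
    (A : Set (ℝ × ℝ × ℝ)) : ℝ≥0∞ :=
  S.prob i {ω | (S.argMin v t ω, S.runMin v t ω, S.pos v t ω) ∈ A ∧ S.switches t ω = n}

/-- `P_i {(ζ^m_t, m_t, Γ(t)) ∈ A}`. -/
def minProbTotal (S : SwitchingProcess P lam) (v : Fin 2 → ℝ) (i : Fin 2) (t : ℝ)
    (A : Set (ℝ × ℝ × ℝ)) : ℝ≥0∞ :=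
  S.prob i {ω | (S.argMin v t ω, S.runMin v t ω, S.pos v t ω) ∈ A}

/-- `P_i {(ζ^M_t, M_t, Γ(t)) ∈ A, N(t) = n}`. -/
def maxProb (S : SwitchingProcess P lam) (v : Fin 2 → ℝ) (i : Fin 2) (t : ℝ) (n : ℕ)
    (A : Set (ℝ × ℝ × ℝ)) : ℝ≥0∞ :=
  S.prob i {ω | (S.argMax v t ω, S.runMax v t ω, S.pos v t ω) ∈ A ∧ S.switches t ω = n}

/-- `P_i {(ζ^M_t, M_t, Γ(t)) ∈ A}`. -/
def maxProbTotal (S : SwitchingProcess P lam) (v : Fin 2 → ℝ) (i : Fin 2) (t : ℝ)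
    (A : Set (ℝ × ℝ × ℝ)) : ℝ≥0∞ :=
  S.prob i {ω | (S.argMax v t ω, S.runMax v t ω, S.pos v t ω) ∈ A}

end SwitchingProcess

/-! ### Explicit functions -/

/-- `ξ_0(t, x)` -/
def xi0 (v : Fin 2 → ℝ) (t x : ℝ) : ℝ := (x - v 1 * t) / (v 0 - v 1)

/-- `ξ_1(t, x)` -/
def xi1 (v : Fin 2 → ℝ) (t x : ℝ) : ℝ := (v 0 * t - x) / (v 0 - v 1)

/-- `z(t, x)` -/
def zed (lam v : Fin 2 → ℝ) (t x : ℝ) : ℝ := lam 0 * lam 1 * xi0 v t x * xi1 v t x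

/-- `θ(t, x)` -/
def theta (lam v : Fin 2 → ℝ) (t x : ℝ) : ℝ :=
  Real.exp (-lam 0 * xi0 v t x - lam 1 * xi1 v t x) / (v 0 - v 1)

/-- The modified Bessel function `I_m` of the first kind, of integer order `m ≥ 0`. -/
def besselI (m : ℕ) (x : ℝ) : ℝ := ∑' k : ℕ, (x / 2) ^ (2 * k + m) / ((k ! : ℝ) * ((k + m)! : ℝ))

/-- `I_0(2 √z)` at `z = z(t, x)` -/
def calI0 (lam v : Fin 2 → ℝ) (t x : ℝ) : ℝ := besselI 0 (2 * √(zed lam v t x))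

/-- `I_1(2 √z) / √z` at `z = z(t, x)` -/
def calI1 (lam v : Fin 2 → ℝ) (t x : ℝ) : ℝ := besselI 1 (2 * √(zed lam v t x)) / √(zed lam v t x)

/-- The density `f_i(t, y; n)`, for `n ≥ 1`, of the first passage time through the level `y`. -/
def passageDensity (lam v : Fin 2 → ℝ) (i : Fin 2) (n : ℕ) (t y : ℝ) : ℝ :=
  if i = 0 then
    if 0 < y ∧ y / v 0 < t ∧ n ≠ 0 ∧ Even n then
      lam 0 * lam 1 * y * (zed lam v t y ^ (n / 2 - 1) / (((n / 2 - 1)! : ℝ) * ((n / 2)! : ℝ)))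
        * theta lam v t y
    else if y < 0 ∧ y / v 1 < t ∧ Odd n then
      lam 0 / xi1 v t y * (zed lam v t y ^ (n / 2) / ((n / 2)! : ℝ) ^ 2) * theta lam v t y
        * (-y + v 0 / ((n / 2 : ℕ) + 1 : ℝ) * xi0 v t y)
    else 0
  else
    if 0 < y ∧ y / v 0 < t ∧ Odd n then
      lam 1 / xi0 v t y * (zed lam v t y ^ (n / 2) / ((n / 2)! : ℝ) ^ 2) * theta lam v t y
        * (y - v 1 / ((n / 2 : ℕ) + 1 : ℝ) * xi1 v t y)
    else if y < 0 ∧ y / v 1 < t ∧ n ≠ 0 ∧ Even n then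
      -(lam 0 * lam 1 * y * (zed lam v t y ^ (n / 2 - 1) / (((n / 2 - 1)! : ℝ) * ((n / 2)! : ℝ)))
        * theta lam v t y)
    else 0

/-- The density `∑ₙ f_i(t, y; n)` of the continuous part of the first passage time through `y`. -/
def passageTotalDensity (lam v : Fin 2 → ℝ) (i : Fin 2) (t y : ℝ) : ℝ :=
  if i = 0 then
    if 0 < y ∧ y / v 0 < t then lam 0 * lam 1 * y * calI1 lam v t y * theta lam v t y
    else if y < 0 ∧ y / v 1 < t then
      lam 0 / xi1 v t y * (-y * calI0 lam v t y + v 0 * xi0 v t y * calI1 lam v t y)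
        * theta lam v t y
    else 0
  else
    if 0 < y ∧ y / v 0 < t then
      lam 1 / xi0 v t y * (y * calI0 lam v t y - v 1 * xi1 v t y * calI1 lam v t y)
        * theta lam v t y
    else if y < 0 ∧ y / v 1 < t then -(lam 0 * lam 1 * y * calI1 lam v t y * theta lam v t y)
    else 0

/-- The density `g⁺(t, x; n)`, for `n ≥ 1`, of the positive meander. -/
def meanderPosDensity (lam v : Fin 2 → ℝ) (n : ℕ) (t x : ℝ) : ℝ :=
  if 0 < x ∧ x < v 0 * t then
    if Odd n then
      lam 0 / xi0 v t x * (zed lam v t x ^ (n / 2) / ((n / 2)! : ℝ) ^ 2) * theta lam v t x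
        * (x - v 1 / ((n / 2 : ℕ) + 1 : ℝ) * xi1 v t x) / v 0
    else if n ≠ 0 then
      lam 0 * lam 1 * (zed lam v t x ^ (n / 2 - 1) / (((n / 2 - 1)! : ℝ) * ((n / 2)! : ℝ)))
        * theta lam v t x * x / v 0
    else 0
  else 0

/-- The density `g⁻(t, x; n)`, for `n ≥ 1`, of the negative meander. -/
def meanderNegDensity (lam v : Fin 2 → ℝ) (n : ℕ) (t x : ℝ) : ℝ :=
  if v 1 * t < x ∧ x < 0 then
    if Odd n then
      lam 1 / xi1 v t x * (zed lam v t x ^ (n / 2) / ((n / 2)! : ℝ) ^ 2) * theta lam v t x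
        * (x - v 0 / ((n / 2 : ℕ) + 1 : ℝ) * xi0 v t x) / v 1
    else if n ≠ 0 then
      lam 0 * lam 1 * (zed lam v t x ^ (n / 2 - 1) / (((n / 2 - 1)! : ℝ) * ((n / 2)! : ℝ)))
        * theta lam v t x * x / v 1
    else 0
  else 0

/-- The density `∑ₙ g⁺(t, x; n)` of the continuous part of the positive meander. -/
def meanderPosTotalDensity (lam v : Fin 2 → ℝ) (t x : ℝ) : ℝ :=
  if 0 < x ∧ x < v 0 * t then
    lam 0 / v 0 * (x / xi0 v t x * calI0 lam v t x
      + (lam 1 * x - v 1 * (xi1 v t x / xi0 v t x)) * calI1 lam v t x) * theta lam v t x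
  else 0

/-- The density `∑ₙ g⁻(t, x; n)` of the continuous part of the negative meander. -/
def meanderNegTotalDensity (lam v : Fin 2 → ℝ) (t x : ℝ) : ℝ :=
  if v 1 * t < x ∧ x < 0 then
    lam 1 / v 1 * (x / xi1 v t x * calI0 lam v t x
      + (lam 0 * x - v 0 * (xi0 v t x / xi1 v t x)) * calI1 lam v t x) * theta lam v t x
  else 0

/-! ### The building blocks of the joint laws -/

/-- The mass at `A` of the measure `F(y)(ds) G(t - s)(d(x - y)) dy` in the variables `(s, y, x)`, with `0 < s < t`
and `y ∈ D`. -/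
def compound (F G : ℝ → Measure ℝ) (D : Set ℝ) (t : ℝ) (A : Set (ℝ × ℝ × ℝ)) : ℝ≥0∞ :=
  ∫⁻ y in D, ∫⁻ s in Ioo 0 t, G (t - s) {w | (s, y, y + w) ∈ A} ∂(F y)

/-- The mass at `A` of the measure `δ_t(ds) δ_x(dy) h(x) dx` in the variables `(s, y, x)`, with `x ∈ D`. -/
def atEnd (h : ℝ → ℝ) (D : Set ℝ) (t : ℝ) (A : Set (ℝ × ℝ × ℝ)) : ℝ≥0∞ :=
  ∫⁻ x in D ∩ {x | (t, x, x) ∈ A}, ENNReal.ofReal (h x)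

end Telegraph

end

noncomputable section

namespace Telegraph

/-! Write γ_i, λ_i for `v i`, `lam i`. A path is determined by its initial state and its holding
times, so every law in question is an iterated integral over holding times and obeys a first-step
recursion. If u and w are the times spent in the states 0 and 1, then the elapsed time is u + w and
the position is γ₀u + γ₁w: the plane of occupation times carries both.

The basic object is `recordOp`. It integrates over paths that end in state 0 strictly above their
whole past, along a line αu + βw = c; the line fixes the last holding time, which is weighted by its
survival probability. By `recordOp_succ_eq_lintegral` the result has, as soon as there is a
switching, a density in w given by one function on the plane, `recordDensity`, the same for all
lines with α > 0. Indeed, prepending a holding time amounts to an antiderivative in u or in w, and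
the explicit factors satisfy ∂_u even_k = λ₀ odd_k and ∂_w odd_{k+1} = λ₁ even_k with vanishing
boundary terms. The line γ₀u + γ₁w = y gives the first passage law (`recordOp_level`). The line u +
w = t gives the law of the position when the maximum is attained at time t (`recordOp_time`). The
two changes of variables differ by a factor γ₀, whence the density f_i / γ₀ in the second law.

The joint law comes from cutting the path at its maximum (`maxOp_eq`). The maximum is attained at
time t, or at time 0 (only for a start in state 1), or at a switching out of state 0. In the last
case the holding time r that ends there has density λ₀ e^{-λ₀ r} dr, which in terms of the level is
(λ₀/γ₀) e^{-λ₀ r} dy; so the past is a first passage law integrated over the levels with weight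
λ₀/γ₀. The future is an independent path that starts in state 1 and stays nonpositive.

The law of that nonpositive path follows by reversing time (`stayOp_succ_last`,
`stayOp_eq_recordOp`): it becomes a record path of the process with exchanged states and reflected
velocities. The weights change only by a ratio of rates, because the unfinished interval is now
another one. Thus `recordOp_time` also yields the meander densities (`meanderOp_eq`).

Summing over the number of switchings produces the Bessel series. `map_holdSeq` and `ae_admissible`
transfer everything from sequences of holding times to the process, and the statements on minima are
those on maxima for the reflected process `flip`. -/

/-! ### Lebesgue integrals on the line -/

/-- The exponential density of rate `l`, with values in `ℝ≥0∞`. -/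
def expWeight (l h : ℝ) : ℝ≥0∞ := if 0 < h then ENNReal.ofReal (l * Real.exp (-l * h)) else 0

@[fun_prop]
lemma measurable_expWeight (l : ℝ) : Measurable (expWeight l) := by
  unfold expWeight
  exact Measurable.ite measurableSet_Ioi (by fun_prop) measurable_const

lemma expWeight_of_nonpos {l h : ℝ} (hh : h ≤ 0) : expWeight l h = 0 := by
  simp [expWeight, hh.not_gt]

lemma lintegral_expMeasure {l : ℝ} (f : ℝ → ℝ≥0∞) (hf : Measurable f) :
    ∫⁻ x, f x ∂(expMeasure l) = ∫⁻ h, expWeight l h * f h := by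
  unfold expMeasure gammaMeasure
  rw [lintegral_withDensity_eq_lintegral_mul _
    (show Measurable (gammaPDF 1 l) from (measurable_gammaPDFReal 1 l).ennreal_ofReal) hf]
  refine lintegral_congr_ae ?_
  have : ∀ᵐ x : ℝ, x ≠ 0 := by simp [ae_iff]
  filter_upwards [this] with x hx
  have h := exponentialPDF_eq l x
  rw [exponentialPDF, exponentialPDFReal] at h
  simp only [Pi.mul_apply, gammaPDF]
  rw [h, expWeight]
  rcases lt_or_gt_of_ne hx with h0 | h0
  · simp [h0.not_ge, h0.not_gt]
  · simp [h0, h0.le]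

lemma lintegral_expWeight_congr {l : ℝ} {f g : ℝ → ℝ≥0∞}
    (h : ∀ᵐ x : ℝ, 0 < x → f x = g x) :
    ∫⁻ x, expWeight l x * f x = ∫⁻ x, expWeight l x * g x := by
  refine lintegral_congr_ae ?_
  filter_upwards [h] with x hx
  by_cases h0 : 0 < x
  · rw [hx h0]
  · simp [expWeight_of_nonpos (not_lt.1 h0)]

/-- A nonnegative derivative is automatically integrable, so the fundamental theorem of calculus
needs no integrability hypothesis here. -/
lemma lintegral_Ioo_eq_ofReal_sub {F f : ℝ → ℝ} {a b : ℝ} (hab : a ≤ b)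
    (hF : ContinuousOn F (Icc a b)) (hd : ∀ x ∈ Ioo a b, HasDerivAt F (f x) x)
    (h0 : ∀ x ∈ Ioo a b, 0 ≤ f x) :
    ∫⁻ x in Ioo a b, ENNReal.ofReal (f x) = ENNReal.ofReal (F b - F a) := by
  have hint : IntegrableOn f (Ioc a b) :=
    intervalIntegral.integrableOn_deriv_of_nonneg hF hd h0
  have hint' : IntegrableOn f (Ioo a b) := hint.mono_set Ioo_subset_Ioc_self
  rw [← ofReal_integral_eq_lintegral_ofReal hint'
    ((ae_restrict_iff' measurableSet_Ioo).2 (ae_of_all _ h0)), ← integral_Ioc_eq_integral_Ioo,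
    ← intervalIntegral.integral_of_le hab,
    intervalIntegral.integral_eq_sub_of_hasDerivAt_of_le hab hF hd
      ((intervalIntegrable_iff_integrableOn_Ioc_of_le hab).2 hint)]

lemma lintegral_comp_affine {a κ : ℝ} (hκ : κ ≠ 0) (f : ℝ → ℝ≥0∞) (hf : Measurable f) :
    ∫⁻ w, f (a + κ * w) = ENNReal.ofReal |κ⁻¹| * ∫⁻ x, f x := by
  have h1 : ∫⁻ x, f (a + x) = ∫⁻ x, f x := lintegral_add_left_eq_self f a
  rw [← h1, ← smul_eq_mul, ← lintegral_smul_measure, ← Real.map_volume_mul_left hκ,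
    lintegral_map (by fun_prop) (by fun_prop)]

/-! ### Integration along a line of occupation times -/

/-- Weighted integral, along the line `α u + β w = c` in the plane of occupation times `(u, w)` of
the states `0` and `1`, over the paths with `n` switchings that start in state `i`, end in state
`0` and end at a point strictly above all earlier ones. -/
def recordOp (lam v : Fin 2 → ℝ) (α β : ℝ) : ℕ → Fin 2 → ℝ → (ℝ × ℝ → ℝ≥0∞) → ℝ≥0∞
  | 0, i, c, Φ =>
      if i = 0 ∧ 0 < c then ENNReal.ofReal (Real.exp (-lam 0 * (c / α))) * Φ (c / α, 0) else 0
  | n + 1, i, c, Φ =>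
      if i = 0 then
        ∫⁻ h, expWeight (lam 0) h * recordOp lam v α β n 1 (c - α * h) (fun p => Φ (p.1 + h, p.2))
      else
        ∫⁻ h, expWeight (lam 1) h * recordOp lam v α β n 0 (c - β * h)
          (fun p => if 0 < v 0 * p.1 + v 1 * (p.2 + h) then Φ (p.1, p.2 + h) else 0)

section recordOp

variable {lam v : Fin 2 → ℝ} {α β : ℝ}

lemma recordOp_zero_zero (c : ℝ) (Φ : ℝ × ℝ → ℝ≥0∞) : recordOp lam v α β 0 0 c Φ =
    if 0 < c then ENNReal.ofReal (Real.exp (-lam 0 * (c / α))) * Φ (c / α, 0) else 0 := by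
  simp [recordOp]

lemma recordOp_zero_one (c : ℝ) (Φ : ℝ × ℝ → ℝ≥0∞) : recordOp lam v α β 0 1 c Φ = 0 := by
  simp [recordOp]

lemma recordOp_succ_zero (n : ℕ) (c : ℝ) (Φ : ℝ × ℝ → ℝ≥0∞) : recordOp lam v α β (n + 1) 0 c Φ =
    ∫⁻ h, expWeight (lam 0) h *
      recordOp lam v α β n 1 (c - α * h) (fun p => Φ (p.1 + h, p.2)) := by
  simp [recordOp]

lemma recordOp_succ_one (n : ℕ) (c : ℝ) (Φ : ℝ × ℝ → ℝ≥0∞) : recordOp lam v α β (n + 1) 1 c Φ =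
    ∫⁻ h, expWeight (lam 1) h * recordOp lam v α β n 0 (c - β * h)
      (fun p => if 0 < v 0 * p.1 + v 1 * (p.2 + h) then Φ (p.1, p.2 + h) else 0) := by
  simp [recordOp]

/-- The parameter space varies in the induction: the recursion integrates over a holding time, which
has to join the parameters, so the claim is applied to `B × ℝ`. -/
lemma measurable_recordOp (n : ℕ) : ∀ (i : Fin 2) {B : Type} [MeasurableSpace B] {c : B → ℝ}
    {Φ : B → ℝ × ℝ → ℝ≥0∞}, Measurable c → Measurable (fun q : B × (ℝ × ℝ) => Φ q.1 q.2) →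
    Measurable fun b => recordOp lam v α β n i (c b) (Φ b) := by
  induction n with
  | zero =>
    intro i B _ c Φ hc hΦ
    rcases Fin.exists_fin_two.1 ⟨i, rfl⟩ with rfl | rfl
    · simp only [recordOp_zero_zero]
      refine Measurable.ite (measurableSet_lt measurable_const hc) ?_ measurable_const
      exact (by fun_prop : Measurable fun b => ENNReal.ofReal (Real.exp (-lam 0 * (c b / α)))).mul
        (hΦ.comp (by fun_prop : Measurable fun b => (b, (c b / α, (0 : ℝ)))))
    · simp [recordOp_zero_one]
  | succ n ih =>
    intro i B _ c Φ hc hΦ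
    rcases Fin.exists_fin_two.1 ⟨i, rfl⟩ with rfl | rfl
    · simp only [recordOp_succ_zero]
      refine Measurable.lintegral_prod_right' (f := fun q : B × ℝ => expWeight (lam 0) q.2 *
        recordOp lam v α β n 1 (c q.1 - α * q.2) (fun p => Φ q.1 (p.1 + q.2, p.2))) ?_
      refine Measurable.mul (by fun_prop) (ih 1 (by fun_prop) ?_)
      exact hΦ.comp (by fun_prop :
        Measurable fun q : (B × ℝ) × (ℝ × ℝ) => (q.1.1, (q.2.1 + q.1.2, q.2.2)))
    · simp only [recordOp_succ_one]
      refine Measurable.lintegral_prod_right' (f := fun q : B × ℝ => expWeight (lam 1) q.2 *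
        recordOp lam v α β n 0 (c q.1 - β * q.2) (fun p =>
          if 0 < v 0 * p.1 + v 1 * (p.2 + q.2) then Φ q.1 (p.1, p.2 + q.2) else 0)) ?_
      refine Measurable.mul (by fun_prop) (ih 0 (by fun_prop) ?_)
      refine Measurable.ite (measurableSet_lt measurable_const (by fun_prop)) ?_ measurable_const
      exact hΦ.comp (by fun_prop :
        Measurable fun q : (B × ℝ) × (ℝ × ℝ) => (q.1.1, (q.2.1, q.2.2 + q.1.2)))

/-- The recursion evaluates its test function only at occupation times on the line, with positive
time in state 0. For a start in state 1 and at least one switching, the indicator in the recursion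
also forces the endpoint above the starting point; nothing of the kind is recorded for a start in
state 0. -/
lemma recordOp_congr (hα : 0 < α) (n : ℕ) : ∀ (i : Fin 2) (c : ℝ) {Φ Ψ : ℝ × ℝ → ℝ≥0∞},
    (∀ u w, 0 < u → 0 ≤ w → α * u + β * w = c → 0 < v 0 * u + v 1 * w ∨ i = 0 →
      Φ (u, w) = Ψ (u, w)) →
    recordOp lam v α β n i c Φ = recordOp lam v α β n i c Ψ := by
  induction n with
  | zero =>
    intro i c Φ Ψ h
    rcases Fin.exists_fin_two.1 ⟨i, rfl⟩ with rfl | rfl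
    · simp only [recordOp_zero_zero]
      split_ifs with hc
      · rw [h _ _ (div_pos hc hα) le_rfl (by field_simp; ring) (Or.inr rfl)]
      · rfl
    · simp [recordOp_zero_one]
  | succ n ih =>
    intro i c Φ Ψ h
    rcases Fin.exists_fin_two.1 ⟨i, rfl⟩ with rfl | rfl
    · simp only [recordOp_succ_zero]
      refine lintegral_expWeight_congr (ae_of_all _ fun x hx => ih _ _ ?_)
      intro u w hu hw hc _
      exact h _ _ (by linarith) hw (by linarith) (Or.inr rfl)
    · simp only [recordOp_succ_one]
      refine lintegral_expWeight_congr (ae_of_all _ fun x hx => ih _ _ ?_)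
      intro u w hu hw hc _
      simp only
      split_ifs with h1
      · exact h _ _ hu (by linarith) (by linarith) (Or.inl h1)
      · rfl

end recordOp

/-! ### Densities in the plane of occupation times -/

/-- The polynomial factor of the density for an even number `2 k + 2` of switchings. -/
def evenFactor (lam v : Fin 2 → ℝ) (k : ℕ) (u w : ℝ) : ℝ :=
  lam 0 * lam 1 * (v 0 * u + v 1 * w) *
    ((lam 0 * lam 1 * u * w) ^ k / ((k ! : ℝ) * ((k + 1)! : ℝ))) / v 0

/-- The polynomial factor of the density for an odd number `2 k + 1` of switchings. -/
def oddFactor (lam v : Fin 2 → ℝ) (k : ℕ) (u w : ℝ) : ℝ :=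
  lam 1 / u * ((lam 0 * lam 1 * u * w) ^ k / (k ! : ℝ) ^ 2) *
    (v 0 * u + v 1 * w - v 1 / ((k : ℝ) + 1) * w) / v 0

/-- The polynomial factor of the density for `n` switchings and initial state `i`. -/
def recordFactor (lam v : Fin 2 → ℝ) (n : ℕ) (i : Fin 2) (u w : ℝ) : ℝ :=
  if i = 0 then if n ≠ 0 ∧ Even n then evenFactor lam v (n / 2 - 1) u w else 0
  else if Odd n then oddFactor lam v (n / 2) u w else 0

section factors

variable {lam v : Fin 2 → ℝ}

/-- With `hasDerivAt_oddFactor` this is the first-step recursion in differential form. Only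
polynomial factors occur, since e^{-λ₀h} e^{-λ₀(u-h)} does not depend on the prepended holding time
h. -/
lemma hasDerivAt_evenFactor (k : ℕ) (w : ℝ) {u : ℝ} (hu : u ≠ 0) (hv0 : v 0 ≠ 0) :
    HasDerivAt (fun s => evenFactor lam v k s w) (lam 0 * oddFactor lam v k u w) u := by
  have h1 : HasDerivAt (fun s : ℝ => v 0 * s + v 1 * w) (v 0) u := by
    simpa using ((hasDerivAt_id u).const_mul (v 0)).add_const (v 1 * w)
  have h2 : HasDerivAt (fun s : ℝ => (lam 0 * lam 1 * s * w) ^ k)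
      (k * (lam 0 * lam 1 * u * w) ^ (k - 1) * (lam 0 * lam 1 * w)) u := by
    have := (((hasDerivAt_id u).const_mul (lam 0 * lam 1)).mul_const w).fun_pow k
    simpa using this
  have h3 := (((h1.const_mul (lam 0 * lam 1)).mul
    (h2.div_const ((k ! : ℝ) * ((k + 1)! : ℝ)))).div_const (v 0))
  refine h3.congr_deriv ?_
  unfold oddFactor
  have hk : ((k + 1 : ℕ)! : ℝ) = ((k : ℝ) + 1) * (k ! : ℝ) := by
    rw [Nat.factorial_succ]; push_cast; ring
  have hk0 : (k ! : ℝ) ≠ 0 := by positivity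
  have hk1 : (k : ℝ) + 1 ≠ 0 := by positivity
  rw [hk]
  -- The derivative of the power contains the truncated exponent `k - 1`, so k = 0 is treated apart.
  rcases k with _ | k
  · simp; field_simp
  · simp only [Nat.add_sub_cancel]
    rw [pow_succ]
    push_cast at *
    field_simp
    ring

lemma hasDerivAt_oddFactor (k : ℕ) (u w : ℝ) (hu : u ≠ 0) (hv0 : v 0 ≠ 0) :
    HasDerivAt (fun s => oddFactor lam v (k + 1) u s) (lam 1 * evenFactor lam v k u w) w := by
  have h1 : HasDerivAt (fun s : ℝ => v 0 * u + v 1 * s - v 1 / (((k + 1 : ℕ) : ℝ) + 1) * s)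
      (v 1 - v 1 / (((k + 1 : ℕ) : ℝ) + 1)) w := by
    have a := ((hasDerivAt_id w).const_mul (v 1)).const_add (v 0 * u)
    have b := (hasDerivAt_id w).const_mul (v 1 / (((k + 1 : ℕ) : ℝ) + 1))
    simpa using a.fun_sub b
  have h2 : HasDerivAt (fun s : ℝ => (lam 0 * lam 1 * u * s) ^ (k + 1))
      ((k + 1 : ℕ) * (lam 0 * lam 1 * u * w) ^ k * (lam 0 * lam 1 * u)) w := by
    have := ((hasDerivAt_id w).const_mul (lam 0 * lam 1 * u)).fun_pow (k + 1)
    simpa using this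
  have h3 := ((((h2.div_const (((k + 1)! : ℝ) ^ 2)).const_mul (lam 1 / u)).mul h1).div_const (v 0))
  refine h3.congr_deriv ?_
  unfold evenFactor
  have hk : ((k + 1 : ℕ)! : ℝ) = ((k : ℝ) + 1) * (k ! : ℝ) := by
    rw [Nat.factorial_succ]; push_cast; ring
  have hk0 : (k ! : ℝ) ≠ 0 := by positivity
  have hk1 : (k : ℝ) + 1 ≠ 0 := by positivity
  have hk2 : (k : ℝ) + 1 + 1 ≠ 0 := by positivity
  rw [hk, pow_succ]
  push_cast
  field_simp
  ring

variable (hlam : ∀ i, 0 < lam i) (hv0 : 0 < v 0) (hv1 : v 1 < 0)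

include hlam hv0 in
lemma evenFactor_nonneg (k : ℕ) {u w : ℝ} (hu : 0 ≤ u) (hw : 0 ≤ w) (hp : 0 ≤ v 0 * u + v 1 * w) :
    0 ≤ evenFactor lam v k u w := by
  have := hlam 0; have := hlam 1
  unfold evenFactor
  positivity

include hlam hv0 hv1 in
lemma oddFactor_nonneg (k : ℕ) {u w : ℝ} (hu : 0 ≤ u) (hw : 0 ≤ w) (hp : 0 ≤ v 0 * u + v 1 * w) :
    0 ≤ oddFactor lam v k u w := by
  have := hlam 0; have := hlam 1
  have h : 0 ≤ v 0 * u + v 1 * w - v 1 / ((k : ℝ) + 1) * w := by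
    have : v 1 / ((k : ℝ) + 1) * w ≤ 0 :=
      mul_nonpos_of_nonpos_of_nonneg (div_nonpos_of_nonpos_of_nonneg hv1.le (by positivity)) hw
    linarith
  unfold oddFactor
  positivity

lemma recordFactor_even_zero (k : ℕ) (u w : ℝ) :
    recordFactor lam v (2 * k + 2) 0 u w = evenFactor lam v k u w := by
  have h : Even (2 * k + 2) := ⟨k + 1, by ring⟩
  simp [recordFactor, h]

lemma recordFactor_odd_one (k : ℕ) (u w : ℝ) :
    recordFactor lam v (2 * k + 1) 1 u w = oddFactor lam v k u w := by
  have h : Odd (2 * k + 1) := ⟨k, by ring⟩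
  have : (2 * k + 1) / 2 = k := by omega
  simp only [recordFactor, h, this, if_true, one_ne_zero, if_false]

lemma recordFactor_odd_zero (k : ℕ) (u w : ℝ) : recordFactor lam v (2 * k + 1) 0 u w = 0 := by
  simp [recordFactor]

lemma recordFactor_even_one (k : ℕ) (u w : ℝ) : recordFactor lam v (2 * k + 2) 1 u w = 0 := by
  have h : ¬ Odd (2 * k + 2) := by simp [Nat.not_odd_iff_even]; exact ⟨k + 1, by ring⟩
  simp [recordFactor, h]

@[fun_prop]
lemma measurable_recordFactor (n : ℕ) (i : Fin 2) :
    Measurable fun p : ℝ × ℝ => recordFactor lam v n i p.1 p.2 := by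
  unfold recordFactor evenFactor oddFactor
  split_ifs <;> fun_prop

/-- The density for `n` switchings and initial state `i` in the plane of occupation times. -/
def recordDensity (lam v : Fin 2 → ℝ) (n : ℕ) (i : Fin 2) (p : ℝ × ℝ) : ℝ≥0∞ :=
  if 0 < p.2 ∧ 0 < v 0 * p.1 + v 1 * p.2 then
    ENNReal.ofReal (recordFactor lam v n i p.1 p.2 * Real.exp (-lam 0 * p.1 - lam 1 * p.2)) else 0

@[fun_prop]
lemma measurable_recordDensity (n : ℕ) (i : Fin 2) : Measurable (recordDensity lam v n i) := by
  unfold recordDensity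
  refine Measurable.ite ?_ (by fun_prop) measurable_const
  exact (measurableSet_lt measurable_const measurable_snd).inter (measurableSet_lt
    measurable_const (by fun_prop : Measurable fun p : ℝ × ℝ => v 0 * p.1 + v 1 * p.2))

include hlam hv0 hv1 in
-- For the relevant parity the integrand is, up to a constant exponential, the derivative in h of
-- -even(u - h, w). The upper limit h = u + γ₁w/γ₀ is where the remaining path would have zero
-- displacement, and there the even factor vanishes. For the other parity both sides are zero.
lemma lintegral_recordDensity_one (n : ℕ) (p : ℝ × ℝ) :
    ∫⁻ h, expWeight (lam 0) h * recordDensity lam v (n + 1) 1 (p.1 - h, p.2)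
      = recordDensity lam v (n + 2) 0 p := by
  obtain ⟨u, w⟩ := p
  rcases Nat.even_or_odd' n with ⟨k, rfl | rfl⟩
  swap
  · simp [recordDensity, recordFactor_even_one, show 2 * k + 1 + 2 = 2 * (k + 1) + 1 by ring,
      show 2 * k + 1 + 1 = 2 * k + 2 by ring, recordFactor_odd_zero]
  simp only [recordDensity, recordFactor_odd_one, recordFactor_even_zero]
  by_cases hw : 0 < w
  swap
  · simp [hw]
  by_cases hp : 0 < v 0 * u + v 1 * w
  swap
  · simp only [hp, and_false, if_false]
    rw [lintegral_eq_zero_iff' (by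
      refine (Measurable.mul (by fun_prop) ?_).aemeasurable
      have := (measurable_recordDensity (lam := lam) (v := v) (2 * k + 1) 1).comp
        (by fun_prop : Measurable fun h : ℝ => (u - h, w))
      simpa [Function.comp_def, recordDensity, recordFactor_odd_one] using this)]
    refine ae_of_all _ fun h => ?_
    simp only [expWeight]
    split_ifs with h1 h2
    · nlinarith [h2.2, mul_pos hv0 h1]
    all_goals simp
  simp only [hw, hp, true_and, and_self, if_true]
  -- The exponentials combine into a factor free of h, and the positivity conditions on h cut out an
  -- interval.
  have key : ∀ h, expWeight (lam 0) h * (if 0 < v 0 * (u - h) + v 1 * w then ENNReal.ofReal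
      (oddFactor lam v k (u - h) w * Real.exp (-lam 0 * (u - h) - lam 1 * w)) else 0) =
      (Ioo 0 (u + v 1 * w / v 0)).indicator (fun h => ENNReal.ofReal
        (lam 0 * oddFactor lam v k (u - h) w) *
          ENNReal.ofReal (Real.exp (-lam 0 * u - lam 1 * w))) h := by
    intro h
    have e : 0 < v 0 * (u - h) + v 1 * w ↔ h < u + v 1 * w / v 0 := by
      have : v 0 * (u - h) + v 1 * w = v 0 * (u + v 1 * w / v 0 - h) := by field_simp; ring
      rw [this, mul_pos_iff_of_pos_left hv0, sub_pos]
    simp only [e, expWeight, indicator]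
    by_cases h0 : 0 < h <;> by_cases h1 : h < u + v 1 * w / v 0 <;> simp only [h0, h1, mem_Ioo,
      if_true, if_false, and_true, and_false, mul_zero, zero_mul]
    · have hnn : 0 ≤ oddFactor lam v k (u - h) w := by
        have h2 := e.2 h1
        refine oddFactor_nonneg hlam hv0 hv1 k ?_ hw.le h2.le
        have : 0 < v 0 * (u - h) := by nlinarith
        exact (pos_of_mul_pos_right this hv0.le).le
      have h3 := (hlam 0).le
      rw [← ENNReal.ofReal_mul (by positivity), ← ENNReal.ofReal_mul (by positivity)]
      congr 1
      have : Real.exp (-lam 0 * u - lam 1 * w) =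
          Real.exp (-lam 0 * h) * Real.exp (-lam 0 * (u - h) - lam 1 * w) := by
        rw [← Real.exp_add]; congr 1; ring
      rw [this]; ring
  simp_rw [key]
  rw [lintegral_indicator measurableSet_Ioo, lintegral_mul_const _ (by
    have := (measurable_recordFactor (lam := lam) (v := v) (2 * k + 1) 1).comp
        (by fun_prop : Measurable fun h : ℝ => (u - h, w))
    simp only [Function.comp_def, recordFactor_odd_one] at this
    fun_prop)]
  have hc : 0 ≤ u + v 1 * w / v 0 := by
    have : u + v 1 * w / v 0 = (v 0 * u + v 1 * w) / v 0 := by field_simp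
    rw [this]; positivity
  rw [lintegral_Ioo_eq_ofReal_sub (F := fun h => - evenFactor lam v k (u - h) w) hc]
  · rw [← ENNReal.ofReal_mul' (by positivity)]
    congr 2
    have : v 0 * (u - (u + v 1 * w / v 0)) + v 1 * w = 0 := by field_simp; ring
    simp only [evenFactor, this]; simp
  · unfold evenFactor; fun_prop
  · intro h hh
    have hu : u - h ≠ 0 := by
      have h2 : h < u + v 1 * w / v 0 := hh.2
      have : v 1 * w / v 0 < 0 := div_neg_of_neg_of_pos (mul_neg_of_neg_of_pos hv1 hw) hv0
      linarith
    have := (hasDerivAt_evenFactor (lam := lam) (v := v) k w hu hv0.ne').scomp h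
      ((hasDerivAt_id h).const_sub u)
    exact this.neg.congr_deriv (by simp)
  · intro h hh
    have h2 : h < u + v 1 * w / v 0 := hh.2
    have : v 1 * w / v 0 < 0 := div_neg_of_neg_of_pos (mul_neg_of_neg_of_pos hv1 hw) hv0
    refine mul_nonneg (hlam 0).le (oddFactor_nonneg hlam hv0 hv1 k (by linarith) hw.le ?_)
    have : v 0 * (u - h) + v 1 * w = v 0 * (u + v 1 * w / v 0 - h) := by field_simp; ring
    rw [this]; exact mul_nonneg hv0.le (by linarith)

include hlam hv0 hv1 in
-- Now the boundary term sits at h = w and vanishes because an odd factor of positive index contains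
-- a power of w. Positivity of the final position passes to the shortened path, since removing time
-- spent in state 1 raises the endpoint.
lemma lintegral_recordDensity_zero (n : ℕ) (p : ℝ × ℝ) :
    (if 0 < v 0 * p.1 + v 1 * p.2 then
      ∫⁻ h, expWeight (lam 1) h * recordDensity lam v (n + 1) 0 (p.1, p.2 - h) else 0)
      = recordDensity lam v (n + 2) 1 p := by
  obtain ⟨u, w⟩ := p
  rcases Nat.even_or_odd' n with ⟨k, rfl | rfl⟩
  · simp [recordDensity, recordFactor_even_one, recordFactor_odd_zero]
  simp only [recordDensity, recordFactor_odd_one, recordFactor_even_zero,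
    show 2 * k + 1 + 2 = 2 * (k + 1) + 1 by ring, show 2 * k + 1 + 1 = 2 * k + 2 by ring]
  by_cases hp : 0 < v 0 * u + v 1 * w
  swap
  · simp [hp]
  simp only [hp, and_true, if_true]
  have key : ∀ h, expWeight (lam 1) h * (if 0 < w - h ∧ 0 < v 0 * u + v 1 * (w - h) then
      ENNReal.ofReal (evenFactor lam v k u (w - h) * Real.exp (-lam 0 * u - lam 1 * (w - h)))
        else 0) =
      (Ioo 0 w).indicator (fun h => ENNReal.ofReal
        (lam 1 * evenFactor lam v k u (w - h)) *
          ENNReal.ofReal (Real.exp (-lam 0 * u - lam 1 * w))) h := by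
    intro h
    simp only [expWeight, indicator, sub_pos]
    by_cases h0 : 0 < h <;> by_cases h1 : h < w <;> simp only [h0, h1, mem_Ioo,
      if_true, if_false, and_true, and_false, mul_zero, zero_mul, true_and, false_and]
    have hpos : 0 < v 0 * u + v 1 * (w - h) := by nlinarith
    have hnn : 0 ≤ evenFactor lam v k u (w - h) := by
      refine evenFactor_nonneg hlam hv0 k ?_ (by linarith) hpos.le
      have : 0 < v 0 * u := by nlinarith
      exact (pos_of_mul_pos_right this hv0.le).le
    have h3 := (hlam 1).le
    rw [if_pos hpos, ← ENNReal.ofReal_mul (by positivity), ← ENNReal.ofReal_mul (by positivity)]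
    congr 1
    have : Real.exp (-lam 0 * u - lam 1 * w) =
        Real.exp (-lam 1 * h) * Real.exp (-lam 0 * u - lam 1 * (w - h)) := by
      rw [← Real.exp_add]; congr 1; ring
    rw [this]; ring
  simp_rw [key]
  by_cases hw : 0 < w
  swap
  · simp [hw]
  have hu : 0 < u := by
    have : 0 < v 0 * u := by nlinarith
    exact pos_of_mul_pos_right this hv0.le
  rw [lintegral_indicator measurableSet_Ioo, lintegral_mul_const _ (by
    unfold evenFactor
    fun_prop), if_pos hw]
  rw [lintegral_Ioo_eq_ofReal_sub (F := fun h => - oddFactor lam v (k + 1) u (w - h)) hw.le]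
  · rw [← ENNReal.ofReal_mul' (by positivity)]
    congr 2
    simp [oddFactor]
  · unfold oddFactor; fun_prop
  · intro h hh
    have := (hasDerivAt_oddFactor (lam := lam) (v := v) k u (w - h) hu.ne' hv0.ne').scomp h
      ((hasDerivAt_id h).const_sub w)
    exact this.neg.congr_deriv (by simp)
  · intro h hh
    refine mul_nonneg (hlam 1).le (evenFactor_nonneg hlam hv0 k hu.le (by linarith [hh.2]) ?_)
    nlinarith [hh.1, hh.2]

end factors

/-! ### The record operator in closed form -/

section closedForm

variable {lam v : Fin 2 → ℝ} {α β : ℝ}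

variable (hlam : ∀ i, 0 < lam i) (hv0 : 0 < v 0) (hv1 : v 1 < 0)

include hv0 in
lemma oddFactor_zero_left {u : ℝ} (hu : 0 < u) (w : ℝ) : oddFactor lam v 0 u w = lam 1 := by
  unfold oddFactor
  simp
  field_simp

include hlam hv0 hv1 in
-- A first holding time h in state 0 shifts u and keeps w; one in state 1 shifts w and keeps u.
-- After exchanging the integrals, the h-integral at a fixed point of the line is one of the two
-- density recursions, neither of which involves α or β.
lemma recordOp_succ_eq_lintegral (hα : 0 < α) (n : ℕ) : ∀ (i : Fin 2) (c : ℝ)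
    {Φ : ℝ × ℝ → ℝ≥0∞}, Measurable Φ → recordOp lam v α β (n + 1) i c Φ =
      ∫⁻ w, recordDensity lam v (n + 1) i ((c - β * w) / α, w) * Φ ((c - β * w) / α, w) := by
  induction n with
  | zero =>
    intro i c Φ hΦ
    rcases Fin.exists_fin_two.1 ⟨i, rfl⟩ with rfl | rfl
    · simp [recordOp_succ_zero, recordOp_zero_one, recordDensity, recordFactor]
    · simp only [recordOp_succ_one, recordOp_zero_zero, recordDensity, zero_add]
      refine lintegral_congr fun w => ?_
      set u := (c - β * w) / α with hu
      have hc : 0 < c - β * w ↔ 0 < u := by rw [hu, div_pos_iff_of_pos_right hα]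
      have h1 := recordFactor_odd_one (lam := lam) (v := v) 0 u w
      simp only [mul_zero, zero_add] at h1
      simp only [hc, h1, expWeight]
      by_cases hw : 0 < w
      swap
      · simp [hw]
      by_cases hp : 0 < v 0 * u + v 1 * w
      swap
      · simp [hp]
      have hu0 : 0 < u := by
        have : 0 < v 0 * u := by nlinarith
        exact pos_of_mul_pos_right this hv0.le
      have h3 := (hlam 1).le
      simp only [hw, hp, hu0, if_true, and_self, oddFactor_zero_left hv0 hu0]
      rw [← mul_assoc, ← ENNReal.ofReal_mul (by positivity), mul_assoc, ← Real.exp_add]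
      congr 4
      ring
  | succ n ih =>
    intro i c Φ hΦ
    rcases Fin.exists_fin_two.1 ⟨i, rfl⟩ with rfl | rfl
    · rw [recordOp_succ_zero]
      have h1 : ∀ h, recordOp lam v α β (n + 1) 1 (c - α * h) (fun p => Φ (p.1 + h, p.2)) =
          ∫⁻ w, recordDensity lam v (n + 1) 1 ((c - β * w) / α - h, w) *
            Φ ((c - β * w) / α, w) := by
        intro h
        rw [ih 1 _ (by fun_prop)]
        refine lintegral_congr fun w => ?_
        have : (c - α * h - β * w) / α = (c - β * w) / α - h := by field_simp; ring
        simp [this]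
      simp_rw [h1]
      have h2 : ∀ h, expWeight (lam 0) h * ∫⁻ w, recordDensity lam v (n + 1) 1
            ((c - β * w) / α - h, w) * Φ ((c - β * w) / α, w) =
          ∫⁻ w, expWeight (lam 0) h * (recordDensity lam v (n + 1) 1
            ((c - β * w) / α - h, w) * Φ ((c - β * w) / α, w)) := fun h =>
        (lintegral_const_mul _ (by fun_prop)).symm
      simp_rw [h2]
      rw [lintegral_lintegral_swap (by fun_prop)]
      refine lintegral_congr fun w => ?_
      simp_rw [← mul_assoc]
      rw [lintegral_mul_const _ (by fun_prop)]
      have := lintegral_recordDensity_one hlam hv0 hv1 n ((c - β * w) / α, w)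
      simp only at this
      rw [this]
    · rw [recordOp_succ_one]
      have hm : Measurable fun p : ℝ × ℝ => if 0 < v 0 * p.1 + v 1 * p.2 then Φ p else 0 :=
        Measurable.ite (measurableSet_lt measurable_const (by fun_prop)) hΦ measurable_const
      have h1 : ∀ h, recordOp lam v α β (n + 1) 0 (c - β * h)
          (fun p => if 0 < v 0 * p.1 + v 1 * (p.2 + h) then Φ (p.1, p.2 + h) else 0) =
          ∫⁻ w, recordDensity lam v (n + 1) 0 ((c - β * w) / α, w - h) *
            (if 0 < v 0 * ((c - β * w) / α) + v 1 * w then Φ ((c - β * w) / α, w) else 0) := by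
        intro h
        refine (ih 0 _ (hm.comp
          (by fun_prop : Measurable fun p : ℝ × ℝ => (p.1, p.2 + h)))).trans ?_
        -- Recentre so that w counts the whole time in state 1, including the first holding time h;
        -- the point (u, w) then lies on the original line.
        rw [← lintegral_sub_right_eq_self _ h]
        refine lintegral_congr fun w => ?_
        have : (c - β * h - β * (w - h)) / α = (c - β * w) / α := by ring
        simp [this]
      simp_rw [h1]
      have hm2 : ∀ h, Measurable fun w => recordDensity lam v (n + 1) 0 ((c - β * w) / α, w - h) *
            (if 0 < v 0 * ((c - β * w) / α) + v 1 * w then Φ ((c - β * w) / α, w) else 0) :=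
        fun h => Measurable.mul (by fun_prop)
          (hm.comp (by fun_prop : Measurable fun w : ℝ => ((c - β * w) / α, w)))
      have h2 : ∀ h, expWeight (lam 1) h * ∫⁻ w, recordDensity lam v (n + 1) 0
            ((c - β * w) / α, w - h) *
            (if 0 < v 0 * ((c - β * w) / α) + v 1 * w then Φ ((c - β * w) / α, w) else 0) =
          ∫⁻ w, expWeight (lam 1) h * (recordDensity lam v (n + 1) 0 ((c - β * w) / α, w - h) *
            (if 0 < v 0 * ((c - β * w) / α) + v 1 * w then Φ ((c - β * w) / α, w) else 0)) :=
        fun h => (lintegral_const_mul _ (hm2 h)).symm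
      simp_rw [h2]
      rw [lintegral_lintegral_swap]
      · refine lintegral_congr fun w => ?_
        simp_rw [← mul_assoc]
        rw [lintegral_mul_const _ (by fun_prop)]
        have := lintegral_recordDensity_zero hlam hv0 hv1 n ((c - β * w) / α, w)
        simp only at this
        rw [← this]
        split_ifs <;> simp
      · refine (Measurable.mul (by fun_prop) (Measurable.mul (by fun_prop) ?_)).aemeasurable
        exact hm.comp (by fun_prop : Measurable fun p : ℝ × ℝ => ((c - β * p.2) / α, p.2))

include hlam hv0 hv1 in
-- Record paths end above their start. Hence the integral over all real levels in `switchOp` only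
-- sees positive levels.
lemma recordOp_of_nonpos_level {y : ℝ} (hy : y ≤ 0) (n : ℕ) (i : Fin 2) {Φ : ℝ × ℝ → ℝ≥0∞}
    (hΦ : Measurable Φ) : recordOp lam v (v 0) (v 1) n i y Φ = 0 := by
  rcases n with _ | n
  · simp [recordOp, hy.not_gt]
  · rw [recordOp_succ_eq_lintegral hlam hv0 hv1 hv0 n i y hΦ]
    rw [← lintegral_zero (μ := (volume : Measure ℝ))]
    refine lintegral_congr fun w => ?_
    rw [recordDensity, if_neg, zero_mul]
    rintro ⟨h1, h2⟩
    simp only at h1 h2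
    have : v 0 * ((y - v 1 * w) / v 0) + v 1 * w = y := by field_simp; ring
    linarith

include hv0 hv1 in
lemma occupation_position (t x : ℝ) : v 0 * xi0 v t x + v 1 * xi1 v t x = x := by
  have : v 0 - v 1 ≠ 0 := by linarith
  unfold xi0 xi1
  field_simp
  ring

include hv0 hv1 in
lemma xi1_pos_iff (t x : ℝ) : 0 < xi1 v t x ↔ x / v 0 < t := by
  unfold xi1
  rw [div_pos_iff_of_pos_right (by linarith), div_lt_iff₀ hv0, sub_pos, mul_comm]

@[fun_prop]
lemma measurable_xi0 : Measurable fun p : ℝ × ℝ => xi0 v p.1 p.2 := by unfold xi0; fun_prop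

@[fun_prop]
lemma measurable_xi1 : Measurable fun p : ℝ × ℝ => xi1 v p.1 p.2 := by unfold xi1; fun_prop

lemma passageDensity_zero (i : Fin 2) (t y : ℝ) : passageDensity lam v i 0 t y = 0 := by
  simp [passageDensity]

include hv0 hv1 in
-- Along γ₀u + γ₁w = y the elapsed time is t = y/γ₀ + ((γ₀ - γ₁)/γ₀) w, so the constant is the
-- Jacobian dw/dt: the passage density is the planar density read as a function of time.
lemma ofReal_passageDensity {n : ℕ} (i : Fin 2) {y : ℝ} (hy : 0 < y) (t : ℝ) :
    ENNReal.ofReal (passageDensity lam v i n t y) =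
      ENNReal.ofReal (v 0 / (v 0 - v 1)) * recordDensity lam v n i (xi0 v t y, xi1 v t y) := by
  have hd : 0 < v 0 - v 1 := by linarith
  have hpos := occupation_position hv0 hv1 t y
  unfold recordDensity
  simp only [hpos, hy, and_true, xi1_pos_iff hv0 hv1]
  by_cases ht : y / v 0 < t
  swap
  · simp [passageDensity, ht, hy, hy.not_gt]
  rw [if_pos ht, ← ENNReal.ofReal_mul (by positivity)]
  congr 1
  rcases Fin.exists_fin_two.1 ⟨i, rfl⟩ with rfl | rfl
  · simp only [passageDensity, recordFactor, hy, ht, true_and, if_true]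
    by_cases hn : n ≠ 0 ∧ Even n
    · have hn1 : n / 2 - 1 + 1 = n / 2 := by
        obtain ⟨h0, k, rfl⟩ := hn; omega
      rw [if_pos hn, if_pos hn, evenFactor, hn1, hpos, theta, zed]
      field_simp
    · simp [hn, hy.not_gt]
  · simp only [passageDensity, recordFactor, hy, ht, true_and, one_ne_zero, if_false]
    by_cases hn : Odd n
    · rw [if_pos hn, if_pos hn, oddFactor, hpos, theta, zed]
      field_simp
    · simp [hn, hy.not_gt]

lemma measurable_passageDensity (n : ℕ) (i : Fin 2) :
    Measurable fun p : ℝ × ℝ => passageDensity lam v i n p.1 p.2 := by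
  unfold passageDensity theta zed xi0 xi1
  have a : MeasurableSet {p : ℝ × ℝ | 0 < p.2 ∧ p.2 / v 0 < p.1} :=
    (measurableSet_lt measurable_const measurable_snd).inter
      (measurableSet_lt (by fun_prop) measurable_fst)
  have b : MeasurableSet {p : ℝ × ℝ | p.2 < 0 ∧ p.2 / v 1 < p.1} :=
    (measurableSet_lt measurable_snd measurable_const).inter
      (measurableSet_lt (by fun_prop) measurable_fst)
  by_cases h0 : n = 0 <;> by_cases h1 : Even n <;> by_cases h2 : i = 0 <;>
  simp only [h0, h1, h2, ne_eq, not_true, not_false_eq_true, if_true, if_false, and_true,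
    and_false, false_and, ← Nat.not_even_iff_odd]
  all_goals first
    | fun_prop
    | exact Measurable.ite a (by fun_prop) (by fun_prop)
    | exact Measurable.ite b (by fun_prop) (by fun_prop)
    | simp

include hlam hv0 hv1 in
/-- The first passage law through a positive level, in terms of its density. -/
lemma recordOp_level {y : ℝ} (hy : 0 < y) (n : ℕ) (i : Fin 2) {f : ℝ → ℝ≥0∞} (hf : Measurable f) :
    recordOp lam v (v 0) (v 1) n i y (fun p => f (p.1 + p.2)) =
      (if n = 0 ∧ i = 0 then ENNReal.ofReal (Real.exp (-lam 0 * (y / v 0))) * f (y / v 0) else 0)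
        + ∫⁻ t, ENNReal.ofReal (passageDensity lam v i n t y) * f t := by
  have hd : 0 < v 0 - v 1 := by linarith
  rcases n with _ | n
  · simp [recordOp, hy, passageDensity_zero]
  · rw [recordOp_succ_eq_lintegral hlam hv0 hv1 hv0 n i y (by fun_prop)]
    simp only [Nat.add_eq_zero_iff, one_ne_zero, and_false, false_and, if_false, zero_add]
    have hκ : (v 0 - v 1) / v 0 ≠ 0 := by positivity
    have h := lintegral_comp_affine (a := y / v 0) hκ
      (fun t => recordDensity lam v (n + 1) i (xi0 v t y, xi1 v t y) * f t)
      (by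
        refine Measurable.mul ?_ hf
        exact (measurable_recordDensity (n + 1) i).comp (Measurable.prodMk
          (measurable_xi0.comp (by fun_prop : Measurable fun t : ℝ => (t, y)))
          (measurable_xi1.comp (by fun_prop : Measurable fun t : ℝ => (t, y)))))
    have h1 : ∀ w, xi1 v (y / v 0 + (v 0 - v 1) / v 0 * w) y = w := by
      intro w; unfold xi1; field_simp; ring
    have h0 : ∀ w, xi0 v (y / v 0 + (v 0 - v 1) / v 0 * w) y = (y - v 1 * w) / v 0 := by
      intro w; unfold xi0; field_simp; ring
    have h2 : ∀ w, y / v 0 + (v 0 - v 1) / v 0 * w = (y - v 1 * w) / v 0 + w := by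
      intro w; field_simp; ring
    simp only [h0, h1] at h
    simp only [h2] at h
    rw [h, abs_of_pos (by positivity), inv_div, ← lintegral_const_mul]
    · simp_rw [ofReal_passageDensity hv0 hv1 i hy, mul_assoc]
    · refine Measurable.mul ?_ hf
      exact (measurable_recordDensity (n + 1) i).comp (Measurable.prodMk
          (measurable_xi0.comp (by fun_prop : Measurable fun t : ℝ => (t, y)))
          (measurable_xi1.comp (by fun_prop : Measurable fun t : ℝ => (t, y))))

include hlam hv0 hv1 in
/-- The law of the position at a time when the running maximum is attained, in terms of its
density. -/
lemma recordOp_time {t : ℝ} (ht : 0 < t) (n : ℕ) (i : Fin 2) {f : ℝ → ℝ≥0∞} (hf : Measurable f) :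
    recordOp lam v 1 1 n i t (fun p => f (v 0 * p.1 + v 1 * p.2)) =
      (if n = 0 ∧ i = 0 then ENNReal.ofReal (Real.exp (-lam 0 * t)) * f (v 0 * t) else 0)
        + ∫⁻ x in Ioi 0, ENNReal.ofReal (passageDensity lam v i n t x / v 0) * f x := by
  have hd : 0 < v 0 - v 1 := by linarith
  rcases n with _ | n
  · simp [recordOp, ht, passageDensity_zero]
  · rw [recordOp_succ_eq_lintegral hlam hv0 hv1 one_pos n i t (by fun_prop)]
    simp only [Nat.add_eq_zero_iff, one_ne_zero, and_false, false_and, if_false, zero_add]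
    -- Along u + w = t the position is x = γ₀t - (γ₀ - γ₁)w, with Jacobian 1/(γ₀ - γ₁). Compared
    -- with γ₀/(γ₀ - γ₁) for the passage density, this leaves a division by γ₀.
    have hκ : -(v 0 - v 1) ≠ 0 := by linarith
    have hm : Measurable fun x => recordDensity lam v (n + 1) i (xi0 v t x, xi1 v t x) :=
        (measurable_recordDensity (n + 1) i).comp (Measurable.prodMk
          (measurable_xi0.comp (by fun_prop : Measurable fun x : ℝ => (t, x)))
          (measurable_xi1.comp (by fun_prop : Measurable fun x : ℝ => (t, x))))
    have h := lintegral_comp_affine (a := v 0 * t) hκ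
      (fun x => recordDensity lam v (n + 1) i (xi0 v t x, xi1 v t x) * f x) (hm.mul hf)
    have h1 : ∀ w, xi1 v t (v 0 * t + -(v 0 - v 1) * w) = w := by
      intro w; unfold xi1; field_simp; ring
    have h0 : ∀ w, xi0 v t (v 0 * t + -(v 0 - v 1) * w) = t - w := by
      intro w; unfold xi0; field_simp; ring
    have h2 : ∀ w, v 0 * t + -(v 0 - v 1) * w = v 0 * (t - w) + v 1 * w := by
      intro w; ring
    simp only [h0, h1] at h
    simp only [h2] at h
    simp only [one_mul, div_one]
    rw [h, inv_neg, abs_neg, abs_of_pos (by positivity), ← lintegral_const_mul _ (by fun_prop),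
      ← lintegral_indicator measurableSet_Ioi]
    refine lintegral_congr fun x => ?_
    by_cases hx : 0 < x
    · rw [indicator_of_mem (by exact hx), ENNReal.ofReal_div_of_pos hv0,
        ofReal_passageDensity hv0 hv1 i hx, ← mul_assoc]
      congr 1
      rw [div_eq_inv_mul (v 0), ENNReal.ofReal_mul (by positivity), ENNReal.div_eq_inv_mul]
      have : (ENNReal.ofReal (v 0))⁻¹ * ENNReal.ofReal (v 0) = 1 :=
        ENNReal.inv_mul_cancel (by simpa using hv0) ENNReal.ofReal_ne_top
      rw [← one_mul (ENNReal.ofReal (v 0 - v 1)⁻¹ * recordDensity _ _ _ _ _), ← this]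
      ring
    · rw [indicator_of_notMem (by simpa using hx), recordDensity, if_neg, zero_mul, mul_zero]
      simp only [occupation_position hv0 hv1]
      tauto

end closedForm

/-! ### Paths with given holding times -/

/-- The number of switchings up to time `t`, for the holding times `h`. -/
def jumpCount (h : ℕ → ℝ) (t : ℝ) : ℕ := {n : ℕ | 1 ≤ n ∧ ∑ k ∈ Finset.range n, h k ≤ t}.ncard

/-- The telegraph path with holding times `h` and initial state `i`. -/
def path (v : Fin 2 → ℝ) (i : Fin 2) (h : ℕ → ℝ) (t : ℝ) : ℝ :=
  ∫ s in (0 : ℝ)..t, v (stateAfter i (jumpCount h s))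

/-- The holding times after the first one. -/
def tail (h : ℕ → ℝ) : ℕ → ℝ := fun k => h (k + 1)

@[fun_prop]
lemma measurable_tail : Measurable tail := by unfold tail; fun_prop

/-- The holding times are positive and their sum diverges. -/
structure Admissible (h : ℕ → ℝ) : Prop where
  pos : ∀ k, 0 < h k
  tendsto : Filter.Tendsto (fun n => ∑ k ∈ Finset.range n, h k) Filter.atTop Filter.atTop

lemma sum_range_succ_tail (h : ℕ → ℝ) (n : ℕ) :
    ∑ k ∈ Finset.range (n + 1), h k = h 0 + ∑ k ∈ Finset.range n, tail h k := by
  rw [Finset.sum_range_succ', add_comm]; rfl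

lemma stateAfter_zero (i : Fin 2) : stateAfter i 0 = i := by simp [stateAfter]

lemma stateAfter_succ (i : Fin 2) (n : ℕ) : stateAfter i (n + 1) = stateAfter (1 - i) n := by
  unfold stateAfter
  by_cases hn : Even n <;> fin_cases i <;> simp [hn, Nat.even_add_one]

namespace Admissible

variable {h : ℕ → ℝ} (H : Admissible h)

include H

lemma tail : Admissible (tail h) where
  pos k := H.pos (k + 1)
  tendsto := by
    have h1 := (Filter.tendsto_add_atTop_iff_nat 1).2 H.tendsto
    simp only [sum_range_succ_tail] at h1
    simpa using Filter.tendsto_atTop_add_const_left Filter.atTop (-h 0) h1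

/-- Divergence of the partial sums makes `ncard` a genuine count; for an infinite set it would
return the default value 0. -/
lemma finite_jumps (t : ℝ) : {n : ℕ | 1 ≤ n ∧ ∑ k ∈ Finset.range n, h k ≤ t}.Finite := by
  obtain ⟨N, hN⟩ := Filter.eventually_atTop.1 (H.tendsto.eventually_gt_atTop t)
  refine (finite_lt_nat N).subset fun n hn => ?_
  by_contra hc
  exact absurd hn.2 (not_le.2 (hN n (not_lt.1 hc)))

lemma le_sum {n : ℕ} (hn : 1 ≤ n) : h 0 ≤ ∑ k ∈ Finset.range n, h k :=
  Finset.single_le_sum (f := h) (fun k _ => (H.pos k).le) (Finset.mem_range.2 hn)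

lemma jumpCount_of_lt {t : ℝ} (ht : t < h 0) : jumpCount h t = 0 := by
  unfold jumpCount
  rw [ncard_eq_zero (H.finite_jumps t)]
  ext n
  simp only [mem_ofPred_eq, mem_empty_iff_false, iff_false, not_and, not_le]
  exact fun hn => ht.trans_le (H.le_sum hn)

lemma jumpCount_of_ge {t : ℝ} (ht : h 0 ≤ t) :
    jumpCount h t = jumpCount (Telegraph.tail h) (t - h 0) + 1 := by
  have e : {n : ℕ | 1 ≤ n ∧ ∑ k ∈ Finset.range n, h k ≤ t} = insert 1 ((fun n => n + 1) ''
      {n : ℕ | 1 ≤ n ∧ ∑ k ∈ Finset.range n, Telegraph.tail h k ≤ t - h 0}) := by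
    ext n
    rcases n with _ | n
    · simp
    · simp only [mem_ofPred_eq, sum_range_succ_tail, mem_insert_iff, mem_image,
        Nat.add_right_cancel_iff, exists_eq_right]
      rcases n with _ | n
      · simpa using ht
      · simp [le_sub_iff_add_le']
  unfold jumpCount
  rw [e, ncard_insert_of_notMem _ ((H.tail.finite_jumps _).image _),
    ncard_image_of_injective _ (add_left_injective 1)]
  simp

lemma monotone_jumpCount : Monotone (jumpCount h) := fun _ t hst =>
  ncard_le_ncard (fun _ hn => ⟨hn.1, hn.2.trans hst⟩) (H.finite_jumps t)

lemma intervalIntegrable_velocity (v : Fin 2 → ℝ) (i : Fin 2) (a b : ℝ) :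
    IntervalIntegrable (fun s => v (stateAfter i (jumpCount h s))) volume a b := by
  have hm : Measurable fun s => v (stateAfter i (jumpCount h s)) :=
    (measurable_from_top (f := fun n : ℕ => v (stateAfter i n))).comp
      H.monotone_jumpCount.measurable
  refine (intervalIntegrable_const (c := |v 0| + |v 1|)).mono_fun hm.aestronglyMeasurable ?_
  refine ae_of_all _ fun s => ?_
  simp only [Real.norm_eq_abs]
  rw [abs_of_nonneg (by positivity : 0 ≤ |v 0| + |v 1|)]
  generalize stateAfter i (jumpCount h s) = j
  have := abs_nonneg (v 0); have := abs_nonneg (v 1)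
  fin_cases j <;> simp

lemma path_of_le (v : Fin 2 → ℝ) (i : Fin 2) {t : ℝ} (h0 : 0 ≤ t) (ht : t ≤ h 0) :
    path v i h t = v i * t := by
  unfold path
  rw [intervalIntegral.integral_congr_ae (g := fun _ => v i)]
  · simp [mul_comm]
  · have : ∀ᵐ x : ℝ, x ≠ h 0 := by simp [ae_iff]
    filter_upwards [this] with x hx hx'
    rw [uIoc_of_le h0] at hx'
    rw [H.jumpCount_of_lt (lt_of_le_of_ne (hx'.2.trans ht) hx), stateAfter_zero]

lemma path_of_ge (v : Fin 2 → ℝ) (i : Fin 2) {t : ℝ} (ht : h 0 ≤ t) :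
    path v i h t = v i * h 0 + path v (1 - i) (Telegraph.tail h) (t - h 0) := by
  rw [← H.path_of_le v i (H.pos 0).le le_rfl]
  unfold path
  rw [← intervalIntegral.integral_add_adjacent_intervals (H.intervalIntegrable_velocity v i 0 (h 0))
    (H.intervalIntegrable_velocity v i (h 0) t)]
  congr 1
  have := intervalIntegral.integral_comp_sub_right (a := h 0) (b := t)
    (fun s => v (stateAfter (1 - i) (jumpCount (Telegraph.tail h) s))) (h 0)
  rw [sub_self] at this
  rw [← this]
  refine intervalIntegral.integral_congr fun s hs => ?_
  rw [uIcc_of_le ht] at hs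
  rw [H.jumpCount_of_ge hs.1, stateAfter_succ]

end Admissible

lemma path_zero (v : Fin 2 → ℝ) (i : Fin 2) (h : ℕ → ℝ) : path v i h 0 = 0 := by simp [path]

/-- Exactly `n` switchings occur up to time `t`. -/
def JumpsEq : ℕ → ℝ → (ℕ → ℝ) → Prop
  | 0, t, h => 0 ≤ t ∧ t < h 0
  | n + 1, t, h => h 0 ≤ t ∧ JumpsEq n (t - h 0) (tail h)

lemma Admissible.jumpsEq_iff {h : ℕ → ℝ} (H : Admissible h) {t : ℝ} (ht : 0 ≤ t) (n : ℕ) :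
    JumpsEq n t h ↔ jumpCount h t = n := by
  induction n generalizing h t with
  | zero =>
    simp only [JumpsEq, ht, true_and]
    refine ⟨H.jumpCount_of_lt, fun h1 => ?_⟩
    by_contra hc
    rw [H.jumpCount_of_ge (not_lt.1 hc)] at h1
    omega
  | succ n ih =>
    simp only [JumpsEq]
    by_cases hc : h 0 ≤ t
    · rw [ih H.tail (sub_nonneg.2 hc), H.jumpCount_of_ge hc]; simp [hc]
    · rw [H.jumpCount_of_lt (not_le.1 hc)]; simp [hc]

lemma measurableSet_jumpsEq (n : ℕ) : MeasurableSet {p : ℝ × (ℕ → ℝ) | JumpsEq n p.1 p.2} := by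
  induction n with
  | zero =>
    exact (measurableSet_le measurable_const measurable_fst).inter
      (measurableSet_lt measurable_fst (by fun_prop : Measurable fun p : ℝ × (ℕ → ℝ) => p.2 0))
  | succ n ih =>
    exact (measurableSet_le (by fun_prop : Measurable fun p : ℝ × (ℕ → ℝ) => p.2 0)
      measurable_fst).inter (ih.preimage
        (by fun_prop : Measurable fun p : ℝ × (ℕ → ℝ) => (p.1 - p.2 0, tail p.2)))

/-- The first time of the running maximum, the running maximum and the position at time `t`, for a
path with `n` switchings up to time `t`. -/
def maxData (v : Fin 2 → ℝ) : ℕ → Fin 2 → ℝ → (ℕ → ℝ) → ℝ × ℝ × ℝ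
  | 0, i, t, _ => if i = 0 then (t, v 0 * t, v 0 * t) else (0, 0, v 1 * t)
  | n + 1, i, t, h =>
      if 0 < v i * h 0 + (maxData v n (1 - i) (t - h 0) (tail h)).2.1 then
        (h 0, v i * h 0, v i * h 0) + maxData v n (1 - i) (t - h 0) (tail h)
      else (0, 0, v i * h 0 + (maxData v n (1 - i) (t - h 0) (tail h)).2.2)

lemma measurable_maxData (v : Fin 2 → ℝ) (n : ℕ) : ∀ i : Fin 2,
    Measurable fun p : ℝ × (ℕ → ℝ) => maxData v n i p.1 p.2 := by
  induction n with
  | zero => intro i; unfold maxData; split_ifs <;> fun_prop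
  | succ n ih =>
    intro i
    have h1 : Measurable fun p : ℝ × (ℕ → ℝ) =>
        maxData v n (1 - i) (p.1 - p.2 0) (tail p.2) :=
      (ih (1 - i)).comp (by fun_prop : Measurable fun p : ℝ × (ℕ → ℝ) => (p.1 - p.2 0, tail p.2))
    unfold maxData
    exact Measurable.ite (measurableSet_lt measurable_const (by fun_prop)) (by fun_prop)
      (by fun_prop)

/-- The strict inequality before the recorded time singles out the first maximiser, as `argMax`
requires. Correspondingly, `maxData` tests `0 <` strictly, so that a tie with the starting point is
resolved in favour of time 0. -/
lemma Admissible.maxData_spec {v : Fin 2 → ℝ} (hv0 : 0 < v 0) (hv1 : v 1 < 0) (n : ℕ) :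
    ∀ {h : ℕ → ℝ} (_ : Admissible h) {t : ℝ} (_ : 0 ≤ t) (i : Fin 2), jumpCount h t = n →
    (maxData v n i t h).2.2 = path v i h t ∧
    (maxData v n i t h).1 ∈ Icc 0 t ∧
    path v i h (maxData v n i t h).1 = (maxData v n i t h).2.1 ∧
    (∀ u ∈ Icc 0 t, path v i h u ≤ (maxData v n i t h).2.1) ∧
    (∀ u ∈ Ico 0 (maxData v n i t h).1, path v i h u < (maxData v n i t h).2.1) := by
  induction n with
  | zero =>
    intro h H t ht i hn
    have hth : t < h 0 := ((H.jumpsEq_iff ht 0).2 hn).2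
    have hp : ∀ u ∈ Icc 0 t, path v i h u = v i * u := fun u hu =>
      H.path_of_le v i hu.1 (hu.2.trans hth.le)
    rcases Fin.exists_fin_two.1 ⟨i, rfl⟩ with rfl | rfl
    · simp only [maxData, if_true]
      refine ⟨(hp t ⟨ht, le_rfl⟩).symm, ⟨ht, le_rfl⟩, hp t ⟨ht, le_rfl⟩, fun u hu => ?_,
        fun u hu => ?_⟩
      · rw [hp u hu]; exact mul_le_mul_of_nonneg_left hu.2 hv0.le
      · rw [hp u ⟨hu.1, hu.2.le⟩]; exact mul_lt_mul_of_pos_left hu.2 hv0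
    · simp only [maxData, one_ne_zero, if_false]
      refine ⟨(hp t ⟨ht, le_rfl⟩).symm, ⟨le_rfl, ht⟩, path_zero _ _ _, fun u hu => ?_,
        fun u hu => ?_⟩
      · rw [hp u hu]; exact mul_nonpos_of_nonpos_of_nonneg hv1.le hu.1
      · exact absurd hu.2 (not_lt.2 hu.1)
  | succ n ih =>
    intro h H t ht i hn
    obtain ⟨hth, hj⟩ := (H.jumpsEq_iff ht (n + 1)).2 hn
    have ht' : 0 ≤ t - h 0 := sub_nonneg.2 hth
    have hn' := (H.tail.jumpsEq_iff ht' n).1 hj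
    obtain ⟨e1, e2, e3, e4, e5⟩ := ih H.tail ht' (1 - i) hn'
    have hM := e4 0 ⟨le_rfl, ht'⟩
    rw [path_zero] at hM
    have hh := H.pos 0
    simp only [maxData]
    set d := maxData v n (1 - i) (t - h 0) (Telegraph.tail h) with hd
    have hiv : i = 0 ∨ i = 1 := Fin.exists_fin_two.1 ⟨i, rfl⟩
    split_ifs with hpos
    · simp only [Prod.fst_add, Prod.snd_add]
      refine ⟨by rw [H.path_of_ge v i hth, e1], ⟨by linarith [e2.1], by linarith [e2.2]⟩,
        by rw [H.path_of_ge v i (by linarith [e2.1]), add_sub_cancel_left, e3],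
        fun u hu => ?_, fun u hu => ?_⟩
      · rcases le_total (h 0) u with h1 | h1
        · rw [H.path_of_ge v i h1]
          linarith [e4 (u - h 0) ⟨by linarith, by linarith [hu.2]⟩]
        · rw [H.path_of_le v i hu.1 h1]
          rcases hiv with rfl | rfl
          · linarith [mul_le_mul_of_nonneg_left h1 hv0.le]
          · linarith [mul_nonpos_of_nonpos_of_nonneg hv1.le hu.1]
      · rcases le_or_gt (h 0) u with h1 | h1
        · rw [H.path_of_ge v i h1]
          linarith [e5 (u - h 0) ⟨by linarith, by linarith [hu.2]⟩]
        · rw [H.path_of_le v i hu.1 h1.le]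
          rcases hiv with rfl | rfl
          · linarith [mul_lt_mul_of_pos_left h1 hv0]
          · linarith [mul_nonpos_of_nonpos_of_nonneg hv1.le hu.1]
    · refine ⟨by rw [H.path_of_ge v i hth, e1], ⟨le_rfl, ht⟩, path_zero _ _ _, fun u hu => ?_,
        fun u hu => absurd hu.2 (not_lt.2 hu.1)⟩
      rcases hiv with rfl | rfl
      · exact absurd (by positivity) hpos
      · rcases le_total (h 0) u with h1 | h1
        · rw [H.path_of_ge v 1 h1]
          linarith [e4 (u - h 0) ⟨by linarith, by linarith [hu.2]⟩]
        · rw [H.path_of_le v 1 hu.1 h1]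
          exact mul_nonpos_of_nonpos_of_nonneg hv1.le hu.1

/-! ### First passage of a path with given holding times -/

/-- The level `y ≥ 0` is reached, for the first time after exactly `n` switchings. -/
def HitsAfter (v : Fin 2 → ℝ) : ℕ → Fin 2 → ℝ → (ℕ → ℝ) → Prop
  | 0, i, y, h => if i = 0 then 0 ≤ y ∧ y < v 0 * h 0 else y = 0
  | n + 1, i, y, h =>
      (if i = 0 then v 0 * h 0 ≤ y else 0 < y) ∧ HitsAfter v n (1 - i) (y - v i * h 0) (tail h)

/-- The time at which the level `y` is first reached, if that happens after `n` switchings. -/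
def firstHit (v : Fin 2 → ℝ) : ℕ → Fin 2 → ℝ → (ℕ → ℝ) → ℝ
  | 0, i, y, _ => y / v i
  | n + 1, i, y, h => h 0 + firstHit v n (1 - i) (y - v i * h 0) (tail h)

lemma measurableSet_hitsAfter (v : Fin 2 → ℝ) (n : ℕ) : ∀ i : Fin 2,
    MeasurableSet {p : ℝ × (ℕ → ℝ) | HitsAfter v n i p.1 p.2} := by
  induction n with
  | zero =>
    intro i
    unfold HitsAfter
    split_ifs
    · exact (measurableSet_le measurable_const measurable_fst).inter
        (measurableSet_lt measurable_fst
          (by fun_prop : Measurable fun p : ℝ × (ℕ → ℝ) => v 0 * p.2 0))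
    · exact measurableSet_eq_fun measurable_fst measurable_const
  | succ n ih =>
    intro i
    unfold HitsAfter
    have h1 := (ih (1 - i)).preimage
        (by fun_prop : Measurable fun p : ℝ × (ℕ → ℝ) => (p.1 - v i * p.2 0, tail p.2))
    split_ifs
    · exact (measurableSet_le (by fun_prop : Measurable fun p : ℝ × (ℕ → ℝ) => v 0 * p.2 0)
        measurable_fst).inter h1
    · exact (measurableSet_lt measurable_const measurable_fst).inter h1

lemma measurable_firstHit (v : Fin 2 → ℝ) (n : ℕ) : ∀ i : Fin 2,
    Measurable fun p : ℝ × (ℕ → ℝ) => firstHit v n i p.1 p.2 := by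
  induction n with
  | zero => intro i; unfold firstHit; fun_prop
  | succ n ih =>
    intro i
    have h1 := (ih (1 - i)).comp
        (by fun_prop : Measurable fun p : ℝ × (ℕ → ℝ) => (p.1 - v i * p.2 0, tail p.2))
    unfold firstHit
    exact Measurable.add (by fun_prop) h1

/-- A level met exactly at a switching instant counts that switching, in agreement with the `≤` in
`jumpCount`. Hence the half-open range y < γ₀ h₀ in state 0, and the base case y = 0 in state 1,
which receives the level γ₀ h₀ after the shift. -/
lemma Admissible.firstHit_spec {v : Fin 2 → ℝ} (hv0 : 0 < v 0) (hv1 : v 1 < 0) (n : ℕ) :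
    ∀ {h : ℕ → ℝ} (_ : Admissible h) {y : ℝ} (i : Fin 2), HitsAfter v n i y h →
    0 ≤ firstHit v n i y h ∧ path v i h (firstHit v n i y h) = y ∧
    (∀ u ∈ Ico 0 (firstHit v n i y h), path v i h u ≠ y) ∧
    jumpCount h (firstHit v n i y h) = n := by
  induction n with
  | zero =>
    intro h H y i hy
    rcases Fin.exists_fin_two.1 ⟨i, rfl⟩ with rfl | rfl
    · simp only [HitsAfter, if_true] at hy
      have hT : y / v 0 < h 0 := by rw [div_lt_iff₀ hv0, mul_comm]; exact hy.2
      have h0 : 0 ≤ y / v 0 := div_nonneg hy.1 hv0.le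
      simp only [firstHit]
      refine ⟨h0, ?_, fun u hu => ?_, H.jumpCount_of_lt hT⟩
      · rw [H.path_of_le v 0 h0 hT.le]; field_simp
      · rw [H.path_of_le v 0 hu.1 (hu.2.trans hT).le]
        have := (lt_div_iff₀ hv0).1 hu.2
        linarith
    · simp only [HitsAfter, one_ne_zero, if_false] at hy
      subst hy
      simp [firstHit, path_zero, H.jumpCount_of_lt (H.pos 0)]
  | succ n ih =>
    intro h H y i hy
    simp only [HitsAfter] at hy
    obtain ⟨e1, e2, e3, e4⟩ := ih H.tail (1 - i) hy.2
    simp only [firstHit]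
    have hle : h 0 ≤ h 0 + firstHit v n (1 - i) (y - v i * h 0) (Telegraph.tail h) := by linarith
    have hh := H.pos 0
    refine ⟨by linarith, ?_, fun u hu => ?_, ?_⟩
    · rw [H.path_of_ge v i hle, add_sub_cancel_left, e2]; ring
    · rcases le_or_gt (h 0) u with h1 | h1
      · rw [H.path_of_ge v i h1]
        have := e3 (u - h 0) ⟨by linarith, by linarith [hu.2]⟩
        contrapose! this
        linarith
      · rw [H.path_of_le v i hu.1 h1.le]
        rcases Fin.exists_fin_two.1 ⟨i, rfl⟩ with rfl | rfl
        · have h2 : v 0 * h 0 ≤ y := by simpa using hy.1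
          linarith [mul_lt_mul_of_pos_left h1 hv0]
        · have h2 : 0 < y := by simpa using hy.1
          linarith [mul_nonpos_of_nonpos_of_nonneg hv1.le hu.1]
    · rw [H.jumpCount_of_ge hle, add_sub_cancel_left, e4]

/-- The induction is on the number of switchings up to an arbitrary time at which the level is met;
the first hit may come earlier and after fewer switchings. -/
lemma Admissible.exists_hitsAfter {v : Fin 2 → ℝ} (hv0 : 0 < v 0) (hv1 : v 1 < 0) (m : ℕ) :
    ∀ {h : ℕ → ℝ} (_ : Admissible h) {y : ℝ} (_ : 0 ≤ y) (i : Fin 2) {u : ℝ} (_ : 0 ≤ u),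
    jumpCount h u = m → path v i h u = y → ∃ n, HitsAfter v n i y h := by
  induction m with
  | zero =>
    intro h H y hy i u hu hm hp
    have hth : u < h 0 := ((H.jumpsEq_iff hu 0).2 hm).2
    rw [H.path_of_le v i hu hth.le] at hp
    rcases Fin.exists_fin_two.1 ⟨i, rfl⟩ with rfl | rfl
    · refine ⟨0, ?_⟩
      simp only [HitsAfter, if_true]
      exact ⟨hy, hp ▸ (mul_lt_mul_iff_right₀ hv0).2 hth⟩
    · refine ⟨0, ?_⟩
      simp only [HitsAfter, one_ne_zero, if_false]
      exact le_antisymm (hp ▸ mul_nonpos_of_nonpos_of_nonneg hv1.le hu) hy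
  | succ m ih =>
    intro h H y hy i u hu hm hp
    obtain ⟨hth, hj⟩ := (H.jumpsEq_iff hu (m + 1)).2 hm
    have hu' : 0 ≤ u - h 0 := sub_nonneg.2 hth
    have hm' := (H.tail.jumpsEq_iff hu' m).1 hj
    rw [H.path_of_ge v i hth] at hp
    have hh := H.pos 0
    rcases Fin.exists_fin_two.1 ⟨i, rfl⟩ with rfl | rfl
    · rcases lt_or_ge y (v 0 * h 0) with h1 | h1
      · exact ⟨0, by simp [HitsAfter, hy, h1]⟩
      · obtain ⟨n, hn⟩ := ih H.tail (y := y - v 0 * h 0) (by linarith) (1 - 0) hu' hm'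
          (by linarith)
        exact ⟨n + 1, by simpa [HitsAfter, h1] using hn⟩
    · rcases hy.eq_or_lt with h1 | h1
      · exact ⟨0, by simp [HitsAfter, h1]⟩
      · obtain ⟨n, hn⟩ := ih H.tail (y := y - v 1 * h 0) (by nlinarith) (1 - 1) hu' hm'
          (by linarith)
        exact ⟨n + 1, by simpa [HitsAfter, h1] using hn⟩

/-! ### The law of the holding times -/

/-- The law of the holding times when the initial state is `i`. -/
def holdLaw (lam : Fin 2 → ℝ) (i : Fin 2) : Measure (ℕ → ℝ) :=
  Measure.infinitePi fun k => expMeasure (lam (stateAfter i k))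

/-- The sequence that starts with `p.1` and goes on with `p.2`. -/
def consSeq (p : ℝ × (ℕ → ℝ)) : ℕ → ℝ
  | 0 => p.1
  | k + 1 => p.2 k

lemma measurable_consSeq : Measurable consSeq :=
  measurable_pi_lambda _ fun k => by
    rcases k with _ | k
    · exact measurable_fst
    · exact (measurable_pi_apply k).comp measurable_snd

section holdLaw

variable {lam : Fin 2 → ℝ}

lemma expMeasure_prob (hlam : ∀ i, 0 < lam i) (i : Fin 2) :
    IsProbabilityMeasure (expMeasure (lam i)) := isProbabilityMeasure_expMeasure (hlam i)

lemma holdLaw_prob (hlam : ∀ i, 0 < lam i) (i : Fin 2) :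
    IsProbabilityMeasure (holdLaw lam i) := by
  have := expMeasure_prob hlam
  unfold holdLaw
  infer_instance

/-- The first holding time is independent of the rest, and the rest has alternating rates beginning
with the other state. The product measure is recognised by its values on finite boxes. -/
lemma map_consSeq (hlam : ∀ i, 0 < lam i) (i : Fin 2) :
    ((expMeasure (lam i)).prod (holdLaw lam (1 - i))).map consSeq = holdLaw lam i := by
  have := expMeasure_prob hlam
  have := holdLaw_prob hlam
  classical
  refine Measure.eq_infinitePi _ fun s t ht => ?_
  rw [Measure.map_apply measurable_consSeq (MeasurableSet.pi s.countable_toSet fun k _ => ht k)]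
  have e : consSeq ⁻¹' (Set.pi s t) = (if 0 ∈ s then t 0 else univ) ×ˢ
      Set.pi (s.preimage (· + 1) (add_left_injective 1).injOn : Finset ℕ)
        (fun k => t (k + 1)) := by
    ext ⟨x, h⟩
    simp only [mem_preimage, mem_pi, mem_prod, Finset.coe_preimage, SetLike.mem_coe]
    constructor
    · intro H
      refine ⟨?_, fun k hk => H (k + 1) hk⟩
      split_ifs with h0
      · exact H 0 h0
      · trivial
    · rintro ⟨h0, h1⟩ k hk
      rcases k with _ | k
      · rw [if_pos hk] at h0; exact h0
      · exact h1 k hk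
  rw [e, Measure.prod_prod, holdLaw, Measure.infinitePi_pi _ (fun k _ => ht (k + 1))]
  have hr : ∀ k, expMeasure (lam (stateAfter (1 - i) k)) (t (k + 1)) =
      expMeasure (lam (stateAfter i (k + 1))) (t (k + 1)) := fun k => by rw [stateAfter_succ]
  simp_rw [hr]
  rw [Finset.prod_preimage' (fun k : ℕ => k + 1) s (add_left_injective 1).injOn
    (fun k => expMeasure (lam (stateAfter i k)) (t k))]
  by_cases h0 : 0 ∈ s
  · rw [if_pos h0, ← Finset.mul_prod_erase s _ h0, stateAfter_zero]
    congr 1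
    refine Finset.prod_congr ?_ fun _ _ => rfl
    ext k
    rcases k with _ | k <;> simp
  · rw [if_neg h0, measure_univ, one_mul]
    refine Finset.prod_congr ?_ fun _ _ => rfl
    ext k
    rcases k with _ | k <;> simp [h0]

/-- The Markov property at the first switching; the recursions for `levelOp` and `maxOp` are
instances of it. -/
lemma lintegral_holdLaw (hlam : ∀ i, 0 < lam i) (i : Fin 2) {F : ℝ × (ℕ → ℝ) → ℝ≥0∞}
    (hF : Measurable F) : ∫⁻ h, F (h 0, tail h) ∂(holdLaw lam i) =
      ∫⁻ x, expWeight (lam i) x * ∫⁻ h, F (x, h) ∂(holdLaw lam (1 - i)) := by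
  have := expMeasure_prob hlam
  have := holdLaw_prob hlam
  rw [← map_consSeq hlam i, lintegral_map (by fun_prop) measurable_consSeq,
    lintegral_prod _ (by
      have hc := measurable_consSeq
      exact (hF.comp (by fun_prop :
        Measurable fun p => (consSeq p 0, tail (consSeq p)))).aemeasurable)]
  exact lintegral_expMeasure _ hF.lintegral_prod_right'

lemma map_eval_holdLaw (hlam : ∀ i, 0 < lam i) (i : Fin 2) (k : ℕ) :
    (holdLaw lam i).map (fun h => h k) = expMeasure (lam (stateAfter i k)) := by
  have := expMeasure_prob hlam
  exact Measure.infinitePi_map_eval (fun k => expMeasure (lam (stateAfter i k))) k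

lemma expMeasure_Iic_zero (l : ℝ) : expMeasure l (Iic 0) = 0 := by
  rw [← lintegral_indicator_one measurableSet_Iic,
    lintegral_expMeasure _ (measurable_one.indicator measurableSet_Iic),
    ← lintegral_zero (μ := (volume : Measure ℝ))]
  refine lintegral_congr fun x => ?_
  by_cases hx : x ≤ 0
  · simp [expWeight_of_nonpos hx]
  · simp [indicator, hx]

lemma expMeasure_Ioi_ne_zero {l : ℝ} (hl : 0 < l) : expMeasure l (Ioi 1) ≠ 0 := by
  rw [← lintegral_indicator_one measurableSet_Ioi,
    lintegral_expMeasure _ (measurable_one.indicator measurableSet_Ioi)]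
  have e : ∀ x, expWeight l x * (Ioi (1 : ℝ)).indicator 1 x =
      (Ioi (1 : ℝ)).indicator (expWeight l) x := fun x => by
    by_cases hx : 1 < x <;> simp [indicator, hx]
  simp_rw [e]
  rw [lintegral_indicator measurableSet_Ioi, Ne, lintegral_eq_zero_iff (by fun_prop)]
  intro h
  rw [Filter.EventuallyEq, ae_restrict_iff' measurableSet_Ioi, ae_iff] at h
  have hsub : Ioi (1 : ℝ) ⊆ {x | ¬ (x ∈ Ioi 1 → expWeight l x = (0 : ℝ → ℝ≥0∞) x)} := by
    intro x hx
    have hx0 : (0 : ℝ) < x := one_pos.trans hx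
    have : 0 < l * Real.exp (-l * x) := by positivity
    simp only [mem_ofPred_eq, Classical.not_imp]
    refine ⟨hx, ?_⟩
    rw [expWeight, if_pos hx0]
    simpa using this
  have := measure_mono_null hsub h
  simp at this

/-- Only two rates occur, so the probabilities of a holding time above 1 are bounded below. By
independence and the second Borel–Cantelli lemma infinitely many holding times exceed 1, which rules
out a convergent sum. -/
lemma ae_admissible (hlam : ∀ i, 0 < lam i) (i : Fin 2) :
    ∀ᵐ h ∂(holdLaw lam i), Admissible h := by
  have := expMeasure_prob hlam
  have := holdLaw_prob hlam
  have hpos : ∀ᵐ h ∂(holdLaw lam i), ∀ k, 0 < h k := by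
    refine ae_all_iff.2 fun k => ?_
    have h1 : ∀ᵐ x ∂(expMeasure (lam (stateAfter i k))), 0 < x := by
      rw [ae_iff]; simpa [Iic_def] using expMeasure_Iic_zero _
    rw [← map_eval_holdLaw hlam i k] at h1
    exact ae_of_ae_map (measurable_pi_apply k).aemeasurable h1
  have heval : ∀ n, holdLaw lam i {h | 1 < h n} = expMeasure (lam (stateAfter i n)) (Ioi 1) :=
    fun n => by
      rw [← map_eval_holdLaw hlam i n, Measure.map_apply (measurable_pi_apply n) measurableSet_Ioi]
      rfl
  have hms : ∀ n, MeasurableSet {h : ℕ → ℝ | 1 < h n} := fun n =>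
    measurableSet_lt measurable_const (measurable_pi_apply n)
  have hind : iIndepSet (fun n => {h : ℕ → ℝ | 1 < h n}) (holdLaw lam i) := by
    rw [iIndepSet_iff_meas_biInter hms]
    intro s
    have e : (⋂ n ∈ s, {h : ℕ → ℝ | 1 < h n}) = Set.pi s (fun _ => Ioi 1) := by
      ext h; simp [Set.pi]
    rw [e, holdLaw, Measure.infinitePi_pi _ (fun _ _ => measurableSet_Ioi)]
    exact Finset.prod_congr rfl fun n _ => (heval n).symm
  have hsum : ∑' n, holdLaw lam i {h | 1 < h n} = ∞ := by
    have h0 : min (expMeasure (lam 0) (Ioi 1)) (expMeasure (lam 1) (Ioi 1)) ≠ 0 := by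
      rcases min_choice (expMeasure (lam 0) (Ioi 1)) (expMeasure (lam 1) (Ioi 1)) with h | h <;>
        rw [h] <;> exact expMeasure_Ioi_ne_zero (hlam _)
    refine top_le_iff.1 ((ENNReal.tsum_const_eq_top_of_ne_zero (α := ℕ) h0).symm.le.trans
      (ENNReal.tsum_le_tsum fun n => ?_))
    rw [heval]
    generalize stateAfter i n = j
    rcases Fin.exists_fin_two.1 ⟨j, rfl⟩ with rfl | rfl
    · exact min_le_left _ _
    · exact min_le_right _ _
  have hls := measure_limsup_eq_one hms hind hsum
  have hls' : ∀ᵐ h ∂(holdLaw lam i), h ∈ Filter.limsup (fun n => {h : ℕ → ℝ | 1 < h n})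
      Filter.atTop :=
    (prob_compl_eq_zero_iff (MeasurableSet.measurableSet_limsup hms)).2 hls
  filter_upwards [hpos, hls'] with h h0 h1
  refine ⟨h0, ?_⟩
  rw [← not_summable_iff_tendsto_nat_atTop_of_nonneg fun k => (h0 k).le]
  intro hs
  rw [Filter.mem_limsup_iff_frequently_mem] at h1
  refine h1 ?_
  filter_upwards [hs.tendsto_atTop_zero.eventually_lt_const one_pos] with n hn
  exact fun h2 => lt_asymm hn h2

end holdLaw

/-! ### First passage and running maximum under the law of the holding times -/

/-- The integral of `f` against the law of the first passage time through `y`, on the event that it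
happens after `n` switchings. -/
def levelOp (lam v : Fin 2 → ℝ) (n : ℕ) (i : Fin 2) (y : ℝ) (f : ℝ → ℝ≥0∞) : ℝ≥0∞ :=
  ∫⁻ h, {h | HitsAfter v n i y h}.indicator (fun h => f (firstHit v n i y h)) h ∂(holdLaw lam i)

/-- The integral of `Ψ` against the joint law of the time of the maximum, the maximum and the
position at time `t > 0`, on the event of `n` switchings. -/
def maxOp (lam v : Fin 2 → ℝ) (n : ℕ) (i : Fin 2) (t : ℝ) (Ψ : ℝ × ℝ × ℝ → ℝ≥0∞) : ℝ≥0∞ :=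
  if 0 < t then
    ∫⁻ h, {h | JumpsEq n t h}.indicator (fun h => Ψ (maxData v n i t h)) h ∂(holdLaw lam i)
  else 0

/-- The integral of `f` against the law of the position at time `t` of a path that starts in state
`1` and stays nonpositive, on the event of `n` switchings. -/
def meanderOp (lam v : Fin 2 → ℝ) (n : ℕ) (t : ℝ) (f : ℝ → ℝ≥0∞) : ℝ≥0∞ :=
  maxOp lam v n 1 t fun d => if d.2.1 = 0 then f d.2.2 else 0

/-- The integral of `Ψ` against the joint law of the `(m + 1)`-st switching time and the position
at that time, on the event that this position is a strict record reached in state `0`. -/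
def switchOp (lam v : Fin 2 → ℝ) (m : ℕ) (i : Fin 2) (Ψ : ℝ × ℝ → ℝ≥0∞) : ℝ≥0∞ :=
  ENNReal.ofReal (lam 0 / v 0) *
    ∫⁻ y, recordOp lam v (v 0) (v 1) m i y (fun p => Ψ (p.1 + p.2, y))

lemma expWeight_ne_top (l h : ℝ) : expWeight l h ≠ ∞ := by
  unfold expWeight
  split_ifs <;> simp

lemma ae_ne_real (a : ℝ) : ∀ᵐ x : ℝ, x ≠ a := by simp [ae_iff]

lemma lintegral_expWeight_Ioi {l : ℝ} (hl : 0 < l) {a : ℝ} (ha : 0 ≤ a) :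
    ∫⁻ x, expWeight l x * (Ioi a).indicator 1 x = ENNReal.ofReal (Real.exp (-l * a)) := by
  have := isProbabilityMeasure_expMeasure hl
  rw [← lintegral_expMeasure _ (measurable_one.indicator measurableSet_Ioi),
    lintegral_indicator_one measurableSet_Ioi, ← compl_Iic,
    prob_compl_eq_one_sub measurableSet_Iic, ← ofReal_cdf, cdf_expMeasure_eq hl, if_pos ha,
    ← ENNReal.ofReal_one, ← ENNReal.ofReal_sub]
  · congr 1; ring_nf
  · have : Real.exp (-(l * a)) ≤ 1 := Real.exp_le_one_iff.2 (by nlinarith)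
    linarith

section

variable {lam v : Fin 2 → ℝ}

variable (hlam : ∀ i, 0 < lam i) (hv0 : 0 < v 0) (hv1 : v 1 < 0)

include hlam in
lemma lintegral_holdLaw_head (i : Fin 2) {f : ℝ → ℝ≥0∞} (hf : Measurable f) :
    ∫⁻ h, f (h 0) ∂(holdLaw lam i) = ∫⁻ x, expWeight (lam i) x * f x := by
  have := holdLaw_prob hlam
  rw [lintegral_holdLaw hlam i (F := fun p => f p.1) (by fun_prop)]
  simp

include hlam in
lemma levelOp_succ (n : ℕ) (i : Fin 2) (y : ℝ) {f : ℝ → ℝ≥0∞} (hf : Measurable f) :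
    levelOp lam v (n + 1) i y f = ∫⁻ x, expWeight (lam i) x *
      {x | if i = 0 then v 0 * x ≤ y else 0 < y}.indicator
        (fun x => levelOp lam v n (1 - i) (y - v i * x) (fun s => f (x + s))) x := by
  have hms : MeasurableSet {x : ℝ | if i = 0 then v 0 * x ≤ y else 0 < y} := by
    split_ifs
    · exact measurableSet_le (by fun_prop) measurable_const
    · exact MeasurableSet.const _
  let F : ℝ × (ℕ → ℝ) → ℝ≥0∞ := fun p =>
    {p : ℝ × (ℕ → ℝ) | p.1 ∈ {x : ℝ | if i = 0 then v 0 * x ≤ y else 0 < y}}.indicator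
      (fun p => {p : ℝ × (ℕ → ℝ) | HitsAfter v n (1 - i) (y - v i * p.1) p.2}.indicator
        (fun p => f (p.1 + firstHit v n (1 - i) (y - v i * p.1) p.2)) p) p
  have hF : Measurable F := by
    refine Measurable.indicator (Measurable.indicator ?_ ?_) (hms.preimage measurable_fst)
    · have := (measurable_firstHit v n (1 - i)).comp
        (by fun_prop : Measurable fun p : ℝ × (ℕ → ℝ) => (y - v i * p.1, p.2))
      exact hf.comp (measurable_fst.add this)
    · exact (measurableSet_hitsAfter v n (1 - i)).preimage
        (by fun_prop : Measurable fun p : ℝ × (ℕ → ℝ) => (y - v i * p.1, p.2))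
  have h1 := lintegral_holdLaw hlam i hF
  have e : levelOp lam v (n + 1) i y f = ∫⁻ h, F (h 0, tail h) ∂(holdLaw lam i) := by
    refine lintegral_congr fun h => ?_
    by_cases a : (if i = 0 then v 0 * h 0 ≤ y else 0 < y) <;>
    by_cases b : HitsAfter v n (1 - i) (y - v i * h 0) (tail h) <;>
    simp only [F, indicator, mem_ofPred_eq, HitsAfter, firstHit, a, b, and_true, and_false,
      if_true, if_false]
  rw [e, h1]
  refine lintegral_congr fun x => ?_
  congr 1
  simp only [F, indicator, mem_ofPred_eq, levelOp]
  split_ifs <;> simp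

include hlam hv0 hv1 in
-- Both sides satisfy the same recursion, except that a path may meet the level exactly at its first
-- switching out of state 0; this concerns the single holding time y/γ₀, a null set.
lemma levelOp_eq_recordOp (n : ℕ) : ∀ (i : Fin 2) {y : ℝ} (_ : 0 < y) {f : ℝ → ℝ≥0∞}
    (_ : Measurable f), levelOp lam v n i y f =
      recordOp lam v (v 0) (v 1) n i y (fun p => f (p.1 + p.2)) := by
  induction n with
  | zero =>
    intro i y hy f hf
    rcases Fin.exists_fin_two.1 ⟨i, rfl⟩ with rfl | rfl
    · rw [recordOp_zero_zero, if_pos hy, add_zero, ← lintegral_expWeight_Ioi (hlam 0)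
        (div_nonneg hy.le hv0.le), ← lintegral_holdLaw_head hlam 0
          (measurable_one.indicator measurableSet_Ioi), ← lintegral_mul_const]
      · refine lintegral_congr fun h => ?_
        have : y < v 0 * h 0 ↔ y / v 0 < h 0 := by rw [div_lt_iff₀ hv0, mul_comm]
        by_cases hc : y / v 0 < h 0 <;>
          simp [indicator, HitsAfter, firstHit, hy.le, this, hc]
      · exact (measurable_one.indicator measurableSet_Ioi).comp (measurable_pi_apply 0)
    · simp [recordOp_zero_one, levelOp, HitsAfter, hy.ne']
  | succ n ih =>
    intro i y hy f hf
    rw [levelOp_succ hlam n i y hf]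
    rcases Fin.exists_fin_two.1 ⟨i, rfl⟩ with rfl | rfl
    · rw [recordOp_succ_zero]
      refine lintegral_expWeight_congr ?_
      filter_upwards [ae_ne_real (y / v 0)] with x hx hx0
      have hx' : v 0 * x ≠ y := fun h => hx (by rw [← h]; field_simp)
      simp only [indicator, mem_ofPred_eq, if_true, sub_zero]
      rcases lt_or_gt_of_ne hx' with hlt | hlt
      · rw [if_pos hlt.le, ih 1 (by linarith) (by fun_prop)]
        refine recordOp_congr hv0 n _ _ fun u w _ _ _ _ => ?_
        simp only
        congr 1; ring
      · rw [if_neg (by linarith), recordOp_of_nonpos_level hlam hv0 hv1 (by linarith) _ _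
          (by fun_prop)]
    · rw [recordOp_succ_one]
      refine lintegral_expWeight_congr (ae_of_all _ fun x hx0 => ?_)
      simp only [indicator, mem_ofPred_eq, one_ne_zero, if_false, hy, if_true, sub_self]
      rw [ih 0 (by nlinarith) (by fun_prop)]
      refine recordOp_congr hv0 n _ _ fun u w _ _ hc _ => ?_
      simp only
      -- On the line of level y the endpoint condition of `recordOp` reads 0 < y, so it is
      -- automatic.
      rw [if_pos (by linarith)]
      congr 1; ring

/-! #### The running maximum -/

/-- The effect of a first holding time `x` in state `i` on the data of the running maximum. -/
def maxStep (v : Fin 2 → ℝ) (i : Fin 2) (x : ℝ) (d : ℝ × ℝ × ℝ) : ℝ × ℝ × ℝ :=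
  if 0 < v i * x + d.2.1 then (x, v i * x, v i * x) + d else (0, 0, v i * x + d.2.2)

lemma measurable_maxStep (i : Fin 2) :
    Measurable fun q : ℝ × (ℝ × ℝ × ℝ) => maxStep v i q.1 q.2 := by
  unfold maxStep
  exact Measurable.ite (measurableSet_lt measurable_const (by fun_prop)) (by fun_prop)
    (by fun_prop)

include hv0 in
lemma maxData_max_nonneg (n : ℕ) (i : Fin 2) {t : ℝ} {h : ℕ → ℝ} (hj : JumpsEq n t h) :
    0 ≤ (maxData v n i t h).2.1 := by
  rcases n with _ | n
  · simp only [maxData]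
    split_ifs
    · exact mul_nonneg hv0.le hj.1
    · exact le_rfl
  · simp only [maxData]
    split_ifs with hc
    · simpa using hc.le
    · exact le_rfl

lemma maxOp_of_nonpos {t : ℝ} (ht : t ≤ 0) (n : ℕ) (i : Fin 2) (Ψ : ℝ × ℝ × ℝ → ℝ≥0∞) :
    maxOp lam v n i t Ψ = 0 := if_neg ht.not_gt

lemma meanderOp_of_nonpos {t : ℝ} (ht : t ≤ 0) (n : ℕ) (f : ℝ → ℝ≥0∞) :
    meanderOp lam v n t f = 0 := maxOp_of_nonpos ht n 1 _

lemma maxOp_const_zero (n : ℕ) (i : Fin 2) (t : ℝ) : maxOp lam v n i t (fun _ => 0) = 0 := by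
  simp [maxOp]

lemma meanderOp_const_zero (n : ℕ) (t : ℝ) : meanderOp lam v n t (fun _ => 0) = 0 := by
  simp [meanderOp, maxOp_const_zero]

include hv0 in
lemma maxOp_congr (n : ℕ) (i : Fin 2) (t : ℝ) {Ψ Ψ' : ℝ × ℝ × ℝ → ℝ≥0∞}
    (h : ∀ d : ℝ × ℝ × ℝ, 0 ≤ d.2.1 → Ψ d = Ψ' d) : maxOp lam v n i t Ψ = maxOp lam v n i t Ψ' := by
  unfold maxOp
  split_ifs
  · refine lintegral_congr fun g => ?_
    simp only [indicator, mem_ofPred_eq]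
    split_ifs with hj
    · exact h _ (maxData_max_nonneg hv0 n i hj)
    · rfl
  · rfl

lemma measurable_maxOp_integrand {B : Type} [MeasurableSpace B] (n : ℕ) (i : Fin 2) {t : B → ℝ}
    {Ψ : B → ℝ × ℝ × ℝ → ℝ≥0∞} (ht : Measurable t)
    (hΨ : Measurable fun q : B × (ℝ × ℝ × ℝ) => Ψ q.1 q.2) :
    Measurable fun q : B × (ℕ → ℝ) =>
      {h | JumpsEq n (t q.1) h}.indicator (fun h => Ψ q.1 (maxData v n i (t q.1) h)) q.2 := by
  have hm : Measurable fun q : B × (ℕ → ℝ) => (t q.1, q.2) := by fun_prop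
  have h1 : Measurable fun q : B × (ℕ → ℝ) => Ψ q.1 (maxData v n i (t q.1) q.2) :=
    hΨ.comp (measurable_fst.prodMk ((measurable_maxData v n i).comp hm))
  exact h1.indicator ((measurableSet_jumpsEq n).preimage hm)

include hlam in
lemma measurable_maxOp {B : Type} [MeasurableSpace B] (n : ℕ) (i : Fin 2) {t : B → ℝ}
    {Ψ : B → ℝ × ℝ × ℝ → ℝ≥0∞} (ht : Measurable t)
    (hΨ : Measurable fun q : B × (ℝ × ℝ × ℝ) => Ψ q.1 q.2) :
    Measurable fun b => maxOp lam v n i (t b) (Ψ b) := by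
  have := holdLaw_prob hlam
  unfold maxOp
  exact Measurable.ite (measurableSet_lt measurable_const ht)
    (measurable_maxOp_integrand n i ht hΨ).lintegral_prod_right' measurable_const

include hlam in
lemma measurable_meanderOp {B : Type} [MeasurableSpace B] (n : ℕ) {t : B → ℝ}
    {f : B → ℝ → ℝ≥0∞} (ht : Measurable t) (hf : Measurable fun q : B × ℝ => f q.1 q.2) :
    Measurable fun b => meanderOp lam v n (t b) (f b) := by
  refine measurable_maxOp hlam n 1 ht ?_
  refine Measurable.ite (measurableSet_eq_fun (by fun_prop) measurable_const) ?_ measurable_const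
  exact hf.comp (by fun_prop : Measurable fun q : B × (ℝ × ℝ × ℝ) => (q.1, q.2.2.2))

lemma maxOp_add (n : ℕ) (i : Fin 2) (t : ℝ) {Ψ Ψ' : ℝ × ℝ × ℝ → ℝ≥0∞} (hΨ : Measurable Ψ) :
    maxOp lam v n i t (fun d => Ψ d + Ψ' d) = maxOp lam v n i t Ψ + maxOp lam v n i t Ψ' := by
  unfold maxOp
  split_ifs
  · rw [← lintegral_add_left]
    · refine lintegral_congr fun h => ?_
      simp only [indicator]
      split_ifs <;> simp
    · exact (measurable_maxOp_integrand (v := v) n i (t := fun _ : Unit => t) (Ψ := fun _ => Ψ)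
        measurable_const (by fun_prop)).comp (measurable_prodMk_left (x := ()))
  · simp

include hlam in
-- The convention that `maxOp` vanishes at nonpositive times encodes the restriction x < t on the
-- first holding time x. It disagrees with the condition x ≤ t of `JumpsEq` only at x = t, a null
-- set.
lemma maxOp_succ (n : ℕ) (i : Fin 2) (t : ℝ) {Ψ : ℝ × ℝ × ℝ → ℝ≥0∞} (hΨ : Measurable Ψ) :
    maxOp lam v (n + 1) i t Ψ = ∫⁻ x, expWeight (lam i) x *
      maxOp lam v n (1 - i) (t - x) (fun d => Ψ (maxStep v i x d)) := by
  by_cases ht : 0 < t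
  swap
  · rw [maxOp, if_neg ht, ← lintegral_zero (μ := (volume : Measure ℝ))]
    refine lintegral_congr fun x => ?_
    by_cases hx : 0 < x
    · rw [maxOp_of_nonpos (by linarith), mul_zero]
    · rw [expWeight_of_nonpos (not_lt.1 hx), zero_mul]
  let F : ℝ × (ℕ → ℝ) → ℝ≥0∞ := fun p => {p : ℝ × (ℕ → ℝ) | p.1 ≤ t}.indicator
    (fun p => {h | JumpsEq n (t - p.1) h}.indicator
      (fun h => Ψ (maxStep v i p.1 (maxData v n (1 - i) (t - p.1) h))) p.2) p
  have hF : Measurable F :=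
    (measurable_maxOp_integrand n (1 - i) (t := fun x => t - x)
      (Ψ := fun x d => Ψ (maxStep v i x d)) (by fun_prop) (hΨ.comp (measurable_maxStep i))).indicator
      (measurableSet_le measurable_fst measurable_const)
  have e : maxOp lam v (n + 1) i t Ψ = ∫⁻ h, F (h 0, tail h) ∂(holdLaw lam i) := by
    rw [maxOp, if_pos ht]
    refine lintegral_congr fun h => ?_
    by_cases a : h 0 ≤ t <;> by_cases b : JumpsEq n (t - h 0) (tail h) <;>
    simp only [F, indicator, mem_ofPred_eq, JumpsEq, maxData, maxStep, a, b, and_true, and_false,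
      if_true, if_false]
  rw [e, lintegral_holdLaw hlam i hF]
  refine lintegral_expWeight_congr ?_
  filter_upwards [ae_ne_real t] with x hx _
  rcases lt_or_gt_of_ne hx with hlt | hlt
  · simp only [F, maxOp, sub_pos, hlt, if_true]
    refine lintegral_congr fun h => ?_
    rw [indicator_of_mem (by exact hlt.le)]
  · rw [maxOp_of_nonpos (by linarith)]
    simp [F, indicator, hlt.not_ge]

include hlam hv0 in
lemma maxOp_succ_zero (n : ℕ) (t : ℝ) {Ψ : ℝ × ℝ × ℝ → ℝ≥0∞} (hΨ : Measurable Ψ) :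
    maxOp lam v (n + 1) 0 t Ψ = ∫⁻ x, expWeight (lam 0) x *
      maxOp lam v n 1 (t - x) (fun d => Ψ (x + d.1, v 0 * x + d.2.1, v 0 * x + d.2.2)) := by
  rw [maxOp_succ hlam n 0 t hΨ]
  refine lintegral_expWeight_congr (ae_of_all _ fun x hx => ?_)
  rw [sub_zero]
  refine maxOp_congr hv0 n 1 _ fun d hd => ?_
  rw [maxStep, if_pos (by positivity)]
  rfl

include hlam in
-- The paths whose maximum is attained at time 0 are not unfolded: their share of the recursion is
-- folded back into a meander with all n + 1 switchings.
lemma maxOp_succ_one (n : ℕ) (t : ℝ) {Ψ : ℝ × ℝ × ℝ → ℝ≥0∞} (hΨ : Measurable Ψ) :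
    maxOp lam v (n + 1) 1 t Ψ = meanderOp lam v (n + 1) t (fun x => Ψ (0, 0, x)) +
      ∫⁻ x, expWeight (lam 1) x * maxOp lam v n 0 (t - x) (fun d =>
        if 0 < v 1 * x + d.2.1 then Ψ (x + d.1, v 1 * x + d.2.1, v 1 * x + d.2.2) else 0) := by
  have hm : Measurable fun d : ℝ × ℝ × ℝ => if d.2.1 = 0 then Ψ (0, 0, d.2.2) else 0 :=
    Measurable.ite (measurableSet_eq_fun (by fun_prop) measurable_const) (by fun_prop)
      measurable_const
  rw [meanderOp, maxOp_succ hlam n 1 t hΨ, maxOp_succ hlam n 1 t hm, ← lintegral_add_left]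
  · refine lintegral_congr fun x => ?_
    rw [sub_self, ← mul_add, ← maxOp_add]
    · congr 2
      ext d
      by_cases hc : 0 < v 1 * x + d.2.1
      · have hM : (maxStep v 1 x d).2.1 = v 1 * x + d.2.1 := by rw [maxStep, if_pos hc]; rfl
        rw [hM, if_neg hc.ne', if_pos hc, zero_add, maxStep, if_pos hc]
        rfl
      · simp [maxStep, hc]
    · exact hm.comp ((measurable_maxStep 1).comp
        (by fun_prop : Measurable fun d : ℝ × ℝ × ℝ => (x, d)))
  · exact Measurable.mul (by fun_prop) (measurable_maxOp hlam n _ (by fun_prop)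
      (hm.comp (measurable_maxStep 1)))

end

/-! ### Decomposition at the time of the maximum -/

section

variable {lam v : Fin 2 → ℝ}

variable (hlam : ∀ i, 0 < lam i) (hv0 : 0 < v 0) (hv1 : v 1 < 0)

include hlam hv0 in
-- The substitution y = γ₀x turns (λ₀/γ₀) dy into λ₀ dx, the density of the holding time that ends
-- at the record; this justifies the weight in `switchOp`.
lemma switchOp_zero_zero {Ψ : ℝ × ℝ → ℝ≥0∞} (hΨ : Measurable Ψ) :
    switchOp lam v 0 0 Ψ = ∫⁻ x, expWeight (lam 0) x * Ψ (x, v 0 * x) := by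
  have h0 := (hlam 0).le
  have h := lintegral_comp_affine (a := 0) hv0.ne'
    (fun y => ENNReal.ofReal (lam 0) * (if 0 < y then
      ENNReal.ofReal (Real.exp (-lam 0 * (y / v 0))) * Ψ (y / v 0, y) else 0))
    (Measurable.mul measurable_const (Measurable.ite measurableSet_Ioi (by fun_prop)
      measurable_const))
  have hm : Measurable fun y => if 0 < y then
      ENNReal.ofReal (Real.exp (-lam 0 * (y / v 0))) * Ψ (y / v 0, y) else 0 :=
    Measurable.ite measurableSet_Ioi (by fun_prop) measurable_const
  simp only [switchOp, recordOp_zero_zero, add_zero]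
  rw [lintegral_const_mul _ hm, ← mul_assoc, ← ENNReal.ofReal_mul (abs_nonneg _),
    abs_of_pos (by positivity), inv_mul_eq_div] at h
  rw [← h]
  refine lintegral_congr fun x => ?_
  have e : v 0 * x / v 0 = x := by field_simp
  simp only [zero_add, e, expWeight, mul_pos_iff_of_pos_left hv0]
  split_ifs
  · rw [ENNReal.ofReal_mul h0, mul_assoc]
  · simp

lemma switchOp_zero_one (Ψ : ℝ × ℝ → ℝ≥0∞) : switchOp lam v 0 1 Ψ = 0 := by
  simp [switchOp, recordOp_zero_one]

/-- The level is translated by the displacement during the first holding time, which leaves the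
Lebesgue measure dy invariant. -/
lemma switchOp_succ_zero (m : ℕ) {Ψ : ℝ × ℝ → ℝ≥0∞} (hΨ : Measurable Ψ) :
    switchOp lam v (m + 1) 0 Ψ = ∫⁻ x, expWeight (lam 0) x *
      switchOp lam v m 1 (fun q => Ψ (q.1 + x, q.2 + v 0 * x)) := by
  simp only [switchOp, recordOp_succ_zero]
  have hm : Measurable fun q : ℝ × ℝ => recordOp lam v (v 0) (v 1) m 1 (q.1 - v 0 * q.2)
      (fun p => Ψ (p.1 + q.2 + p.2, q.1)) :=
    measurable_recordOp m 1 (by fun_prop) (by fun_prop)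
  rw [lintegral_lintegral_swap (by fun_prop), ← lintegral_const_mul' _ _ ENNReal.ofReal_ne_top]
  refine lintegral_congr fun x => ?_
  rw [lintegral_const_mul' _ _ (expWeight_ne_top _ _),
    ← lintegral_add_right_eq_self _ (v 0 * x), mul_left_comm]
  congr 3
  ext y
  rw [add_sub_cancel_right]
  congr 1
  ext p
  congr 2
  ring

include hv0 in
lemma switchOp_succ_one (m : ℕ) {Ψ : ℝ × ℝ → ℝ≥0∞} (hΨ : Measurable Ψ) :
    switchOp lam v (m + 1) 1 Ψ = ∫⁻ x, expWeight (lam 1) x *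
      switchOp lam v m 0 (fun q => if 0 < q.2 + v 1 * x then Ψ (q.1 + x, q.2 + v 1 * x) else 0) := by
  simp only [switchOp, recordOp_succ_one]
  have hm : Measurable fun q : ℝ × ℝ => recordOp lam v (v 0) (v 1) m 0 (q.1 - v 1 * q.2)
      (fun p => if 0 < v 0 * p.1 + v 1 * (p.2 + q.2) then Ψ (p.1 + (p.2 + q.2), q.1) else 0) := by
    refine measurable_recordOp m 0 (by fun_prop) ?_
    exact Measurable.ite (measurableSet_lt measurable_const (by fun_prop)) (by fun_prop)
      measurable_const
  rw [lintegral_lintegral_swap (by fun_prop), ← lintegral_const_mul' _ _ ENNReal.ofReal_ne_top]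
  refine lintegral_congr fun x => ?_
  rw [lintegral_const_mul' _ _ (expWeight_ne_top _ _),
    ← lintegral_add_right_eq_self _ (v 1 * x), mul_left_comm]
  congr 3
  ext y
  rw [add_sub_cancel_right]
  refine recordOp_congr hv0 m 0 _ fun u w _ _ hc _ => ?_
  have e1 : v 0 * u + v 1 * (w + x) = y + v 1 * x := by rw [← hc]; ring
  simp only [e1, ← add_assoc]

lemma measurable_switchOp {B : Type} [MeasurableSpace B] (m : ℕ) (i : Fin 2)
    {Ψ : B → ℝ × ℝ → ℝ≥0∞} (hΨ : Measurable fun q : B × (ℝ × ℝ) => Ψ q.1 q.2) :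
    Measurable fun b => switchOp lam v m i (Ψ b) := by
  unfold switchOp
  refine Measurable.const_mul (Measurable.lintegral_prod_right' (f := fun q : B × ℝ =>
    recordOp lam v (v 0) (v 1) m i q.2 fun p => Ψ q.1 (p.1 + p.2, q.2)) ?_) _
  refine measurable_recordOp m i (by fun_prop) ?_
  exact hΨ.comp (by fun_prop : Measurable fun q : (B × ℝ) × (ℝ × ℝ) =>
    (q.1.1, (q.2.1 + q.2.2, q.1.2)))

include hlam in
lemma measurable_postMaximum {B : Type} [MeasurableSpace B] (k : ℕ) {t : B → ℝ}
    {Ψ : B → ℝ × ℝ × ℝ → ℝ≥0∞} (ht : Measurable t)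
    (hΨ : Measurable fun q : B × (ℝ × ℝ × ℝ) => Ψ q.1 q.2) :
    Measurable fun q : B × (ℝ × ℝ) => meanderOp lam v k (t q.1 - q.2.1)
      (fun x => Ψ q.1 (q.2.1, q.2.2, q.2.2 + x)) := by
  refine measurable_meanderOp hlam k (by fun_prop) ?_
  exact hΨ.comp (by fun_prop : Measurable fun q : (B × (ℝ × ℝ)) × ℝ =>
    (q.1.1, (q.1.2.1, q.1.2.2, q.1.2.2 + q.2)))

include hlam hv0 in
/-- The joint law of the time of the maximum, the maximum and the position at time `t` is
decomposed according to whether the maximum is attained at time `t`, at time `0`, or at the `(m +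
1)`-st switching. -/
theorem maxOp_eq (n : ℕ) : ∀ (i : Fin 2) (t : ℝ) {Ψ : ℝ × ℝ × ℝ → ℝ≥0∞}, Measurable Ψ →
    maxOp lam v n i t Ψ =
      recordOp lam v 1 1 n i t
        (fun p => Ψ (p.1 + p.2, v 0 * p.1 + v 1 * p.2, v 0 * p.1 + v 1 * p.2))
      + (if i = 1 then meanderOp lam v n t (fun x => Ψ (0, 0, x)) else 0)
      + ∑ m ∈ Finset.range n, switchOp lam v m i (fun q =>
          meanderOp lam v (n - (m + 1)) (t - q.1) (fun x => Ψ (q.1, q.2, q.2 + x))) := by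
  induction n with
  | zero =>
    intro i t Ψ hΨ
    have := holdLaw_prob hlam
    rcases Fin.exists_fin_two.1 ⟨i, rfl⟩ with rfl | rfl
    · simp only [Finset.range_zero, Finset.sum_empty, add_zero, zero_ne_one, if_false,
        recordOp_zero_zero, maxOp]
      split_ifs with ht
      · rw [← lintegral_expWeight_Ioi (hlam 0) (div_nonneg ht.le zero_le_one),
          ← lintegral_holdLaw_head hlam 0
            (measurable_one.indicator measurableSet_Ioi), ← lintegral_mul_const]
        · refine lintegral_congr fun h => ?_
          by_cases hc : t < h 0 <;>
            simp [indicator, JumpsEq, maxData, ht.le, hc]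
        · exact (measurable_one.indicator measurableSet_Ioi).comp (measurable_pi_apply 0)
      · rfl
    · simp only [Finset.range_zero, Finset.sum_empty, add_zero, if_true, recordOp_zero_one,
        zero_add, meanderOp, maxOp]
      simp [maxData]
  | succ n ih =>
    intro i t Ψ hΨ
    rcases Fin.exists_fin_two.1 ⟨i, rfl⟩ with rfl | rfl
    · rw [maxOp_succ_zero hlam hv0 n t hΨ, recordOp_succ_zero, Finset.sum_range_succ',
        switchOp_zero_zero hlam hv0 (measurable_meanderOp hlam _ (by fun_prop) (by fun_prop))]
      have hsucc : ∀ m, switchOp lam v (m + 1) 0 (fun q => meanderOp lam v (n + 1 - (m + 1 + 1))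
            (t - q.1) (fun x => Ψ (q.1, q.2, q.2 + x))) = ∫⁻ x, expWeight (lam 0) x *
          switchOp lam v m 1 (fun q => meanderOp lam v (n - (m + 1)) (t - x - q.1)
            (fun z => Ψ (x + q.1, v 0 * x + q.2, v 0 * x + (q.2 + z)))) := fun m => by
        rw [switchOp_succ_zero m (measurable_meanderOp hlam _ (by fun_prop) (by fun_prop))]
        refine lintegral_congr fun x => ?_
        congr 2
        ext q
        have e1 : n + 1 - (m + 1 + 1) = n - (m + 1) := by omega
        have e2 : t - (x + q.1) = t - x - q.1 := by ring
        have e3 : q.1 + x = x + q.1 := by ring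
        have e4 : q.2 + v 0 * x = v 0 * x + q.2 := by ring
        simp only [e1, e2, e3, e4]
        simp only [add_assoc]
      simp_rw [hsucc]
      have hmΨ : ∀ x, Measurable fun d : ℝ × ℝ × ℝ => Ψ (x + d.1, v 0 * x + d.2.1, v 0 * x + d.2.2) :=
        fun x => by fun_prop
      simp_rw [fun x => ih 1 (t - x) (hmΨ x)]
      have hA : Measurable fun x => recordOp lam v 1 1 n 1 (t - x) (fun p => Ψ (x + (p.1 + p.2),
          v 0 * x + (v 0 * p.1 + v 1 * p.2), v 0 * x + (v 0 * p.1 + v 1 * p.2))) :=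
        measurable_recordOp n 1 (by fun_prop) (by fun_prop)
      have hB : Measurable fun x => meanderOp lam v n (t - x)
          (fun z => Ψ (x, v 0 * x, v 0 * x + z)) :=
        measurable_meanderOp hlam n (by fun_prop) (by fun_prop)
      have hC : ∀ m, Measurable fun x => switchOp lam v m 1 (fun q =>
          meanderOp lam v (n - (m + 1)) (t - x - q.1)
            (fun z => Ψ (x + q.1, v 0 * x + q.2, v 0 * x + (q.2 + z)))) := fun m =>
        measurable_switchOp m 1 (measurable_postMaximum hlam _ (t := fun x => t - x)
          (Ψ := fun x d => Ψ (x + d.1, v 0 * x + d.2.1, v 0 * x + d.2.2))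
          (by fun_prop) (by fun_prop))
      simp only [if_true, mul_add, Finset.mul_sum, zero_ne_one, if_false, add_zero]
      rw [lintegral_add_left (by fun_prop), lintegral_add_left (by fun_prop),
        lintegral_finsetSum _ (fun m _ => by have := hC m; fun_prop), add_assoc]
      congr 1
      · refine lintegral_congr fun x => ?_
        rw [one_mul]
        congr 2
        ext p
        congr 2
        · ring
        · congr 1 <;> ring
      -- The meander term for the path after the first switching means that the maximum is attained
      -- at that switching; it is the summand m = 0, moved here to the end.
      · rw [add_comm]
        congr 1
    -- From state 1 the first switching is a local minimum, so the summand m = 0 vanishes, and the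
    -- two meander terms agree as they stand.
    · rw [maxOp_succ_one hlam n t hΨ, recordOp_succ_one, Finset.sum_range_succ',
        switchOp_zero_one, add_zero, if_pos rfl, add_comm (lintegral _ _)
          (meanderOp lam v (n + 1) t _), add_assoc]
      congr 1
      have hsucc : ∀ m, switchOp lam v (m + 1) 1 (fun q => meanderOp lam v (n + 1 - (m + 1 + 1))
            (t - q.1) (fun x => Ψ (q.1, q.2, q.2 + x))) = ∫⁻ x, expWeight (lam 1) x *
          switchOp lam v m 0 (fun q => meanderOp lam v (n - (m + 1)) (t - x - q.1)
            (fun z => if 0 < v 1 * x + q.2 then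
              Ψ (x + q.1, v 1 * x + q.2, v 1 * x + (q.2 + z)) else 0)) := fun m => by
        rw [switchOp_succ_one hv0 m (measurable_meanderOp hlam _ (by fun_prop) (by fun_prop))]
        refine lintegral_congr fun x => ?_
        congr 2
        ext q
        have e1 : n + 1 - (m + 1 + 1) = n - (m + 1) := by omega
        have e2 : t - (x + q.1) = t - x - q.1 := by ring
        have e3 : q.1 + x = x + q.1 := by ring
        have e4 : q.2 + v 1 * x = v 1 * x + q.2 := by ring
        simp only [e1, e2, e3, e4]
        simp only [add_assoc]
        split_ifs
        · rfl
        · rw [meanderOp_const_zero]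
      simp_rw [hsucc]
      have hm2 : Measurable fun q : ℝ × (ℝ × ℝ × ℝ) => if 0 < v 1 * q.1 + q.2.2.1 then
          Ψ (q.1 + q.2.1, v 1 * q.1 + q.2.2.1, v 1 * q.1 + q.2.2.2) else 0 :=
        Measurable.ite (measurableSet_lt measurable_const (by fun_prop)) (by fun_prop)
          measurable_const
      have hmΨ : ∀ x, Measurable fun d : ℝ × ℝ × ℝ => if 0 < v 1 * x + d.2.1 then
          Ψ (x + d.1, v 1 * x + d.2.1, v 1 * x + d.2.2) else 0 :=
        fun x => hm2.comp (measurable_prodMk_left (x := x))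
      simp_rw [fun x => ih 0 (t - x) (hmΨ x)]
      have hA : Measurable fun x => recordOp lam v 1 1 n 0 (t - x) (fun p =>
          if 0 < v 1 * x + (v 0 * p.1 + v 1 * p.2) then Ψ (x + (p.1 + p.2),
          v 1 * x + (v 0 * p.1 + v 1 * p.2), v 1 * x + (v 0 * p.1 + v 1 * p.2)) else 0) :=
        measurable_recordOp n 0 (by fun_prop) (hm2.comp (by fun_prop :
          Measurable fun q : ℝ × (ℝ × ℝ) =>
            (q.1, (q.2.1 + q.2.2, v 0 * q.2.1 + v 1 * q.2.2, v 0 * q.2.1 + v 1 * q.2.2))))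
      have hC : ∀ m, Measurable fun x => switchOp lam v m 0 (fun q =>
          meanderOp lam v (n - (m + 1)) (t - x - q.1)
            (fun z => if 0 < v 1 * x + q.2 then
              Ψ (x + q.1, v 1 * x + q.2, v 1 * x + (q.2 + z)) else 0)) := fun m =>
        measurable_switchOp m 0 (measurable_postMaximum hlam _ (t := fun x => t - x)
          (Ψ := fun x d => if 0 < v 1 * x + d.2.1 then
            Ψ (x + d.1, v 1 * x + d.2.1, v 1 * x + d.2.2) else 0) (by fun_prop) hm2)
      simp only [zero_ne_one, if_false, mul_add, Finset.mul_sum, add_zero]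
      rw [lintegral_add_left (by fun_prop),
        lintegral_finsetSum _ (fun m _ => by have := hC m; fun_prop)]
      congr 1
      refine lintegral_congr fun x => ?_
      rw [one_mul]
      congr 2
      ext p
      have e1 : v 1 * x + (v 0 * p.1 + v 1 * p.2) = v 0 * p.1 + v 1 * (p.2 + x) := by ring
      have e2 : x + (p.1 + p.2) = p.1 + (p.2 + x) := by ring
      have e3 : v 0 * p.1 + (v 1 * p.2 + v 1 * x) = v 0 * p.1 + v 1 * (p.2 + x) := by ring
      rw [e1, e2, e3]

end

/-! ### Paths that stay below a level -/

/-- The integral of `f` against the law of the position at time `t` of a path that starts in state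
`i`, has `n` switchings and stays below the level `a`, by the law of the first holding time. -/
def stayOp (lam v : Fin 2 → ℝ) : ℕ → Fin 2 → ℝ → ℝ → (ℝ → ℝ≥0∞) → ℝ≥0∞
  | 0, i, a, t, f =>
      if 0 < t ∧ v i * t < a then ENNReal.ofReal (Real.exp (-lam i * t)) * f (v i * t) else 0
  | n + 1, i, a, t, f => ∫⁻ x, expWeight (lam i) x *
      (if v i * x < a then
        stayOp lam v n (1 - i) (a - v i * x) (t - x) (fun z => f (v i * x + z)) else 0)

/-- The switching rates after exchanging the two states. -/
def flipRate (lam : Fin 2 → ℝ) (i : Fin 2) : ℝ := lam (1 - i)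

/-- The velocities after exchanging the two states and reflecting space. -/
def flipVel (v : Fin 2 → ℝ) (i : Fin 2) : ℝ := -v (1 - i)

section

variable {lam v : Fin 2 → ℝ}

lemma measurable_stayOp (n : ℕ) : ∀ (i : Fin 2) {B : Type} [MeasurableSpace B] {a t : B → ℝ}
    {f : B → ℝ → ℝ≥0∞}, Measurable a → Measurable t → Measurable (fun q : B × ℝ => f q.1 q.2) →
    Measurable fun b => stayOp lam v n i (a b) (t b) (f b) := by
  induction n with
  | zero =>
    intro i B _ a t f ha ht hf
    unfold stayOp
    refine Measurable.ite ((measurableSet_lt measurable_const ht).inter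
      (measurableSet_lt (by fun_prop) ha)) ?_ measurable_const
    exact Measurable.mul (by fun_prop) (hf.comp (by fun_prop : Measurable fun b => (b, v i * t b)))
  | succ n ih =>
    intro i B _ a t f ha ht hf
    unfold stayOp
    refine Measurable.lintegral_prod_right' (f := fun q : B × ℝ => expWeight (lam i) q.2 *
      (if v i * q.2 < a q.1 then stayOp lam v n (1 - i) (a q.1 - v i * q.2) (t q.1 - q.2)
        (fun z => f q.1 (v i * q.2 + z)) else 0)) ?_
    refine Measurable.mul (by fun_prop) (Measurable.ite (measurableSet_lt (by fun_prop)
      (by fun_prop)) (ih (1 - i) (by fun_prop) (by fun_prop) ?_) measurable_const)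
    exact hf.comp (by fun_prop : Measurable fun q : (B × ℝ) × ℝ => (q.1.1, v i * q.1.2 + q.2))

variable (hlam : ∀ i, 0 < lam i) (hv0 : 0 < v 0) (hv1 : v 1 < 0)

include hlam hv0 hv1 in
-- The two sides differ only where the path touches the level a without crossing it. This has
-- measure zero once a holding time is integrated over; for n = 0 nothing is integrated, which is
-- why the endpoint is excluded by hypothesis.
lemma maxOp_eq_stayOp (n : ℕ) : ∀ (i : Fin 2) {a t : ℝ} {f : ℝ → ℝ≥0∞}, 0 ≤ a → Measurable f →
    (n = 0 → v i * t ≠ a) →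
    maxOp lam v n i t (fun d => if d.2.1 ≤ a then f d.2.2 else 0) = stayOp lam v n i a t f := by
  induction n with
  | zero =>
    intro i a t f ha hf hne
    simp only [stayOp, maxOp]
    by_cases ht : 0 < t
    swap
    · simp [ht]
    have hM : ∀ h, (if (maxData v 0 i t h).2.1 ≤ a then f (maxData v 0 i t h).2.2 else 0) =
        if v i * t < a then f (v i * t) else 0 := by
      intro h
      have := hne rfl
      rcases Fin.exists_fin_two.1 ⟨i, rfl⟩ with rfl | rfl
      · simp [maxData, le_iff_lt_or_eq, this]
      · have h1 : v 1 * t < a := by nlinarith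
        simp [maxData, ha, h1]
    simp only [hM, ht, if_true, true_and]
    split_ifs with hc
    · rw [← lintegral_expWeight_Ioi (hlam i) ht.le, ← lintegral_holdLaw_head hlam i
          (measurable_one.indicator measurableSet_Ioi), ← lintegral_mul_const]
      · refine lintegral_congr fun h => ?_
        by_cases hc : t < h 0 <;> simp [indicator, JumpsEq, ht.le, hc]
      · exact (measurable_one.indicator measurableSet_Ioi).comp (measurable_pi_apply 0)
    · simp
  | succ n ih =>
    intro i a t f ha hf hne
    rw [maxOp_succ hlam n i t (Measurable.ite (measurableSet_le (by fun_prop) measurable_const)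
      (by fun_prop) measurable_const), stayOp]
    have hd : v i - v (1 - i) ≠ 0 := by
      rcases Fin.exists_fin_two.1 ⟨i, rfl⟩ with rfl | rfl
      · simp only [sub_zero]; linarith
      · simp only [sub_self]; linarith
    have hvi : v i ≠ 0 := by
      rcases Fin.exists_fin_two.1 ⟨i, rfl⟩ with rfl | rfl
      exacts [hv0.ne', hv1.ne]
    refine lintegral_expWeight_congr ?_
    -- The first excluded value puts the first switching at the level a. The second puts the
    -- endpoint there when the remaining path has no switching, and so supplies the side condition
    -- of the induction hypothesis.
    filter_upwards [ae_ne_real (a / v i), ae_ne_real ((a - v (1 - i) * t) / (v i - v (1 - i)))]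
      with x hx1 hx2 hx
    have hx1' : v i * x ≠ a := fun h => hx1 (by rw [← h]; field_simp)
    have hstep : ∀ d : ℝ × ℝ × ℝ, 0 ≤ d.2.1 →
        (if (maxStep v i x d).2.1 ≤ a then f (maxStep v i x d).2.2 else 0) =
        if d.2.1 ≤ a - v i * x then f (v i * x + d.2.2) else 0 := by
      intro d hd0
      by_cases h1 : 0 < v i * x + d.2.1
      · have e1 : maxStep v i x d = (x + d.1, v i * x + d.2.1, v i * x + d.2.2) := by
          rw [maxStep, if_pos h1]; rfl
        simp only [e1, le_sub_iff_add_le']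
      · rw [maxStep, if_neg h1, if_pos ha, if_pos (by linarith)]
    rw [maxOp_congr hv0 n _ _ hstep]
    split_ifs with hc
    · refine ih (1 - i) (a := a - v i * x) (f := fun z => f (v i * x + z)) (by linarith)
        (by fun_prop) fun _ h => hx2 ?_
      rw [eq_div_iff hd]
      linarith
    · have hlt : a < v i * x := lt_of_le_of_ne (not_lt.1 hc) (Ne.symm hx1')
      rw [maxOp_congr hv0 n _ _ (Ψ' := fun _ => 0) fun d hd0 => if_neg (by linarith),
        maxOp_const_zero]

include hlam in
/-- The law of a path that stays below a level, by the law of the last holding time. -/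
lemma stayOp_succ_last (n : ℕ) : ∀ (i : Fin 2) (a t : ℝ) {f : ℝ → ℝ≥0∞}, Measurable f →
    stayOp lam v (n + 1) i a t f =
      ENNReal.ofReal (lam (stateAfter i n) / lam (stateAfter i (n + 1))) *
      ∫⁻ r, expWeight (lam (stateAfter i (n + 1))) r * stayOp lam v n i a (t - r)
        (fun z => if z + v (stateAfter i (n + 1)) * r < a
          then f (z + v (stateAfter i (n + 1)) * r) else 0) := by
  induction n with
  | zero =>
    intro i a t f hf
    rw [← lintegral_sub_left_eq_self _ t, ← lintegral_const_mul' _ _ ENNReal.ofReal_ne_top]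
    simp only [stayOp, stateAfter_succ, stateAfter_zero]
    refine lintegral_congr fun x => ?_
    have e : t - (t - x) = x := by ring
    have h0 := hlam i; have h1 := hlam (1 - i)
    rw [e]
    simp only [expWeight, sub_pos]
    have e1 : v (1 - i) * (t - x) < a - v i * x ↔ v i * x + v (1 - i) * (t - x) < a := by
      constructor <;> intro h <;> linarith
    simp only [e1]
    by_cases hx : 0 < x
    swap
    · simp [hx]
    by_cases hx2 : x < t
    swap
    · simp [hx2]
    by_cases hx3 : v i * x < a
    swap
    · simp [hx3]
    by_cases hx4 : v i * x + v (1 - i) * (t - x) < a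
    swap
    · simp [hx4]
    simp only [hx, hx2, hx3, hx4, if_true, true_and]
    simp only [← mul_assoc]
    congr 1
    rw [← ENNReal.ofReal_mul (by positivity), ← ENNReal.ofReal_mul (by positivity),
      ← ENNReal.ofReal_mul (by positivity)]
    congr 1
    field_simp
  | succ n ih =>
    intro i a t f hf
    rw [stayOp]
    rw [stateAfter_succ i n, stateAfter_succ i (n + 1)]
    -- The unfinished last interval carries a survival probability, all others a density. Splitting
    -- the last one off as a density costs it an extra rate, while the interval before it becomes
    -- unfinished and loses its own; the ratio repairs both.
    set c := ENNReal.ofReal (lam (stateAfter (1 - i) n) / lam (stateAfter (1 - i) (n + 1)))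
    set j := stateAfter (1 - i) (n + 1)
    have h1 : ∀ x, expWeight (lam i) x * (if v i * x < a then stayOp lam v (n + 1) (1 - i)
        (a - v i * x) (t - x) (fun z => f (v i * x + z)) else 0) =
        ∫⁻ r, c * (expWeight (lam j) r * (expWeight (lam i) x * (if v i * x < a then
          stayOp lam v n (1 - i) (a - v i * x) (t - r - x)
            (fun z => if v i * x + z + v j * r < a then f (v i * x + z + v j * r) else 0)
          else 0))) := by
      intro x
      rw [lintegral_const_mul' _ _ ENNReal.ofReal_ne_top]
      split_ifs with hc
      · rw [ih (1 - i) _ _ (by fun_prop), mul_left_comm,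
          ← lintegral_const_mul' _ _ (expWeight_ne_top _ _)]
        congr 2
        ext r
        rw [mul_left_comm]
        congr 3
        · ring
        · ext z
          have e1 : z + v j * r < a - v i * x ↔ v i * x + z + v j * r < a := by
            constructor <;> intro h <;> linarith
          simp only [e1, j, add_assoc]
      · simp
    simp_rw [h1]
    rw [lintegral_lintegral_swap]
    · rw [← lintegral_const_mul' c _ ENNReal.ofReal_ne_top]
      refine lintegral_congr fun r => ?_
      rw [lintegral_const_mul' c _ ENNReal.ofReal_ne_top,
        lintegral_const_mul' _ _ (expWeight_ne_top _ _)]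
      rfl
    · refine (Measurable.const_mul (Measurable.mul (by fun_prop) (Measurable.mul (by fun_prop)
        (Measurable.ite (measurableSet_lt (by fun_prop) measurable_const) ?_
          measurable_const))) c).aemeasurable
      refine measurable_stayOp n (1 - i) (by fun_prop) (by fun_prop) ?_
      exact Measurable.ite (measurableSet_lt (by fun_prop) measurable_const) (by fun_prop)
        measurable_const

include hlam hv1 in
/-- Reversal of time: paths that stay below their starting point correspond to paths that end at a
record of the reflected process. -/
lemma stayOp_eq_recordOp (n : ℕ) : ∀ (t : ℝ) {f : ℝ → ℝ≥0∞}, Measurable f →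
    stayOp lam v n 1 0 t f = ENNReal.ofReal (lam 1 / lam (stateAfter 1 n)) *
      recordOp (flipRate lam) (flipVel v) 1 1 n (stateAfter 0 n) t
        (fun p => f (-(flipVel v 0 * p.1 + flipVel v 1 * p.2))) := by
  have e0 : flipRate lam 0 = lam 1 := by simp [flipRate]
  have e1 : flipRate lam 1 = lam 0 := by simp [flipRate]
  have e2 : flipVel v 0 = -v 1 := by simp [flipVel]
  have e3 : flipVel v 1 = -v 0 := by simp [flipVel]
  have l0 := hlam 0
  have l1 := hlam 1
  induction n with
  | zero =>
    intro t f hf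
    have h1 : (0 < t ∧ v 1 * t < 0) ↔ 0 < t := ⟨fun h => h.1, fun h => ⟨h, by nlinarith⟩⟩
    rw [stateAfter_zero, stateAfter_zero, recordOp_zero_zero, stayOp, div_self l1.ne', e0, e2]
    simp [h1]
  | succ n ih =>
    intro t f hf
    rw [stayOp_succ_last hlam n 1 0 t hf]
    have hm : ∀ r, Measurable fun z => if z + v (stateAfter 1 (n + 1)) * r < 0
        then f (z + v (stateAfter 1 (n + 1)) * r) else 0 := fun r =>
      Measurable.ite (measurableSet_lt (by fun_prop) measurable_const) (by fun_prop)
        measurable_const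
    simp_rw [fun r => ih (t - r) (hm r)]
    rcases Nat.even_or_odd n with hn | hn
    -- The last interval is spent in state 0, where the path rises. That it ends below 0 is a
    -- genuine constraint, namely the indicator in `recordOp` for the reversed path.
    · have hn' : ¬ Even (n + 1) := by simpa [Nat.even_add_one] using hn
      simp only [stateAfter, hn, hn', if_true, if_false, sub_self, sub_zero, div_self l1.ne',
        ENNReal.ofReal_one, one_mul]
      rw [recordOp_succ_one, e1]
      congr 2
      ext r
      rw [one_mul]
      congr 2
      ext p
      rw [e2, e3]
      have c1 : -(-v 1 * p.1 + -v 0 * p.2) + v 0 * r = -(-v 1 * p.1 + -v 0 * (p.2 + r)) := by ring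
      rw [c1]
      simp only [neg_lt_zero]
    · have hn1 : ¬ Even n := by simpa using hn
      have hn' : Even (n + 1) := by simpa [Nat.even_add_one] using hn
      simp only [stateAfter, hn1, hn', if_true, if_false, sub_self, sub_zero, div_self l1.ne',
        ENNReal.ofReal_one, one_mul]
      rw [recordOp_succ_zero, e0, ← lintegral_const_mul' _ _ ENNReal.ofReal_ne_top]
      refine lintegral_congr fun r => ?_
      rw [mul_left_comm]
      by_cases hr : 0 < r
      swap
      · simp [expWeight_of_nonpos (not_lt.1 hr)]
      congr 1
      rw [← mul_assoc, ← ENNReal.ofReal_mul (by positivity), one_mul]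
      have c0 : lam 0 / lam 1 * (lam 1 / lam 0) = 1 := by field_simp
      rw [c0, ENNReal.ofReal_one, one_mul]
      -- The last interval is spent in state 1: the path is already below 0 and descends further, so
      -- the endpoint condition holds automatically.
      refine recordOp_congr one_pos n _ _ fun u w _ _ _ hp => ?_
      have hp' : 0 < flipVel v 0 * u + flipVel v 1 * w := hp.resolve_right one_ne_zero
      rw [e2, e3] at hp' ⊢
      have c1 : -(-v 1 * u + -v 0 * w) + v 1 * r = -(-v 1 * (u + r) + -v 0 * w) := by ring
      simp only [c1]
      rw [if_pos (by nlinarith)]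

/-! ### Explicit functions under exchange of the states, and the meander law -/

include hv0 hv1 in
lemma xi0_flip (t x : ℝ) : xi0 (flipVel v) t x = xi1 v t (-x) := by
  have : v 0 - v 1 ≠ 0 := by linarith
  have h2 : -v 1 + v 0 ≠ 0 := by linarith
  simp only [xi0, xi1, flipVel, sub_zero, sub_self, sub_neg_eq_add]
  field_simp
  ring

include hv0 hv1 in
lemma xi1_flip (t x : ℝ) : xi1 (flipVel v) t x = xi0 v t (-x) := by
  have : v 0 - v 1 ≠ 0 := by linarith
  have h2 : -v 1 + v 0 ≠ 0 := by linarith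
  simp only [xi0, xi1, flipVel, sub_zero, sub_self, sub_neg_eq_add]
  field_simp
  ring

include hv0 hv1 in
lemma zed_flip (t x : ℝ) : zed (flipRate lam) (flipVel v) t x = zed lam v t (-x) := by
  simp only [zed, xi0_flip hv0 hv1, xi1_flip hv0 hv1, flipRate, sub_zero, sub_self]
  ring

include hv0 hv1 in
lemma theta_flip (t x : ℝ) : theta (flipRate lam) (flipVel v) t x = theta lam v t (-x) := by
  simp only [theta, xi0_flip hv0 hv1, xi1_flip hv0 hv1, flipRate, flipVel, sub_zero, sub_self]
  congr 1
  · congr 1; ring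
  · ring

include hv0 hv1 in
lemma passageDensity_flip (n : ℕ) (i : Fin 2) (t y : ℝ) :
    passageDensity (flipRate lam) (flipVel v) i n t y = passageDensity lam v (1 - i) n t (-y) := by
  have a1 : ∀ c : ℝ, y / -c = -y / c := fun c => by rw [div_neg, neg_div]
  simp only [passageDensity, xi0_flip hv0 hv1, xi1_flip hv0 hv1, zed_flip hv0 hv1,
    theta_flip hv0 hv1]
  rcases Fin.exists_fin_two.1 ⟨i, rfl⟩ with rfl | rfl
  · simp only [flipRate, flipVel, if_true, sub_zero, sub_self, one_ne_zero, if_false, a1,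
      Left.neg_neg_iff, Left.neg_pos_iff]
    by_cases h1 : 0 < y
    · simp only [h1, h1.not_gt, true_and, false_and, if_false]
      split_ifs <;> ring
    · simp only [h1, false_and, if_false]
      split_ifs <;> ring
  · simp only [flipRate, flipVel, if_true, sub_zero, sub_self, one_ne_zero, if_false, a1,
      Left.neg_neg_iff, Left.neg_pos_iff]
    by_cases h1 : 0 < y
    · simp only [h1, h1.not_gt, true_and, false_and, if_false]
      split_ifs <;> ring
    · simp only [h1, false_and, if_false]
      split_ifs <;> ring

include hlam hv1 in
-- This is the shape produced by time reversal: the ratio of rates from `stayOp_eq_recordOp`, and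
-- the division in `recordOp_time` by the upward velocity of the reflected process, which is -γ₁.
lemma meanderNegDensity_eq (n : ℕ) {t x : ℝ} (hx : x < 0) : meanderNegDensity lam v n t x =
    lam 1 / lam (stateAfter 1 n) * (passageDensity lam v (stateAfter 1 n) n t x / (-v 1)) := by
  have hc : v 1 * t < x ↔ x / v 1 < t := by
    rw [div_lt_iff_of_neg hv1, mul_comm]
  have l0 := (hlam 0).ne'
  have l1 := (hlam 1).ne'
  have v1 := hv1.ne
  simp only [meanderNegDensity, passageDensity, hx, hx.not_gt, hc, and_true, true_and, false_and,
    if_false]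
  by_cases ht : x / v 1 < t
  swap
  · simp [ht]
  rcases Nat.even_or_odd n with hn | hn
  · have hn' : ¬ Odd n := by simpa using hn
    simp only [stateAfter, hn, hn', ht, if_true, if_false, and_true, true_and, one_ne_zero]
    by_cases h0 : n = 0
    · simp [h0]
    · simp only [h0, ne_eq, not_false_eq_true, if_true]
      field_simp
  · have hn' : ¬ Even n := by simpa using hn
    simp only [stateAfter, hn, hn', ht, if_true, if_false, and_self, sub_self]
    field_simp
    ring

lemma meanderNegDensity_of_nonneg (n : ℕ) {t x : ℝ} (hx : 0 ≤ x) :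
    meanderNegDensity lam v n t x = 0 := by
  simp [meanderNegDensity, hx.not_gt]

include hlam hv0 hv1 in
/-- The law of a path that stays nonpositive, in terms of its density. -/
lemma meanderOp_eq (n : ℕ) {t : ℝ} (ht : 0 < t) {f : ℝ → ℝ≥0∞} (hf : Measurable f) :
    meanderOp lam v n t f =
      (if n = 0 then ENNReal.ofReal (Real.exp (-lam 1 * t)) * f (v 1 * t) else 0)
        + ∫⁻ x, ENNReal.ofReal (meanderNegDensity lam v n t x) * f x := by
  have l0 := hlam 0
  have l1 := hlam 1
  have hF0 : 0 < flipVel v 0 := by simpa [flipVel] using hv1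
  have hF1 : flipVel v 1 < 0 := by simpa [flipVel] using hv0
  have hlamF : ∀ i, 0 < flipRate lam i := fun i => hlam _
  have h1 : meanderOp lam v n t f = stayOp lam v n 1 0 t f := by
    rw [← maxOp_eq_stayOp hlam hv0 hv1 n 1 le_rfl hf fun _ => by nlinarith]
    refine maxOp_congr hv0 n 1 t fun d hd => ?_
    have : d.2.1 = 0 ↔ d.2.1 ≤ 0 := ⟨fun h => h.le, fun h => le_antisymm h hd⟩
    simp only [this]
  rw [h1, stayOp_eq_recordOp hlam hv1 n t hf,
    recordOp_time hlamF hF0 hF1 ht n _ (f := fun x => f (-x)) (by fun_prop), mul_add]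
  congr 1
  · by_cases hn : n = 0
    · subst hn
      simp [stateAfter_zero, div_self l1.ne', flipRate, flipVel]
    · simp [hn]
  · have hneg : ∀ g : ℝ → ℝ≥0∞, ∫⁻ x, g (-x) = ∫⁻ x, g x := fun g => lintegral_neg_eq_self g
    rw [← lintegral_const_mul' _ _ ENNReal.ofReal_ne_top, ← lintegral_indicator measurableSet_Ioi,
      ← hneg fun x => ENNReal.ofReal (meanderNegDensity lam v n t x) * f x]
    refine lintegral_congr fun x => ?_
    by_cases hx : 0 < x
    · rw [indicator_of_mem (by exact hx), meanderNegDensity_eq hlam hv1 n (by linarith),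
        ← mul_assoc, ← ENNReal.ofReal_mul (div_pos l1 (hlam _)).le, passageDensity_flip hv0 hv1]
      have : 1 - stateAfter 0 n = stateAfter 1 n := by
        unfold stateAfter; split_ifs <;> simp
      rw [this]
      simp [flipVel]
    · rw [indicator_of_notMem (by simpa using hx), meanderNegDensity_of_nonneg n (by linarith)]
      simp

end

/-! ### Summation over the number of switchings -/

lemma hasSum_besselI (m : ℕ) {z : ℝ} (hz : 0 < z) :
    HasSum (fun k : ℕ => z ^ k / ((k ! : ℝ) * ((k + m)! : ℝ)))
      (besselI m (2 * √z) / √z ^ m) := by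
  have hs : √z ^ m ≠ 0 := (pow_pos (Real.sqrt_pos.2 hz) m).ne'
  have hsum : Summable fun k : ℕ => z ^ k / ((k ! : ℝ) * ((k + m)! : ℝ)) := by
    refine Summable.of_nonneg_of_le (fun k => by positivity) (fun k => ?_)
      (Real.summable_pow_div_factorial z)
    refine div_le_div_of_nonneg_left (by positivity) (by positivity) ?_
    exact le_mul_of_one_le_right (by positivity) (by exact_mod_cast Nat.factorial_pos (k + m))
  have h2 : besselI m (2 * √z) / √z ^ m = ∑' k : ℕ, z ^ k / ((k ! : ℝ) * ((k + m)! : ℝ)) := by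
    rw [besselI, ← tsum_div_const]
    refine tsum_congr fun k => ?_
    have h3 : (2 * √z / 2) ^ (2 * k + m) = z ^ k * √z ^ m := by
      rw [mul_div_cancel_left₀ _ two_ne_zero, pow_add, pow_mul, Real.sq_sqrt hz.le]
    rw [h3]
    field_simp
  rw [h2]
  exact hsum.hasSum

section

variable {lam v : Fin 2 → ℝ}

lemma hasSum_calI0 {t x : ℝ} (hz : 0 < zed lam v t x) :
    HasSum (fun k : ℕ => zed lam v t x ^ k / (k ! : ℝ) ^ 2) (calI0 lam v t x) := by
  simpa [calI0, sq] using hasSum_besselI 0 hz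

lemma hasSum_calI1 {t x : ℝ} (hz : 0 < zed lam v t x) :
    HasSum (fun k : ℕ => zed lam v t x ^ k / ((k ! : ℝ) * ((k + 1)! : ℝ))) (calI1 lam v t x) := by
  simpa [calI1] using hasSum_besselI 1 hz

variable (hlam : ∀ i, 0 < lam i) (hv0 : 0 < v 0) (hv1 : v 1 < 0)

include hv0 hv1 in
lemma xi_pos {t y : ℝ} (hy : 0 < y) (ht : y / v 0 < t) : 0 < xi0 v t y ∧ 0 < xi1 v t y := by
  have h1 : 0 < t := (div_pos hy hv0).trans ht
  rw [div_lt_iff₀ hv0] at ht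
  exact ⟨div_pos (by nlinarith) (by linarith), div_pos (by nlinarith) (by linarith)⟩

include hv0 hv1 in
lemma theta_pos (t y : ℝ) : 0 < theta lam v t y :=
  div_pos (Real.exp_pos _) (by linarith)

include hlam in
lemma zed_pos {t y : ℝ} (h : 0 < xi0 v t y ∧ 0 < xi1 v t y) : 0 < zed lam v t y :=
  mul_pos (mul_pos (mul_pos (hlam 0) (hlam 1)) h.1) h.2

include hv0 hv1 in
lemma passageTotalDensity_flip (i : Fin 2) (t y : ℝ) :
    passageTotalDensity (flipRate lam) (flipVel v) i t y =
      passageTotalDensity lam v (1 - i) t (-y) := by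
  have a1 : ∀ c : ℝ, y / -c = -y / c := fun c => by rw [div_neg, neg_div]
  simp only [passageTotalDensity, calI0, calI1, xi0_flip hv0 hv1, xi1_flip hv0 hv1,
    zed_flip hv0 hv1, theta_flip hv0 hv1]
  rcases Fin.exists_fin_two.1 ⟨i, rfl⟩ with rfl | rfl
  all_goals
    simp only [flipRate, flipVel, if_true, sub_zero, sub_self, one_ne_zero, if_false, a1,
      Left.neg_neg_iff, Left.neg_pos_iff]
    by_cases h1 : 0 < y
    · simp only [h1, h1.not_gt, true_and, false_and, if_false]
      split_ifs <;> ring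
    · simp only [h1, false_and, if_false]
      split_ifs <;> ring

include hlam hv0 hv1 in
lemma passageDensity_nonneg_of_pos (i : Fin 2) (n : ℕ) (t : ℝ) {y : ℝ} (hy : 0 < y) :
    0 ≤ passageDensity lam v i n t y := by
  by_cases ht : y / v 0 < t
  swap
  · simp [passageDensity, ht, hy.not_gt]
  have l0 := hlam 0
  have l1 := hlam 1
  obtain ⟨h0, h1⟩ := xi_pos hv0 hv1 hy ht
  have hz := zed_pos hlam ⟨h0, h1⟩
  have hth := theta_pos (lam := lam) hv0 hv1 t y
  have hf : ∀ k : ℕ, 0 ≤ y - v 1 / ((k : ℝ) + 1) * xi1 v t y := fun k => by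
    have : v 1 / ((k : ℝ) + 1) * xi1 v t y ≤ 0 :=
      mul_nonpos_of_nonpos_of_nonneg (div_nonpos_of_nonpos_of_nonneg hv1.le (by positivity)) h1.le
    linarith
  have := hf (n / 2)
  simp only [passageDensity, hy, hy.not_gt, ht, true_and, false_and, if_false]
  split_ifs <;> positivity

include hlam hv0 hv1 in
-- Parity leaves the terms n = 2k + 2 for a start in state 0 and n = 2k + 1 for a start in state 1.
-- In the odd terms the factor 1/(k + 1) turns 1/k!² into 1/(k!(k + 1)!), which separates the I₀
-- part from the I₁ part.
lemma hasSum_passageDensity_of_pos (i : Fin 2) (t : ℝ) {y : ℝ} (hy : 0 < y) :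
    HasSum (fun n => passageDensity lam v i n t y) (passageTotalDensity lam v i t y) := by
  by_cases ht : y / v 0 < t
  swap
  · simp [passageDensity, passageTotalDensity, ht, hy.not_gt]
  have hz := zed_pos hlam (xi_pos hv0 hv1 hy ht)
  rcases Fin.exists_fin_two.1 ⟨i, rfl⟩ with rfl | rfl
  · have hinj : Function.Injective fun k : ℕ => 2 * k + 2 := fun a b h => by simpa using h
    refine (hinj.hasSum_iff fun n hn => ?_).1 ?_
    · have : ¬ (n ≠ 0 ∧ Even n) := fun ⟨h0, k, hk⟩ => hn ⟨k - 1, by simp only; omega⟩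
      simp only [passageDensity, hy, ht, this, hy.not_gt, true_and, false_and, if_false, if_true]
    · have h := (((hasSum_calI1 hz).mul_left (lam 0 * lam 1 * y)).mul_right (theta lam v t y))
      simp only [passageTotalDensity, hy, ht, and_self, if_true]
      refine h.congr_fun fun k => ?_
      have e1 : Even (2 * k + 2) := ⟨k + 1, by ring⟩
      have e2 : (2 * k + 2) / 2 = k + 1 := by omega
      simp [passageDensity, hy, ht, e1, e2]
  · have hinj : Function.Injective fun k : ℕ => 2 * k + 1 := fun a b h => by simpa using h
    refine (hinj.hasSum_iff fun n hn => ?_).1 ?_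
    · have : ¬ Odd n := fun ⟨k, hk⟩ => hn ⟨k, hk.symm⟩
      simp only [passageDensity, hy, ht, this, hy.not_gt, and_false, false_and, if_false,
        one_ne_zero]
    · have h := ((((hasSum_calI0 hz).mul_left y).sub ((hasSum_calI1 hz).mul_left
        (v 1 * xi1 v t y))).mul_left (lam 1 / xi0 v t y)).mul_right (theta lam v t y)
      simp only [passageTotalDensity, hy, ht, and_self, if_true, one_ne_zero, if_false]
      refine h.congr_fun fun k => ?_
      have e1 : Odd (2 * k + 1) := ⟨k, rfl⟩
      have e2 : (2 * k + 1) / 2 = k := by omega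
      simp only [passageDensity, hy, ht, e1, e2, one_ne_zero, if_false, if_true, and_self,
        Function.comp_apply]
      rw [Nat.factorial_succ]
      push_cast
      field_simp

include hlam hv0 hv1 in
lemma passageDensity_nonneg (i : Fin 2) (n : ℕ) (t y : ℝ) :
    0 ≤ passageDensity lam v i n t y := by
  rcases lt_trichotomy y 0 with hy | rfl | hy
  · have h := passageDensity_nonneg_of_pos (lam := flipRate lam) (v := flipVel v) (fun i => hlam _)
      (by simpa [flipVel] using hv1) (by simpa [flipVel] using hv0) (1 - i) n t (neg_pos.2 hy)
    rwa [passageDensity_flip hv0 hv1, neg_neg, sub_sub_cancel] at h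
  · simp [passageDensity]
  · exact passageDensity_nonneg_of_pos hlam hv0 hv1 i n t hy

include hlam hv0 hv1 in
/-- The passage densities sum up to the total passage density. -/
lemma hasSum_passageDensity (i : Fin 2) (t y : ℝ) :
    HasSum (fun n => passageDensity lam v i n t y) (passageTotalDensity lam v i t y) := by
  rcases lt_trichotomy y 0 with hy | rfl | hy
  · have h := hasSum_passageDensity_of_pos (lam := flipRate lam) (v := flipVel v)
      (fun i => hlam _) (by simpa [flipVel] using hv1) (by simpa [flipVel] using hv0) (1 - i) t
      (neg_pos.2 hy)
    simpa only [passageDensity_flip hv0 hv1, passageTotalDensity_flip hv0 hv1, neg_neg,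
      sub_sub_cancel] using h
  · simp [passageDensity, passageTotalDensity]
  · exact hasSum_passageDensity_of_pos hlam hv0 hv1 i t hy

include hlam hv1 in
-- For each parity of n one of the two passage densities vanishes. Adding both removes the
-- dependence of the final state on n, so the series can be summed term by term.
lemma meanderNegDensity_eq_add (n : ℕ) (t : ℝ) {x : ℝ} (hx : x < 0) :
    meanderNegDensity lam v n t x = (passageDensity lam v 1 n t x + lam 1 / lam 0 * passageDensity lam v 0 n t x) / (-v 1) := by
  rw [meanderNegDensity_eq hlam hv1 n hx]
  have l1 := (hlam 1).ne'
  rcases Nat.even_or_odd n with hn | hn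
  · have hn' : ¬ Odd n := by simpa using hn
    have h0 : passageDensity lam v 0 n t x = 0 := by simp [passageDensity, hx.not_gt, hn']
    simp [stateAfter, hn, h0, div_self l1]
  · have hn' : ¬ Even n := by simpa using hn
    have h0 : passageDensity lam v 1 n t x = 0 := by simp [passageDensity, hx.not_gt, hn']
    simp only [stateAfter, hn', if_false, sub_self, h0, zero_add]
    ring

include hlam hv0 hv1 in
lemma meanderNegDensity_nonneg (n : ℕ) (t x : ℝ) : 0 ≤ meanderNegDensity lam v n t x := by
  rcases lt_or_ge x 0 with hx | hx
  · rw [meanderNegDensity_eq_add hlam hv1 n t hx]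
    have := passageDensity_nonneg hlam hv0 hv1 0 n t x
    have := passageDensity_nonneg hlam hv0 hv1 1 n t x
    exact div_nonneg (add_nonneg ‹_› (mul_nonneg (div_pos (hlam 1) (hlam 0)).le ‹_›))
      (neg_pos.2 hv1).le
  · rw [meanderNegDensity_of_nonneg n hx]

include hlam hv0 hv1 in
/-- The meander densities sum up to the total meander density. -/
lemma hasSum_meanderNegDensity (t x : ℝ) :
    HasSum (fun n => meanderNegDensity lam v n t x) (meanderNegTotalDensity lam v t x) := by
  rcases lt_or_ge x 0 with hx | hx
  swap
  · simp [meanderNegDensity, meanderNegTotalDensity, hx.not_gt]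
  simp only [fun n => meanderNegDensity_eq_add hlam hv1 n t hx]
  have h := (((hasSum_passageDensity hlam hv0 hv1 1 t x).add
    ((hasSum_passageDensity hlam hv0 hv1 0 t x).mul_left (lam 1 / lam 0))).div_const (-v 1))
  suffices e : meanderNegTotalDensity lam v t x = (passageTotalDensity lam v 1 t x +
      lam 1 / lam 0 * passageTotalDensity lam v 0 t x) / (-v 1) by rwa [e]
  have hc : v 1 * t < x ↔ x / v 1 < t := by
    rw [div_lt_iff_of_neg hv1, mul_comm]
  simp only [meanderNegTotalDensity, passageTotalDensity, hx, hx.not_gt, hc, false_and, true_and,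
    and_true, if_false, if_true, one_ne_zero]
  have l0 := (hlam 0).ne'
  have l1 := (hlam 1).ne'
  have v1 := hv1.ne
  by_cases ht : x / v 1 < t
  · have hxi : xi1 v t x ≠ 0 := by
      rw [← hc] at ht
      have h2 : 0 < v 0 - v 1 := by linarith
      have : 0 < t := by nlinarith
      exact (div_pos (by nlinarith) h2).ne'
    simp only [ht, if_true]
    field_simp
    ring
  · simp [ht]

@[fun_prop]
lemma measurable_meanderNegDensity (n : ℕ) :
    Measurable fun p : ℝ × ℝ => meanderNegDensity lam v n p.1 p.2 := by
  have h0 : Measurable fun p : ℝ × ℝ => xi0 v p.1 p.2 := by unfold xi0; fun_prop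
  have h1 : Measurable fun p : ℝ × ℝ => xi1 v p.1 p.2 := by unfold xi1; fun_prop
  unfold meanderNegDensity zed theta
  refine Measurable.ite ?_ ?_ measurable_const
  · exact (measurableSet_lt (by fun_prop : Measurable fun p : ℝ × ℝ => v 1 * p.1)
      measurable_snd).inter (measurableSet_lt measurable_snd measurable_const)
  · split_ifs <;> fun_prop

include hlam hv0 hv1 in
lemma tsum_ofReal_passageDensity (i : Fin 2) (t y : ℝ) :
    ∑' n, ENNReal.ofReal (passageDensity lam v i n t y) =
      ENNReal.ofReal (passageTotalDensity lam v i t y) := by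
  have h := hasSum_passageDensity hlam hv0 hv1 i t y
  rw [← h.tsum_eq, ENNReal.ofReal_tsum_of_nonneg
    (fun n => passageDensity_nonneg hlam hv0 hv1 i n t y) h.summable]

include hlam hv0 hv1 in
lemma tsum_ofReal_meanderNegDensity (t x : ℝ) :
    ∑' n, ENNReal.ofReal (meanderNegDensity lam v n t x) =
      ENNReal.ofReal (meanderNegTotalDensity lam v t x) := by
  have h := hasSum_meanderNegDensity hlam hv0 hv1 t x
  rw [← h.tsum_eq, ENNReal.ofReal_tsum_of_nonneg
    (fun n => meanderNegDensity_nonneg hlam hv0 hv1 n t x) h.summable]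

include hv0 hv1 in
lemma meanderNegDensity_flip (n : ℕ) (t x : ℝ) :
    meanderNegDensity (flipRate lam) (flipVel v) n t x = meanderPosDensity lam v n t (-x) := by
  simp only [meanderNegDensity, meanderPosDensity, xi0_flip hv0 hv1, xi1_flip hv0 hv1,
    zed_flip hv0 hv1, theta_flip hv0 hv1]
  simp only [flipRate, flipVel, sub_zero, sub_self]
  have hc : (-v 0 * t < x ∧ x < 0) ↔ (0 < -x ∧ -x < v 0 * t) :=
    ⟨fun h => ⟨by linarith [h.2], by linarith [h.1]⟩,
      fun h => ⟨by linarith [h.2], by linarith [h.1]⟩⟩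
  simp only [hc]
  have := hv0.ne'
  split_ifs <;> first | rfl | (field_simp; ring) | field_simp

include hv0 hv1 in
lemma meanderNegTotalDensity_flip (t x : ℝ) :
    meanderNegTotalDensity (flipRate lam) (flipVel v) t x =
      meanderPosTotalDensity lam v t (-x) := by
  simp only [meanderNegTotalDensity, meanderPosTotalDensity, calI0, calI1, xi0_flip hv0 hv1,
    xi1_flip hv0 hv1, zed_flip hv0 hv1, theta_flip hv0 hv1]
  simp only [flipRate, flipVel, sub_zero, sub_self]
  have hc : (-v 0 * t < x ∧ x < 0) ↔ (0 < -x ∧ -x < v 0 * t) :=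
    ⟨fun h => ⟨by linarith [h.2], by linarith [h.1]⟩,
      fun h => ⟨by linarith [h.2], by linarith [h.1]⟩⟩
  simp only [hc]
  have := hv0.ne'
  split_ifs <;> ring

end

namespace SwitchingProcess

/-! ### From the process to the law of its holding times -/

section

variable {Ω : Type*} [MeasurableSpace Ω] {P : Measure Ω} {lam v : Fin 2 → ℝ}
  (S : SwitchingProcess P lam)

/-- The sequence of the holding times. -/
def holdSeq (ω : Ω) : ℕ → ℝ := fun k => S.hold k ω

lemma measurable_holdSeq : Measurable S.holdSeq := measurable_pi_lambda _ S.measurable_hold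

lemma map_holdSeq (i : Fin 2) : (S.prob i).map S.holdSeq = holdLaw lam i := by
  have h := (S.indep i).map_fun_eq_infinitePi_map₀ S.measurable_holdSeq.aemeasurable
  exact h.trans (congrArg Measure.infinitePi (funext (S.law i)))

lemma ae_prob [IsFiniteMeasure P] (hlam : ∀ i, 0 < lam i) (i : Fin 2) :
    ∀ᵐ ω ∂S.prob i, S.init ω = i ∧ Admissible (S.holdSeq ω) := by
  have h1 : ∀ᵐ ω ∂S.prob i, S.init ω = i :=
    ae_cond_mem (S.measurable_init (measurableSet_singleton i))
  have h2 := ae_admissible hlam i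
  rw [← S.map_holdSeq i] at h2
  exact h1.and (ae_of_ae_map S.measurable_holdSeq.aemeasurable h2)

variable {S} {ω : Ω} {i : Fin 2}

lemma maxTriple_eq (hv0 : 0 < v 0) (hv1 : v 1 < 0) (hi : S.init ω = i)
    (H : Admissible (S.holdSeq ω)) {t : ℝ} (ht : 0 ≤ t) {n : ℕ} (hn : S.switches t ω = n) :
    (S.argMax v t ω, S.runMax v t ω, S.pos v t ω) = maxData v n i t (S.holdSeq ω) := by
  obtain ⟨e1, e2, e3, e4, e5⟩ := H.maxData_spec hv0 hv1 n ht i hn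
  have hp : ∀ u, S.pos v u ω = path v i (S.holdSeq ω) u := fun u => by rw [← hi]; rfl
  have hM : S.runMax v t ω = (maxData v n i t (S.holdSeq ω)).2.1 := by
    refine IsGreatest.csSup_eq ⟨⟨_, e2, (hp _).trans e3⟩, ?_⟩
    rintro _ ⟨u, hu, rfl⟩
    exact (hp u).trans_le (e4 u hu)
  have hA : S.argMax v t ω = (maxData v n i t (S.holdSeq ω)).1 := by
    refine IsLeast.csInf_eq ⟨⟨e2, by rw [hM, hp, e3]⟩, ?_⟩
    rintro u ⟨hu, hu2⟩
    by_contra hc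
    have := e5 u ⟨hu.1, not_le.1 hc⟩
    rw [← hp, hu2, hM] at this
    exact lt_irrefl _ this
  rw [hM, hA, hp t, ← e1]

lemma hitTime_of_hitsAfter (hv0 : 0 < v 0) (hv1 : v 1 < 0) (hi : S.init ω = i)
    (H : Admissible (S.holdSeq ω)) {y : ℝ} (hy : y ≠ 0) {n : ℕ}
    (hn : HitsAfter v n i y (S.holdSeq ω)) :
    S.Hits v y ω ∧ S.hitTime v y ω = firstHit v n i y (S.holdSeq ω) ∧
      S.switches (S.hitTime v y ω) ω = n := by
  obtain ⟨e1, e2, e3, e4⟩ := H.firstHit_spec hv0 hv1 n i hn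
  have hp : ∀ u, S.pos v u ω = path v i (S.holdSeq ω) u := fun u => by rw [← hi]; rfl
  have hpos : 0 < firstHit v n i y (S.holdSeq ω) := by
    refine lt_of_le_of_ne e1 fun h => hy ?_
    rw [← e2, ← h, path_zero]
  have hT : S.hitTime v y ω = firstHit v n i y (S.holdSeq ω) := by
    refine IsLeast.csInf_eq ⟨⟨hpos, (hp _).trans e2⟩, ?_⟩
    rintro u ⟨hu, hu2⟩
    by_contra hc
    exact e3 u ⟨hu.le, not_le.1 hc⟩ ((hp u).symm.trans hu2)
  exact ⟨⟨_, hpos, (hp _).trans e2⟩, hT, by rw [hT]; exact e4⟩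

lemma hits_and_switches_iff (hv0 : 0 < v 0) (hv1 : v 1 < 0) (hi : S.init ω = i)
    (H : Admissible (S.holdSeq ω)) {y : ℝ} (hy : 0 < y) {n : ℕ} :
    (S.Hits v y ω ∧ S.switches (S.hitTime v y ω) ω = n) ↔
      HitsAfter v n i y (S.holdSeq ω) := by
  constructor
  · rintro ⟨⟨u, hu, hu2⟩, hn⟩
    have hp : path v i (S.holdSeq ω) u = y := by rw [← hi]; exact hu2
    obtain ⟨m, hm⟩ := H.exists_hitsAfter hv0 hv1 _ hy.le i hu.le rfl hp
    have := (hitTime_of_hitsAfter hv0 hv1 hi H hy.ne' hm).2.2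
    rwa [← hn, this]
  · intro h
    exact ⟨(hitTime_of_hitsAfter hv0 hv1 hi H hy.ne' h).1,
      (hitTime_of_hitsAfter hv0 hv1 hi H hy.ne' h).2.2⟩

variable (S) (i)

/-- The transfer of an event to the space of holding times. -/
lemma ae_eq_preimage {E : Set Ω} {E' : Set (ℕ → ℝ)}
    (h : ∀ᵐ ω ∂S.prob i, ω ∈ E ↔ S.holdSeq ω ∈ E') : E =ᵐ[S.prob i] S.holdSeq ⁻¹' E' := by
  filter_upwards [h] with ω hω
  exact propext hω

/-- Measurability on Ω of functionals such as `argMax` or `hitTime` is never proved; it is enough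
that the events agree almost everywhere with measurable events of the holding times. -/
lemma nullMeasurableSet_of_ae_iff {E : Set Ω} {E' : Set (ℕ → ℝ)} (hE' : MeasurableSet E')
    (h : ∀ᵐ ω ∂S.prob i, ω ∈ E ↔ S.holdSeq ω ∈ E') : NullMeasurableSet E (S.prob i) :=
  (S.measurable_holdSeq hE').nullMeasurableSet.congr (S.ae_eq_preimage i h).symm

lemma prob_eq_holdLaw {E : Set Ω} {E' : Set (ℕ → ℝ)} (hE' : MeasurableSet E')
    (h : ∀ᵐ ω ∂S.prob i, ω ∈ E ↔ S.holdSeq ω ∈ E') : S.prob i E = holdLaw lam i E' := by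
  rw [measure_congr (S.ae_eq_preimage i h), ← Measure.map_apply S.measurable_holdSeq hE',
    S.map_holdSeq]

lemma ae_restrict_eq {E : Set Ω} {E' : Set (ℕ → ℝ)} (hE' : MeasurableSet E')
    (h : ∀ᵐ ω ∂S.prob i, ω ∈ E ↔ S.holdSeq ω ∈ E') {T : Ω → ℝ} {T' : (ℕ → ℝ) → ℝ}
    (hTT : ∀ᵐ ω ∂S.prob i, ω ∈ E → T ω = T' (S.holdSeq ω)) :
    T =ᵐ[(S.prob i).restrict E] T' ∘ S.holdSeq := by
  rw [Filter.EventuallyEq, ae_restrict_iff'₀ (S.nullMeasurableSet_of_ae_iff i hE' h)]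
  exact hTT

/-- The transfer of a law to the space of holding times. -/
lemma lintegral_map_restrict {E : Set Ω} {E' : Set (ℕ → ℝ)} (hE' : MeasurableSet E')
    (h : ∀ᵐ ω ∂S.prob i, ω ∈ E ↔ S.holdSeq ω ∈ E') {T : Ω → ℝ} {T' : (ℕ → ℝ) → ℝ}
    (hT' : Measurable T') (hTT : ∀ᵐ ω ∂S.prob i, ω ∈ E → T ω = T' (S.holdSeq ω))
    {f : ℝ → ℝ≥0∞} (hf : Measurable f) :
    ∫⁻ x, f x ∂(((S.prob i).restrict E).map T) =
      ∫⁻ x, E'.indicator (fun x => f (T' x)) x ∂(holdLaw lam i) := by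
  rw [Measure.map_congr (S.ae_restrict_eq i hE' h hTT),
    Measure.restrict_congr_set (S.ae_eq_preimage i h),
    ← Measure.map_map hT' S.measurable_holdSeq, ← Measure.restrict_map S.measurable_holdSeq hE',
    S.map_holdSeq, lintegral_map hf hT', lintegral_indicator hE']

/-- The law of `T` on an event is the sum of its laws on the parts of the event where `N = n`. -/
lemma map_restrict_eq_sum {E : Set Ω} (N : Ω → ℕ) {E' : ℕ → Set (ℕ → ℝ)}
    (hE' : ∀ n, MeasurableSet (E' n))
    (h : ∀ n, ∀ᵐ ω ∂S.prob i, (ω ∈ E ∧ N ω = n) ↔ S.holdSeq ω ∈ E' n) {T : Ω → ℝ}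
    {T' : ℕ → (ℕ → ℝ) → ℝ} (hT' : ∀ n, Measurable (T' n))
    (hTT : ∀ n, ∀ᵐ ω ∂S.prob i, ω ∈ E ∧ N ω = n → T ω = T' n (S.holdSeq ω)) :
    ((S.prob i).restrict E).map T =
      Measure.sum fun n => ((S.prob i).restrict {ω | ω ∈ E ∧ N ω = n}).map T := by
  have hU : E = ⋃ n, {ω | ω ∈ E ∧ N ω = n} := by
    ext ω
    simp
  have hd : Pairwise (Function.onFun (AEDisjoint (S.prob i)) fun n => {ω | ω ∈ E ∧ N ω = n}) := by
    intro a b hab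
    refine Disjoint.aedisjoint (disjoint_left.2 fun ω ha hb => hab ?_)
    exact ha.2.symm.trans hb.2
  have hm : ∀ n, AEMeasurable T ((S.prob i).restrict {ω | ω ∈ E ∧ N ω = n}) := fun n =>
    ((hT' n).comp S.measurable_holdSeq).aemeasurable.congr
      (S.ae_restrict_eq i (hE' n) (h n) (hTT n)).symm
  conv_lhs => rw [hU, Measure.restrict_iUnion_ae hd
    fun n => S.nullMeasurableSet_of_ae_iff i (hE' n) (h n)]
  exact Measure.map_sum (aemeasurable_sum_measure_iff.2 hm)

end

/-! ### Laws of the process as integrals over holding times -/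

section

variable {Ω : Type*} [MeasurableSpace Ω] {P : Measure Ω} [IsFiniteMeasure P] {lam v : Fin 2 → ℝ}
  (S : SwitchingProcess P lam) (hlam : ∀ i, 0 < lam i) (hv0 : 0 < v 0) (hv1 : v 1 < 0)

include hlam hv0 hv1

lemma lintegral_passage (i : Fin 2) {y : ℝ} (hy : 0 < y) (n : ℕ) {f : ℝ → ℝ≥0∞}
    (hf : Measurable f) : ∫⁻ s, f s ∂(S.passage v i y n) = levelOp lam v n i y f := by
  have hm : Measurable fun h : ℕ → ℝ => (y, h) := by fun_prop
  refine S.lintegral_map_restrict i ((measurableSet_hitsAfter v n i).preimage hm) ?_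
    ((measurable_firstHit v n i).comp hm) ?_ hf
  · filter_upwards [S.ae_prob hlam i] with ω hω
    exact hits_and_switches_iff hv0 hv1 hω.1 hω.2 hy
  · filter_upwards [S.ae_prob hlam i] with ω hω hE
    exact (hitTime_of_hitsAfter hv0 hv1 hω.1 hω.2 hy.ne'
      ((hits_and_switches_iff hv0 hv1 hω.1 hω.2 hy).1 hE)).2.1

lemma passageTotal_eq_sum (i : Fin 2) {y : ℝ} (hy : 0 < y) :
    S.passageTotal v i y = Measure.sum fun n => S.passage v i y n := by
  have hm : Measurable fun h : ℕ → ℝ => (y, h) := by fun_prop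
  refine S.map_restrict_eq_sum i (fun ω => S.switches (S.hitTime v y ω) ω)
    (fun n => (measurableSet_hitsAfter v n i).preimage hm) (fun n => ?_)
    (fun n => (measurable_firstHit v n i).comp hm) fun n => ?_
  · filter_upwards [S.ae_prob hlam i] with ω hω
    exact hits_and_switches_iff hv0 hv1 hω.1 hω.2 hy
  · filter_upwards [S.ae_prob hlam i] with ω hω hE
    exact (hitTime_of_hitsAfter hv0 hv1 hω.1 hω.2 hy.ne'
      ((hits_and_switches_iff hv0 hv1 hω.1 hω.2 hy).1 hE)).2.1

lemma runMax_and_switches_iff {t : ℝ} (ht : 0 ≤ t) (n : ℕ) : ∀ᵐ ω ∂S.prob 1,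
    ((S.runMax v t ω = 0 ∧ S.switches t ω = n) ↔
      JumpsEq n t (S.holdSeq ω) ∧ (maxData v n 1 t (S.holdSeq ω)).2.1 = 0) ∧
    (S.runMax v t ω = 0 ∧ S.switches t ω = n →
      S.pos v t ω = (maxData v n 1 t (S.holdSeq ω)).2.2) := by
  filter_upwards [S.ae_prob hlam 1] with ω hω
  have hJ : JumpsEq n t (S.holdSeq ω) ↔ S.switches t ω = n := hω.2.jumpsEq_iff ht n
  refine ⟨?_, fun h => by rw [← maxTriple_eq hv0 hv1 hω.1 hω.2 ht h.2]⟩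
  rw [hJ, and_comm]
  refine and_congr_right fun h => ?_
  rw [← maxTriple_eq hv0 hv1 hω.1 hω.2 ht h]

omit hlam hv0 hv1 in
lemma measurableSet_meander (t : ℝ) (n : ℕ) :
    MeasurableSet {h : ℕ → ℝ | JumpsEq n t h ∧ (maxData v n 1 t h).2.1 = 0} := by
  have hm : Measurable fun h : ℕ → ℝ => (t, h) := by fun_prop
  have h2 : Measurable fun h : ℕ → ℝ => maxData v n 1 t h := (measurable_maxData v n 1).comp hm
  exact ((measurableSet_jumpsEq n).preimage hm).inter
    (measurableSet_eq_fun h2.snd.fst measurable_const)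

lemma lintegral_meanderNeg {t : ℝ} (ht : 0 < t) (n : ℕ) {f : ℝ → ℝ≥0∞} (hf : Measurable f) :
    ∫⁻ x, f x ∂(S.meanderNeg v t n) = meanderOp lam v n t f := by
  have hm : Measurable fun h : ℕ → ℝ => (t, h) := by fun_prop
  have h2 : Measurable fun h : ℕ → ℝ => maxData v n 1 t h := (measurable_maxData v n 1).comp hm
  rw [meanderOp, maxOp, if_pos ht]
  refine (S.lintegral_map_restrict 1 (measurableSet_meander t n)
    ((S.runMax_and_switches_iff hlam hv0 hv1 ht.le n).mono fun ω h => h.1) h2.snd.snd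
    ((S.runMax_and_switches_iff hlam hv0 hv1 ht.le n).mono fun ω h => h.2) hf).trans ?_
  refine lintegral_congr fun h => ?_
  by_cases a : JumpsEq n t h <;> by_cases b : (maxData v n 1 t h).2.1 = 0 <;>
    simp [indicator, a, b]

lemma meanderNegTotal_eq_sum {t : ℝ} (ht : 0 < t) :
    S.meanderNegTotal v t = Measure.sum fun n => S.meanderNeg v t n := by
  have hm : Measurable fun h : ℕ → ℝ => (t, h) := by fun_prop
  have h2 : ∀ n, Measurable fun h : ℕ → ℝ => maxData v n 1 t h :=
    fun n => (measurable_maxData v n 1).comp hm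
  exact S.map_restrict_eq_sum 1 (fun ω => S.switches t ω) (measurableSet_meander t)
    (fun n => (S.runMax_and_switches_iff hlam hv0 hv1 ht.le n).mono fun ω h => h.1)
    (fun n => (h2 n).snd.snd)
    (fun n => (S.runMax_and_switches_iff hlam hv0 hv1 ht.le n).mono fun ω h => h.2)

lemma maxTriple_mem_iff (i : Fin 2) {t : ℝ} (ht : 0 ≤ t) (n : ℕ) (A : Set (ℝ × ℝ × ℝ)) :
    ∀ᵐ ω ∂S.prob i,
    ((S.argMax v t ω, S.runMax v t ω, S.pos v t ω) ∈ A ∧ S.switches t ω = n) ↔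
      S.holdSeq ω ∈ {h | JumpsEq n t h ∧ maxData v n i t h ∈ A} := by
  filter_upwards [S.ae_prob hlam i] with ω hω
  have hJ : JumpsEq n t (S.holdSeq ω) ↔ S.switches t ω = n := hω.2.jumpsEq_iff ht n
  change _ ↔ JumpsEq n t (S.holdSeq ω) ∧ _
  rw [hJ, and_comm]
  refine and_congr_right fun h => ?_
  rw [← maxTriple_eq hv0 hv1 hω.1 hω.2 ht h]

omit hlam hv0 hv1 in
lemma measurableSet_maxData (i : Fin 2) (t : ℝ) (n : ℕ) {A : Set (ℝ × ℝ × ℝ)}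
    (hA : MeasurableSet A) : MeasurableSet {h | JumpsEq n t h ∧ maxData v n i t h ∈ A} := by
  have hm : Measurable fun h : ℕ → ℝ => (t, h) := by fun_prop
  exact ((measurableSet_jumpsEq n).preimage hm).inter ((measurable_maxData v n i).comp hm hA)

lemma maxProb_eq_maxOp (i : Fin 2) {t : ℝ} (ht : 0 < t) (n : ℕ) {A : Set (ℝ × ℝ × ℝ)}
    (hA : MeasurableSet A) : S.maxProb v i t n A = maxOp lam v n i t (A.indicator 1) := by
  have hms := measurableSet_maxData (v := v) i t n hA
  rw [maxOp, if_pos ht]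
  refine (S.prob_eq_holdLaw i hms (S.maxTriple_mem_iff hlam hv0 hv1 i ht.le n A)).trans ?_
  rw [← lintegral_indicator_one hms]
  refine lintegral_congr fun h => ?_
  by_cases a : JumpsEq n t h <;> by_cases b : maxData v n i t h ∈ A <;>
    simp [indicator, a, b]

lemma maxProbTotal_eq_tsum (i : Fin 2) {t : ℝ} (ht : 0 < t) {A : Set (ℝ × ℝ × ℝ)}
    (hA : MeasurableSet A) : S.maxProbTotal v i t A = ∑' n, S.maxProb v i t n A := by
  have hU : {ω | (S.argMax v t ω, S.runMax v t ω, S.pos v t ω) ∈ A} = ⋃ n,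
      {ω | (S.argMax v t ω, S.runMax v t ω, S.pos v t ω) ∈ A ∧ S.switches t ω = n} := by
    ext ω
    simp
  rw [maxProbTotal, hU, measure_iUnion₀]
  · rfl
  · intro a b hab
    refine Disjoint.aedisjoint (disjoint_left.2 fun ω ha hb => hab ?_)
    exact ha.2.symm.trans hb.2
  · exact fun n => S.nullMeasurableSet_of_ae_iff i (measurableSet_maxData i t n hA)
      (S.maxTriple_mem_iff hlam hv0 hv1 i ht.le n A)

end

end SwitchingProcess

/-! ### Building blocks of the joint laws and rearrangement of sums -/

lemma compound_congr {F F' G G' : ℝ → Measure ℝ} {D : Set ℝ} (hD : MeasurableSet D) {t : ℝ}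
    (hF : ∀ y ∈ D, F y = F' y) (hG : ∀ r, 0 < r → G r = G' r) (A : Set (ℝ × ℝ × ℝ)) :
    compound F G D t A = compound F' G' D t A := by
  refine setLIntegral_congr_fun hD fun y hy => ?_
  simp only [hF y hy]
  exact setLIntegral_congr_fun measurableSet_Ioo fun s hs => by rw [hG _ (sub_pos.2 hs.2)]

lemma compound_eq_zero {F G : ℝ → Measure ℝ} {D : Set ℝ} (hD : MeasurableSet D) (t : ℝ)
    (hF : ∀ y ∈ D, F y = 0) (A : Set (ℝ × ℝ × ℝ)) : compound F G D t A = 0 := by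
  rw [compound_congr (F' := 0) (G' := G) hD hF (fun _ _ => rfl)]
  simp [compound]

lemma atEnd_eq_lintegral (h : ℝ → ℝ) (D : Set ℝ) (t : ℝ)
    {A : Set (ℝ × ℝ × ℝ)} (hA : MeasurableSet A) :
    atEnd h D t A = ∫⁻ x in D, ENNReal.ofReal (h x) * A.indicator 1 (t, x, x) := by
  have hm : MeasurableSet {x : ℝ | (t, x, x) ∈ A} :=
    hA.preimage (by fun_prop : Measurable fun x : ℝ => (t, x, x))
  rw [atEnd, inter_comm, ← Measure.restrict_restrict hm, ← lintegral_indicator hm]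
  refine lintegral_congr fun x => ?_
  by_cases hx : (t, x, x) ∈ A <;> simp [indicator, hx]

lemma sum_range_eq_sum_even {n : ℕ} {a : ℕ → ℝ≥0∞} (ha : ∀ m, Odd m → a m = 0) :
    ∑ m ∈ Finset.range n, a m = ∑ k ∈ Finset.range ((n + 1) / 2), a (2 * k) := by
  rw [← Finset.sum_image (s := Finset.range ((n + 1) / 2)) (g := fun k => 2 * k) (f := a)
    fun x _ y _ h => by simpa using h]
  refine (Finset.sum_subset (fun m hm => ?_) fun m hm hm' => ?_).symm
  · obtain ⟨k, hk, rfl⟩ := Finset.mem_image.1 hm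
    rw [Finset.mem_range] at hk ⊢
    omega
  · refine ha m ((Nat.even_or_odd' m).elim fun k hk => ?_)
    refine hk.elim (fun h => absurd (Finset.mem_image.2 ⟨k, ?_, h.symm⟩) hm') fun h => ⟨k, h⟩
    rw [Finset.mem_range] at hm ⊢
    omega

lemma sum_range_eq_sum_odd {n : ℕ} {a : ℕ → ℝ≥0∞} (ha : ∀ m, Even m → a m = 0) :
    ∑ m ∈ Finset.range n, a m = ∑ k ∈ Finset.Icc 1 (n / 2), a (2 * k - 1) := by
  rw [← Finset.sum_image (s := Finset.Icc 1 (n / 2)) (g := fun k => 2 * k - 1) (f := a)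
    fun x hx y hy h => by
      have := (Finset.mem_Icc.1 hx).1
      have := (Finset.mem_Icc.1 hy).1
      simp only at h
      omega]
  refine (Finset.sum_subset (fun m hm => ?_) fun m hm hm' => ?_).symm
  · obtain ⟨k, hk, rfl⟩ := Finset.mem_image.1 hm
    rw [Finset.mem_Icc] at hk
    rw [Finset.mem_range]
    omega
  · refine ha m ((Nat.even_or_odd' m).elim fun k hk => ?_)
    refine hk.elim (fun h => ⟨k, by omega⟩) fun h =>
      absurd (Finset.mem_image.2 ⟨k + 1, ?_, by omega⟩) hm'
    rw [Finset.mem_range] at hm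
    rw [Finset.mem_Icc]
    omega

/-- A term has m switchings before the maximum, one at it and k after it, so n = m + 1 + k; for each
n ≥ 1 these pairs (m, k) form an antidiagonal, and n = 0 contributes nothing. -/
lemma tsum_sum_range (b : ℕ → ℕ → ℝ≥0∞) :
    ∑' n, ∑ m ∈ Finset.range n, b m (n - (m + 1)) = ∑' m, ∑' k, b m k := by
  rw [tsum_eq_zero_add' ENNReal.summable, Finset.range_zero, Finset.sum_empty, zero_add,
    ← ENNReal.tsum_prod,
    ← Finset.HasAntidiagonal.sigmaAntidiagonalEquivProd.tsum_eq fun p : ℕ × ℕ => b p.1 p.2,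
    ENNReal.tsum_sigma']
  refine tsum_congr fun n => ?_
  rw [tsum_fintype]
  refine Eq.trans ?_ (Finset.sum_coe_sort (Finset.HasAntidiagonal.antidiagonal n)
    fun p : ℕ × ℕ => b p.1 p.2).symm
  rw [Finset.Nat.sum_antidiagonal_eq_sum_range_succ b]
  refine Finset.sum_congr rfl fun m _ => ?_
  congr 1
  omega

section

variable {lam v : Fin 2 → ℝ}

lemma div_velocity_pos_iff (hv0 : 0 < v 0) (hv1 : v 1 < 0) {y : ℝ} (hy : 0 < y)
    (i : Fin 2) : 0 < y / v i ↔ i = 0 := by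
  rcases Fin.exists_fin_two.1 ⟨i, rfl⟩ with rfl | rfl
  · simp [div_pos hy hv0]
  · simp [(div_neg_of_pos_of_neg hy hv1).le]

lemma measurable_ofReal_passageDensity (i : Fin 2) (n : ℕ) (y : ℝ) :
    Measurable fun t => ENNReal.ofReal (passageDensity lam v i n t y) :=
  ((measurable_passageDensity n i).comp
    (by fun_prop : Measurable fun t : ℝ => (t, y))).ennreal_ofReal

lemma measurable_ofReal_meanderNegDensity (n : ℕ) (t : ℝ) :
    Measurable fun x => ENNReal.ofReal (meanderNegDensity lam v n t x) :=
  ((measurable_meanderNegDensity n).comp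
    (by fun_prop : Measurable fun x : ℝ => (t, x))).ennreal_ofReal

lemma measurable_meanderOp_shift (hlam : ∀ i, 0 < lam i) (t : ℝ) (n : ℕ) {A : Set (ℝ × ℝ × ℝ)}
    (hA : MeasurableSet A) : Measurable fun q : ℝ × ℝ => meanderOp lam v n (t - q.1)
      (fun x => A.indicator (1 : ℝ × ℝ × ℝ → ℝ≥0∞) (q.1, q.2, q.2 + x)) := by
  refine measurable_meanderOp hlam n (by fun_prop) ?_
  exact (measurable_one.indicator hA).comp (by fun_prop : Measurable fun q : (ℝ × ℝ) × ℝ =>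
    (q.1.1, q.1.2, q.1.2 + q.2))

end

namespace SwitchingProcess

/-! ### Explicit laws of the first passage time, of the negative meander and of the maximum -/

section

variable {Ω : Type*} [MeasurableSpace Ω] {P : Measure Ω} [IsFiniteMeasure P] {lam v : Fin 2 → ℝ}
  (S : SwitchingProcess P lam) (hlam : ∀ i, 0 < lam i) (hv0 : 0 < v 0) (hv1 : v 1 < 0)

include hlam hv0 hv1

lemma lintegral_passage_eq (i : Fin 2) {y : ℝ} (hy : 0 < y) (n : ℕ) {f : ℝ → ℝ≥0∞}
    (hf : Measurable f) : ∫⁻ s, f s ∂(S.passage v i y n) =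
      (if n = 0 ∧ i = 0 then ENNReal.ofReal (Real.exp (-lam 0 * (y / v 0))) * f (y / v 0) else 0)
        + ∫⁻ t, ENNReal.ofReal (passageDensity lam v i n t y) * f t := by
  rw [S.lintegral_passage hlam hv0 hv1 i hy n hf, levelOp_eq_recordOp hlam hv0 hv1 n i hy hf,
    recordOp_level hlam hv0 hv1 hy n i hf]

/-- The law of the first passage time through a positive level after `n` switchings. -/
lemma passage_of_pos (i : Fin 2) {y : ℝ} (hy : 0 < y) (n : ℕ) : S.passage v i y n =
    (if n = 0 ∧ 0 < y / v i then
      ENNReal.ofReal (Real.exp (-lam i * (y / v i))) • Measure.dirac (y / v i) else 0)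
    + volume.withDensity (fun t => ENNReal.ofReal (passageDensity lam v i n t y)) := by
  refine Measure.ext_of_lintegral _ fun f hf => ?_
  rw [S.lintegral_passage_eq hlam hv0 hv1 i hy n hf, lintegral_add_measure,
    lintegral_withDensity_eq_lintegral_mul _ (measurable_ofReal_passageDensity i n y) hf]
  simp only [div_velocity_pos_iff hv0 hv1 hy]
  congr 1
  split_ifs with h
  · rw [h.2, lintegral_smul_measure, lintegral_dirac' _ hf, smul_eq_mul]
  · simp

/-- A positive level is almost surely crossed upwards in state 0, so the initial state dictates the
parity of the number of switchings. This thins out the sum over m in the joint law. -/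
lemma passage_eq_zero {i : Fin 2} {y : ℝ} (hy : 0 < y) {n : ℕ}
    (hn : if i = 0 then Odd n else Even n) : S.passage v i y n = 0 := by
  rw [S.passage_of_pos hlam hv0 hv1 i hy n]
  have hd : ∀ t, passageDensity lam v i n t y = 0 := by
    intro t
    rcases Fin.exists_fin_two.1 ⟨i, rfl⟩ with rfl | rfl
    · have h : ¬ Even n := by simpa using hn
      simp [passageDensity, h, hy.not_gt]
    · have h : ¬ Odd n := by simpa using hn
      simp [passageDensity, h, hy.not_gt]
  simp only [hd, ENNReal.ofReal_zero, div_velocity_pos_iff hv0 hv1 hy]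
  rw [if_neg]
  · simp
  · rintro ⟨rfl, rfl⟩
    simp at hn

/-- The law of the first passage time through a positive level. -/
lemma passageTotal_of_pos (i : Fin 2) {y : ℝ} (hy : 0 < y) : S.passageTotal v i y =
    (if 0 < y / v i then
      ENNReal.ofReal (Real.exp (-lam i * (y / v i))) • Measure.dirac (y / v i) else 0)
    + volume.withDensity (fun t => ENNReal.ofReal (passageTotalDensity lam v i t y)) := by
  rw [S.passageTotal_eq_sum hlam hv0 hv1 i hy]
  simp_rw [S.passage_of_pos hlam hv0 hv1 i hy]
  rw [← Measure.sum_add_sum, ← withDensity_tsum (measurable_ofReal_passageDensity i · y)]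
  congr 1
  · ext B hB
    rw [Measure.sum_apply _ hB, tsum_eq_single 0 fun n hn => by simp [hn]]
    simp
  · congr 1
    ext t
    rw [tsum_apply (Pi.summable.2 fun _ => ENNReal.summable),
      tsum_ofReal_passageDensity hlam hv0 hv1]

lemma lintegral_meanderNeg_eq {t : ℝ} (ht : 0 < t) (n : ℕ) {f : ℝ → ℝ≥0∞} (hf : Measurable f) :
    ∫⁻ x, f x ∂(S.meanderNeg v t n) =
      (if n = 0 then ENNReal.ofReal (Real.exp (-lam 1 * t)) * f (v 1 * t) else 0)
        + ∫⁻ x, ENNReal.ofReal (meanderNegDensity lam v n t x) * f x := by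
  rw [S.lintegral_meanderNeg hlam hv0 hv1 ht n hf, meanderOp_eq hlam hv0 hv1 n ht hf]

/-- The law of the negative meander with `n` switchings. -/
lemma meanderNeg_eq {t : ℝ} (ht : 0 < t) (n : ℕ) : S.meanderNeg v t n =
    (if n = 0 then ENNReal.ofReal (Real.exp (-lam 1 * t)) • Measure.dirac (v 1 * t) else 0)
    + volume.withDensity (fun x => ENNReal.ofReal (meanderNegDensity lam v n t x)) := by
  refine Measure.ext_of_lintegral _ fun f hf => ?_
  rw [S.lintegral_meanderNeg_eq hlam hv0 hv1 ht n hf, lintegral_add_measure,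
    lintegral_withDensity_eq_lintegral_mul _ (measurable_ofReal_meanderNegDensity n t) hf]
  congr 1
  split_ifs with h
  · rw [lintegral_smul_measure, lintegral_dirac' _ hf, smul_eq_mul]
  · simp

/-- The law of the negative meander. -/
lemma meanderNegTotal_eq {t : ℝ} (ht : 0 < t) : S.meanderNegTotal v t =
    ENNReal.ofReal (Real.exp (-lam 1 * t)) • Measure.dirac (v 1 * t)
    + volume.withDensity (fun x => ENNReal.ofReal (meanderNegTotalDensity lam v t x)) := by
  rw [S.meanderNegTotal_eq_sum hlam hv0 hv1 ht]
  simp_rw [S.meanderNeg_eq hlam hv0 hv1 ht]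
  rw [← Measure.sum_add_sum, ← withDensity_tsum (measurable_ofReal_meanderNegDensity · t)]
  congr 1
  · ext B hB
    rw [Measure.sum_apply _ hB, tsum_eq_single 0 fun n hn => by simp [hn]]
    simp
  · congr 1
    ext x
    rw [tsum_apply (Pi.summable.2 fun _ => ENNReal.summable),
      tsum_ofReal_meanderNegDensity hlam hv0 hv1]

lemma meanderNeg_apply {t : ℝ} (ht : 0 < t) (n : ℕ) {B : Set ℝ} (hB : MeasurableSet B) :
    S.meanderNeg v t n B = meanderOp lam v n t (B.indicator 1) := by
  rw [← S.lintegral_meanderNeg hlam hv0 hv1 ht n (measurable_one.indicator hB),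
    lintegral_indicator_one hB]

/-! #### The joint law of the maximum -/

omit hlam hv0 hv1 [IsFiniteMeasure P] in
lemma setLIntegral_meanderNeg_eq (t y : ℝ) (n : ℕ) (A : Set (ℝ × ℝ × ℝ)) (F : Measure ℝ) :
    ∫⁻ s in Ioo 0 t, S.meanderNeg v (t - s) n {w | (s, y, y + w) ∈ A} ∂F =
      ∫⁻ s, (Ioo 0 t).indicator
        (fun s => S.meanderNeg v (t - s) n {w | (s, y, y + w) ∈ A}) s ∂F :=
  (lintegral_indicator measurableSet_Ioo _).symm

/-- The family of meander laws is traded for `meanderOp`, which is known to be measurable in its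
parameters; its vanishing at nonpositive times replaces the cutoff s < t. -/
lemma indicator_meanderNeg (t y : ℝ) (n : ℕ) {A : Set (ℝ × ℝ × ℝ)} (hA : MeasurableSet A) (s : ℝ) :
    (Ioo 0 t).indicator (fun s => S.meanderNeg v (t - s) n {w | (s, y, y + w) ∈ A}) s =
      (Ioi 0).indicator (fun s => meanderOp lam v n (t - s)
        (fun x => A.indicator 1 (s, y, y + x))) s := by
  by_cases h0 : 0 < s
  swap
  · simp [h0]
  rcases lt_or_ge s t with h1 | h1
  · have hm : MeasurableSet {w : ℝ | (s, y, y + w) ∈ A} :=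
      hA.preimage (by fun_prop : Measurable fun w : ℝ => (s, y, y + w))
    rw [indicator_of_mem (by exact ⟨h0, h1⟩), indicator_of_mem (by exact h0),
      S.meanderNeg_apply hlam hv0 hv1 (sub_pos.2 h1) n hm]
    rfl
  · rw [indicator_of_notMem (fun h => h1.not_gt h.2), indicator_of_mem (by exact h0),
      meanderOp_of_nonpos (by linarith)]

lemma lintegral_passage_meanderNeg (t : ℝ) (i : Fin 2) {y : ℝ} (hy : 0 < y) (m n : ℕ)
    {A : Set (ℝ × ℝ × ℝ)} (hA : MeasurableSet A) :
    ∫⁻ s in Ioo 0 t, S.meanderNeg v (t - s) n {w | (s, y, y + w) ∈ A} ∂(S.passage v i y m) =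
      recordOp lam v (v 0) (v 1) m i y (fun p => meanderOp lam v n (t - (p.1 + p.2))
        (fun x => A.indicator 1 (p.1 + p.2, y, y + x))) := by
  have hm : Measurable fun s : ℝ => meanderOp lam v n (t - s)
      (fun x => A.indicator (1 : ℝ × ℝ × ℝ → ℝ≥0∞) (s, y, y + x)) :=
    (measurable_meanderOp_shift hlam t n hA).comp (by fun_prop : Measurable fun s : ℝ => (s, y))
  rw [setLIntegral_meanderNeg_eq]
  simp_rw [S.indicator_meanderNeg hlam hv0 hv1 t y n hA]
  rw [S.lintegral_passage hlam hv0 hv1 i hy m (hm.indicator measurableSet_Ioi),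
    levelOp_eq_recordOp hlam hv0 hv1 m i hy (hm.indicator measurableSet_Ioi)]
  refine recordOp_congr hv0 m i y fun u w hu hw _ _ => ?_
  rw [indicator_of_mem (by exact add_pos_of_pos_of_nonneg hu hw)]

lemma switchOp_eq_compound (t : ℝ) (i : Fin 2) (m n : ℕ) {A : Set (ℝ × ℝ × ℝ)}
    (hA : MeasurableSet A) :
    switchOp lam v m i (fun q => meanderOp lam v n (t - q.1)
      (fun x => A.indicator 1 (q.1, q.2, q.2 + x))) =
    ENNReal.ofReal (lam 0 / v 0) *
      compound (fun y => S.passage v i y m) (fun r => S.meanderNeg v r n) (Ioi 0) t A := by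
  rw [switchOp, compound, ← lintegral_indicator measurableSet_Ioi]
  congr 1
  refine lintegral_congr fun y => ?_
  by_cases hy : 0 < y
  · rw [indicator_of_mem (by exact hy), S.lintegral_passage_meanderNeg hlam hv0 hv1 t i hy m n hA]
  · rw [indicator_of_notMem (by simpa using hy)]
    refine recordOp_of_nonpos_level hlam hv0 hv1 (not_lt.1 hy) m i ?_
    exact (measurable_meanderOp_shift hlam t n hA).comp
      (by fun_prop : Measurable fun p : ℝ × ℝ => (p.1 + p.2, y))

/-- The joint law of the time of the maximum, the maximum and the position, with `n` switchings. -/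
lemma maxProb_eq (i : Fin 2) {t : ℝ} (ht : 0 < t) (n : ℕ) {A : Set (ℝ × ℝ × ℝ)}
    (hA : MeasurableSet A) : S.maxProb v i t n A =
      (if n = 0 ∧ i = 0 then ENNReal.ofReal (Real.exp (-lam 0 * t)) *
          Measure.dirac (t, v 0 * t, v 0 * t) A else 0)
      + atEnd (fun x => passageDensity lam v i n t x / v 0) (Ioi 0) t A
      + (if i = 1 then S.meanderNeg v t n {x | (0, 0, x) ∈ A} else 0)
      + ENNReal.ofReal (lam 0 / v 0) * ∑ m ∈ Finset.range n,
          compound (fun y => S.passage v i y m) (fun r => S.meanderNeg v r (n - (m + 1)))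
            (Ioi 0) t A := by
  have hi : Measurable (A.indicator (1 : ℝ × ℝ × ℝ → ℝ≥0∞)) := measurable_one.indicator hA
  have h1 : recordOp lam v 1 1 n i t
      (fun p => A.indicator 1 (p.1 + p.2, v 0 * p.1 + v 1 * p.2, v 0 * p.1 + v 1 * p.2)) =
      recordOp lam v 1 1 n i t (fun p => (fun x => A.indicator (1 : ℝ × ℝ × ℝ → ℝ≥0∞) (t, x, x))
        (v 0 * p.1 + v 1 * p.2)) := by
    -- On the line u + w = t the time coordinate is constantly t, so the indicator is a function of
    -- the position alone.
    refine recordOp_congr one_pos n i t fun u w _ _ hc _ => ?_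
    rw [one_mul, one_mul] at hc
    simp only [hc]
  rw [S.maxProb_eq_maxOp hlam hv0 hv1 i ht n hA, maxOp_eq hlam hv0 n i t hi, h1,
    recordOp_time hlam hv0 hv1 ht n i (f := fun x => A.indicator 1 (t, x, x)) (by fun_prop),
    atEnd_eq_lintegral _ _ t hA, Measure.dirac_apply' _ hA, Finset.mul_sum]
  congr 1
  · congr 1
    split_ifs
    · have hm : MeasurableSet {x : ℝ | ((0 : ℝ), (0 : ℝ), x) ∈ A} :=
        hA.preimage (by fun_prop : Measurable fun x : ℝ => ((0 : ℝ), (0 : ℝ), x))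
      rw [S.meanderNeg_apply hlam hv0 hv1 ht n hm]
      rfl
    · rfl
  · exact Finset.sum_congr rfl fun m _ => S.switchOp_eq_compound hlam hv0 hv1 t i m _ hA

lemma maxProb_zero {t : ℝ} (ht : 0 < t) (n : ℕ) {A : Set (ℝ × ℝ × ℝ)}
    (hA : MeasurableSet A) : S.maxProb v 0 t n A =
      (if n = 0 then ENNReal.ofReal (Real.exp (-lam 0 * t)) *
          Measure.dirac (t, v 0 * t, v 0 * t) A else 0)
      + atEnd (fun x => passageDensity lam v 0 n t x / v 0) (Ioi 0) t A
      + ENNReal.ofReal (lam 0 / v 0) * ∑ k ∈ Finset.range ((n + 1) / 2),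
          compound (fun y => S.passage v 0 y (2 * k))
            (fun r => S.meanderNeg v r (n - 2 * k - 1)) (Ioi 0) t A := by
  rw [S.maxProb_eq hlam hv0 hv1 0 ht n hA, sum_range_eq_sum_even]
  · simp [Nat.sub_sub]
  · exact fun m hm => compound_eq_zero measurableSet_Ioi t
      (fun y hy => S.passage_eq_zero hlam hv0 hv1 hy (by simpa using hm)) A

lemma maxProb_one {t : ℝ} (ht : 0 < t) (n : ℕ) {A : Set (ℝ × ℝ × ℝ)}
    (hA : MeasurableSet A) : S.maxProb v 1 t n A =
      S.meanderNeg v t n {x | (0, 0, x) ∈ A}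
      + atEnd (fun x => passageDensity lam v 1 n t x / v 0) (Ioi 0) t A
      + ENNReal.ofReal (lam 0 / v 0) * ∑ k ∈ Finset.Icc 1 (n / 2),
          compound (fun y => S.passage v 1 y (2 * k - 1))
            (fun r => S.meanderNeg v r (n - 2 * k)) (Ioi 0) t A := by
  rw [S.maxProb_eq hlam hv0 hv1 1 ht n hA, sum_range_eq_sum_odd]
  · simp only [one_ne_zero, and_false, if_false, if_true, zero_add]
    congr 1
    · rw [add_comm]
    · congr 1
      refine Finset.sum_congr rfl fun k hk => ?_
      have e : 2 * k - 1 + 1 = 2 * k := by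
        have := (Finset.mem_Icc.1 hk).1
        omega
      rw [e]
  · exact fun m hm => compound_eq_zero measurableSet_Ioi t
      (fun y hy => S.passage_eq_zero hlam hv0 hv1 hy (by simpa using hm)) A

/-- Tonelli for sums and integrals. Measurability in the level y is obtained by rewriting the inner
integral through `recordOp`, so the passage laws need not be shown to form a kernel in y. -/
lemma compound_total (i : Fin 2) (t : ℝ) {A : Set (ℝ × ℝ × ℝ)} (hA : MeasurableSet A) :
    compound (S.passageTotal v i) (S.meanderNegTotal v) (Ioi 0) t A =
      ∑' m, ∑' n, compound (fun y => S.passage v i y m) (fun r => S.meanderNeg v r n)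
        (Ioi 0) t A := by
  rw [compound_congr measurableSet_Ioi
    (fun y hy => S.passageTotal_eq_sum hlam hv0 hv1 i hy)
    (fun r hr => S.meanderNegTotal_eq_sum hlam hv0 hv1 hr)]
  have hW : ∀ m n, Measurable fun y => recordOp lam v (v 0) (v 1) m i y
      (fun p => meanderOp lam v n (t - (p.1 + p.2))
        (fun x => A.indicator (1 : ℝ × ℝ × ℝ → ℝ≥0∞) (p.1 + p.2, y, y + x))) := by
    intro m n
    refine measurable_recordOp m i measurable_id ?_
    exact (measurable_meanderOp_shift hlam t n hA).comp
      (by fun_prop : Measurable fun q : ℝ × (ℝ × ℝ) => (q.2.1 + q.2.2, q.1))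
  have hc : ∀ m n, compound (fun y => S.passage v i y m) (fun r => S.meanderNeg v r n)
      (Ioi 0) t A = ∫⁻ y in Ioi 0, recordOp lam v (v 0) (v 1) m i y
      (fun p => meanderOp lam v n (t - (p.1 + p.2))
        (fun x => A.indicator 1 (p.1 + p.2, y, y + x))) := fun m n =>
    setLIntegral_congr_fun measurableSet_Ioi fun y hy =>
      S.lintegral_passage_meanderNeg hlam hv0 hv1 t i hy m n hA
  simp_rw [hc]
  simp_rw [fun m => (lintegral_tsum (μ := volume.restrict (Ioi (0 : ℝ)))
    fun n => (hW m n).aemeasurable).symm]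
  rw [← lintegral_tsum fun m => (Measurable.tsum (hW m)).aemeasurable]
  refine setLIntegral_congr_fun measurableSet_Ioi fun y hy => ?_
  simp only
  rw [Measure.restrict_sum _ measurableSet_Ioo, lintegral_sum_measure]
  refine tsum_congr fun m => ?_
  simp_rw [← S.lintegral_passage_meanderNeg hlam hv0 hv1 t i hy m _ hA,
    setLIntegral_meanderNeg_eq, S.indicator_meanderNeg hlam hv0 hv1 t y _ hA]
  rw [← lintegral_tsum, ← lintegral_indicator measurableSet_Ioo]
  · refine lintegral_congr fun s => ?_
    simp_rw [← S.indicator_meanderNeg hlam hv0 hv1 t y _ hA]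
    by_cases hs : s ∈ Ioo 0 t
    · have hm : MeasurableSet {w : ℝ | (s, y, y + w) ∈ A} :=
        hA.preimage (by fun_prop : Measurable fun w : ℝ => (s, y, y + w))
      simp only [indicator_of_mem hs]
      rw [Measure.sum_apply _ hm]
    · simp only [indicator_of_notMem hs, tsum_zero]
  · exact fun n => (((measurable_meanderOp_shift hlam t n hA).comp
      (by fun_prop : Measurable fun s : ℝ => (s, y))).indicator measurableSet_Ioi).aemeasurable

/-- The joint law of the time of the maximum, the maximum and the position. -/
lemma maxProbTotal_eq (i : Fin 2) {t : ℝ} (ht : 0 < t) {A : Set (ℝ × ℝ × ℝ)}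
    (hA : MeasurableSet A) : S.maxProbTotal v i t A =
      (if i = 0 then ENNReal.ofReal (Real.exp (-lam 0 * t)) *
          Measure.dirac (t, v 0 * t, v 0 * t) A else 0)
      + atEnd (fun x => passageTotalDensity lam v i t x / v 0) (Ioi 0) t A
      + (if i = 1 then S.meanderNegTotal v t {x | (0, 0, x) ∈ A} else 0)
      + ENNReal.ofReal (lam 0 / v 0) *
          compound (S.passageTotal v i) (S.meanderNegTotal v) (Ioi 0) t A := by
  rw [S.maxProbTotal_eq_tsum hlam hv0 hv1 i ht hA]
  simp_rw [S.maxProb_eq hlam hv0 hv1 i ht _ hA]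
  rw [ENNReal.tsum_add, ENNReal.tsum_add, ENNReal.tsum_add, ENNReal.tsum_mul_left,
    tsum_sum_range fun m n => compound (fun y => S.passage v i y m)
      (fun r => S.meanderNeg v r n) (Ioi 0) t A, ← S.compound_total hlam hv0 hv1 i t hA]
  have hm : MeasurableSet {x : ℝ | ((0 : ℝ), (0 : ℝ), x) ∈ A} :=
    hA.preimage (by fun_prop : Measurable fun x : ℝ => ((0 : ℝ), (0 : ℝ), x))
  congr 2
  · congr 1
    · rw [tsum_eq_single 0 fun n hn => by simp [hn]]
      simp
    · simp_rw [atEnd, ENNReal.ofReal_div_of_pos hv0]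
      rw [← lintegral_tsum]
      · refine lintegral_congr fun x => ?_
        simp_rw [div_eq_mul_inv]
        rw [ENNReal.tsum_mul_right, tsum_ofReal_passageDensity hlam hv0 hv1]
      · intro n
        have : Measurable fun x => passageDensity lam v i n t x :=
          (measurable_passageDensity n i).comp (by fun_prop : Measurable fun x : ℝ => (t, x))
        fun_prop
  · split_ifs
    · rw [S.meanderNegTotal_eq_sum hlam hv0 hv1 ht, Measure.sum_apply _ hm]
    · simp

end

end SwitchingProcess

/-! ### Reflection -/

lemma stateAfter_one_sub (i : Fin 2) (n : ℕ) : stateAfter (1 - i) n = 1 - stateAfter i n := by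
  unfold stateAfter
  split_ifs <;> rfl

/-- The reflection of space in the variables `(s, y, x)`. -/
def reflect (A : Set (ℝ × ℝ × ℝ)) : Set (ℝ × ℝ × ℝ) := (fun p => (p.1, -p.2.1, -p.2.2)) ⁻¹' A

lemma measurableSet_reflect {A : Set (ℝ × ℝ × ℝ)} (hA : MeasurableSet A) :
    MeasurableSet (reflect A) :=
  hA.preimage (by fun_prop)

lemma lintegral_Iio_eq_lintegral_Ioi (f : ℝ → ℝ≥0∞) :
    ∫⁻ y in Iio 0, f y = ∫⁻ y in Ioi 0, f (-y) := by
  rw [← lintegral_indicator measurableSet_Iio, ← lintegral_indicator measurableSet_Ioi,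
    ← lintegral_neg_eq_self]
  refine lintegral_congr fun y => ?_
  by_cases hy : 0 < y <;> simp [indicator, hy]

lemma compound_reflect (F G : ℝ → Measure ℝ) (t : ℝ) {A : Set (ℝ × ℝ × ℝ)}
    (hA : MeasurableSet A) : compound (fun y => F (-y)) (fun r => (G r).map Neg.neg) (Ioi 0) t
      (reflect A) = compound F G (Iio 0) t A := by
  rw [compound, compound, lintegral_Iio_eq_lintegral_Ioi]
  refine lintegral_congr fun y => lintegral_congr fun s => ?_
  have hm : MeasurableSet {w : ℝ | (s, y, y + w) ∈ reflect A} :=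
    (measurableSet_reflect hA).preimage (by fun_prop : Measurable fun w : ℝ => (s, y, y + w))
  rw [Measure.map_apply measurable_neg hm]
  congr 1
  ext w
  simp [reflect, add_comm]

lemma atEnd_reflect (h : ℝ → ℝ) (t : ℝ) {A : Set (ℝ × ℝ × ℝ)} (hA : MeasurableSet A) :
    atEnd (fun x => h (-x)) (Ioi 0) t (reflect A) = atEnd h (Iio 0) t A := by
  rw [atEnd_eq_lintegral _ _ t hA, atEnd_eq_lintegral _ _ t (measurableSet_reflect hA),
    lintegral_Iio_eq_lintegral_Ioi]
  rfl

lemma map_neg_withDensity (f : ℝ → ℝ≥0∞) :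
    ((volume : Measure ℝ).withDensity f).map Neg.neg = volume.withDensity fun x => f (-x) := by
  ext B hB
  have hB' : MeasurableSet (Neg.neg ⁻¹' B : Set ℝ) := measurable_neg hB
  rw [Measure.map_apply measurable_neg hB, withDensity_apply _ hB', withDensity_apply _ hB,
    ← lintegral_indicator hB', ← lintegral_indicator hB, ← lintegral_neg_eq_self]
  refine lintegral_congr fun x => ?_
  by_cases hx : x ∈ B <;> simp [indicator, hx]

lemma dirac_reflect (t x : ℝ) {A : Set (ℝ × ℝ × ℝ)} (hA : MeasurableSet A) :
    Measure.dirac (t, x, x) (reflect A) = Measure.dirac (t, -x, -x) A := by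
  rw [Measure.dirac_apply' _ hA, Measure.dirac_apply' _ (measurableSet_reflect hA)]
  rfl

/-- If `T` is not almost everywhere measurable, neither is its negative, and both sides are the
default value zero of `Measure.map`. -/
lemma map_neg_comp {Ω : Type*} [MeasurableSpace Ω] (μ : Measure Ω) (T : Ω → ℝ) :
    μ.map (fun ω => -T ω) = (μ.map T).map Neg.neg := by
  by_cases h : AEMeasurable T μ
  · exact (AEMeasurable.map_map_of_aemeasurable measurable_neg.aemeasurable h).symm
  · have h' : ¬ AEMeasurable (fun ω => -T ω) μ := fun hc =>
      h (hc.neg.congr (Filter.Eventually.of_forall fun ω => neg_neg (T ω)))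
    rw [Measure.map_of_not_aemeasurable h, Measure.map_of_not_aemeasurable h', Measure.map_zero]

namespace SwitchingProcess

section

variable {Ω : Type*} [MeasurableSpace Ω] {P : Measure Ω} {lam : Fin 2 → ℝ}

/-- The process with exchanged states. -/
def flip (S : SwitchingProcess P lam) : SwitchingProcess P (flipRate lam) :=
  have h : ∀ i : Fin 2, (fun ω => 1 - S.init ω) ⁻¹' {i} = S.init ⁻¹' {1 - i} := fun i => by
    ext ω
    simp only [mem_preimage, mem_singleton_iff]
    constructor
    · rintro rfl
      rw [sub_sub_cancel]
    · intro h
      rw [h, sub_sub_cancel]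
  { init := fun ω => 1 - S.init ω
    hold := S.hold
    measurable_init := (measurable_from_top (f := fun i : Fin 2 => 1 - i)).comp S.measurable_init
    measurable_hold := S.measurable_hold
    init_ne_zero := fun i => by rw [h]; exact S.init_ne_zero (1 - i)
    indep := fun i => by rw [h]; exact S.indep (1 - i)
    law := fun i k => by rw [h, S.law, stateAfter_one_sub]; rfl }

variable (S : SwitchingProcess P lam) (v : Fin 2 → ℝ)

lemma flip_prob (i : Fin 2) : S.flip.prob i = S.prob (1 - i) := by
  unfold prob
  congr 1
  ext ω
  simp only [flip, mem_preimage, mem_singleton_iff]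
  constructor
  · rintro rfl
    rw [sub_sub_cancel]
  · intro h
    rw [h, sub_sub_cancel]

lemma flip_pos (t : ℝ) (ω : Ω) : S.flip.pos (flipVel v) t ω = -S.pos v t ω := by
  rw [pos, pos, ← intervalIntegral.integral_neg]
  congr 1
  ext s
  have : S.flip.state s ω = 1 - S.state s ω := stateAfter_one_sub _ _
  rw [this, flipVel, sub_sub_cancel]

lemma flip_runMax (t : ℝ) (ω : Ω) : S.flip.runMax (flipVel v) t ω = -S.runMin v t ω := by
  simp only [runMax, runMin, flip_pos]
  rw [← Real.sSup_neg, ← image_neg_eq_neg, image_image]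

lemma flip_argMax (t : ℝ) (ω : Ω) : S.flip.argMax (flipVel v) t ω = S.argMin v t ω := by
  simp only [argMax, argMin, flip_pos, flip_runMax, neg_inj]

lemma flip_hits (y : ℝ) (ω : Ω) : S.flip.Hits (flipVel v) y ω ↔ S.Hits v (-y) ω := by
  simp only [Hits, flip_pos, neg_eq_iff_eq_neg]

lemma flip_hitTime (y : ℝ) (ω : Ω) : S.flip.hitTime (flipVel v) y ω = S.hitTime v (-y) ω := by
  simp only [hitTime, flip_pos, neg_eq_iff_eq_neg]

lemma flip_switches (t : ℝ) (ω : Ω) : S.flip.switches t ω = S.switches t ω := rfl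

lemma flip_passage (i : Fin 2) (y : ℝ) (n : ℕ) :
    S.flip.passage (flipVel v) i y n = S.passage v (1 - i) (-y) n := by
  simp only [passage, flip_prob, flip_hits, flip_switches, flip_hitTime,
    funext fun ω => S.flip_hitTime v y ω]

lemma flip_passageTotal (i : Fin 2) (y : ℝ) :
    S.flip.passageTotal (flipVel v) i y = S.passageTotal v (1 - i) (-y) := by
  simp only [passageTotal, flip_prob, flip_hits, funext fun ω => S.flip_hitTime v y ω]

lemma flip_meanderNeg (t : ℝ) (n : ℕ) :
    S.flip.meanderNeg (flipVel v) t n = (S.meanderPos v t n).map Neg.neg := by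
  rw [meanderPos, ← map_neg_comp]
  simp only [meanderNeg, flip_prob, flip_runMax, flip_switches, neg_eq_zero, sub_self,
    funext fun ω => S.flip_pos v t ω]

lemma flip_meanderNegTotal (t : ℝ) :
    S.flip.meanderNegTotal (flipVel v) t = (S.meanderPosTotal v t).map Neg.neg := by
  rw [meanderPosTotal, ← map_neg_comp]
  simp only [meanderNegTotal, flip_prob, flip_runMax, neg_eq_zero, sub_self,
    funext fun ω => S.flip_pos v t ω]

lemma flip_maxProb (i : Fin 2) (t : ℝ) (n : ℕ) (A : Set (ℝ × ℝ × ℝ)) :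
    S.flip.maxProb (flipVel v) i t n (reflect A) = S.minProb v (1 - i) t n A := by
  simp only [maxProb, minProb, flip_prob, flip_runMax, flip_argMax, flip_pos, flip_switches,
    reflect, mem_preimage, neg_neg]

lemma flip_maxProbTotal (i : Fin 2) (t : ℝ) (A : Set (ℝ × ℝ × ℝ)) :
    S.flip.maxProbTotal (flipVel v) i t (reflect A) = S.minProbTotal v (1 - i) t A := by
  simp only [maxProbTotal, minProbTotal, flip_prob, flip_runMax, flip_argMax, flip_pos,
    reflect, mem_preimage, neg_neg]

lemma map_neg_neg (μ : Measure ℝ) : (μ.map Neg.neg).map Neg.neg = μ := by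
  rw [Measure.map_map measurable_neg measurable_neg]
  simp

lemma flip_meander_reflect (t : ℝ) (n : ℕ) {A : Set (ℝ × ℝ × ℝ)} (hA : MeasurableSet A) :
    S.flip.meanderNeg (flipVel v) t n {x | (0, 0, x) ∈ reflect A} =
      S.meanderPos v t n {x | (0, 0, x) ∈ A} := by
  have hm : MeasurableSet {x : ℝ | ((0 : ℝ), (0 : ℝ), x) ∈ reflect A} :=
    (measurableSet_reflect hA).preimage
      (by fun_prop : Measurable fun x : ℝ => ((0 : ℝ), (0 : ℝ), x))
  rw [flip_meanderNeg, Measure.map_apply measurable_neg hm]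
  simp [reflect]

lemma flip_meanderTotal_reflect (t : ℝ) {A : Set (ℝ × ℝ × ℝ)} (hA : MeasurableSet A) :
    S.flip.meanderNegTotal (flipVel v) t {x | (0, 0, x) ∈ reflect A} =
      S.meanderPosTotal v t {x | (0, 0, x) ∈ A} := by
  have hm : MeasurableSet {x : ℝ | ((0 : ℝ), (0 : ℝ), x) ∈ reflect A} :=
    (measurableSet_reflect hA).preimage
      (by fun_prop : Measurable fun x : ℝ => ((0 : ℝ), (0 : ℝ), x))
  rw [flip_meanderNegTotal, Measure.map_apply measurable_neg hm]
  simp [reflect]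

end

/-! ### Passage laws at all levels, the positive meander and the minimum -/

section

variable {Ω : Type*} [MeasurableSpace Ω] {P : Measure Ω} [IsFiniteMeasure P] {lam v : Fin 2 → ℝ}
  (S : SwitchingProcess P lam) (hlam : ∀ i, 0 < lam i) (hv0 : 0 < v 0) (hv1 : v 1 < 0)

include hlam hv0 hv1

/-- A negative level is a positive level of the reflected process, and the quotient `y / v i`, which
locates the atom, is unchanged by the reflection. -/
lemma passage_eq (i : Fin 2) {y : ℝ} (hy : y ≠ 0) (n : ℕ) : S.passage v i y n =
    (if n = 0 ∧ 0 < y / v i then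
      ENNReal.ofReal (Real.exp (-lam i * (y / v i))) • Measure.dirac (y / v i) else 0)
    + volume.withDensity (fun t => ENNReal.ofReal (passageDensity lam v i n t y)) := by
  rcases hy.lt_or_gt with hy | hy
  swap
  · exact S.passage_of_pos hlam hv0 hv1 i hy n
  have h := S.flip.passage_of_pos (v := flipVel v) (fun i => hlam _) (by simpa [flipVel] using hv1)
    (by simpa [flipVel] using hv0) (1 - i) (neg_pos.2 hy) n
  simpa only [flip_passage, passageDensity_flip hv0 hv1, flipRate, flipVel, sub_sub_cancel, neg_neg,
    neg_div_neg_eq] using h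

lemma passageTotal_eq (i : Fin 2) {y : ℝ} (hy : y ≠ 0) : S.passageTotal v i y =
    (if 0 < y / v i then
      ENNReal.ofReal (Real.exp (-lam i * (y / v i))) • Measure.dirac (y / v i) else 0)
    + volume.withDensity (fun t => ENNReal.ofReal (passageTotalDensity lam v i t y)) := by
  rcases hy.lt_or_gt with hy | hy
  swap
  · exact S.passageTotal_of_pos hlam hv0 hv1 i hy
  have h := S.flip.passageTotal_of_pos (v := flipVel v) (fun i => hlam _)
    (by simpa [flipVel] using hv1) (by simpa [flipVel] using hv0) (1 - i) (neg_pos.2 hy)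
  simpa only [flip_passageTotal, passageTotalDensity_flip hv0 hv1, flipRate, flipVel,
    sub_sub_cancel, neg_neg, neg_div_neg_eq] using h

/-- The law of the positive meander with `n` switchings. -/
lemma meanderPos_eq {t : ℝ} (ht : 0 < t) (n : ℕ) : S.meanderPos v t n =
    (if n = 0 then ENNReal.ofReal (Real.exp (-lam 0 * t)) • Measure.dirac (v 0 * t) else 0)
    + volume.withDensity (fun x => ENNReal.ofReal (meanderPosDensity lam v n t x)) := by
  rw [← map_neg_neg (S.meanderPos v t n), ← flip_meanderNeg,
    S.flip.meanderNeg_eq (v := flipVel v) (fun i => hlam _) (by simpa [flipVel] using hv1)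
    (by simpa [flipVel] using hv0) ht n, Measure.map_add _ _ measurable_neg, map_neg_withDensity]
  simp only [meanderNegDensity_flip hv0 hv1, neg_neg]
  congr 1
  split_ifs
  · rw [Measure.map_smul, Measure.map_dirac' measurable_neg]
    simp [flipRate, flipVel]
  · simp

/-- The law of the positive meander. -/
lemma meanderPosTotal_eq {t : ℝ} (ht : 0 < t) : S.meanderPosTotal v t =
    ENNReal.ofReal (Real.exp (-lam 0 * t)) • Measure.dirac (v 0 * t)
    + volume.withDensity (fun x => ENNReal.ofReal (meanderPosTotalDensity lam v t x)) := by
  rw [← map_neg_neg (S.meanderPosTotal v t), ← flip_meanderNegTotal,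
    S.flip.meanderNegTotal_eq (v := flipVel v) (fun i => hlam _) (by simpa [flipVel] using hv1)
    (by simpa [flipVel] using hv0) ht, Measure.map_add _ _ measurable_neg, map_neg_withDensity,
    Measure.map_smul, Measure.map_dirac' measurable_neg]
  simp only [meanderNegTotalDensity_flip hv0 hv1, neg_neg]
  simp [flipRate, flipVel]

lemma minProb_zero {t : ℝ} (ht : 0 < t) (n : ℕ) {A : Set (ℝ × ℝ × ℝ)} (hA : MeasurableSet A) :
    S.minProb v 0 t n A = S.meanderPos v t n {x | (0, 0, x) ∈ A}
      + atEnd (fun x => passageDensity lam v 0 n t x / (-v 1)) (Iio 0) t A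
      + ENNReal.ofReal (lam 1 / (-v 1)) * ∑ k ∈ Finset.Icc 1 (n / 2),
          compound (fun y => S.passage v 0 y (2 * k - 1))
            (fun r => S.meanderPos v r (n - 2 * k)) (Iio 0) t A := by
  have h := S.flip.maxProb_one (v := flipVel v) (fun i => hlam _) (by simpa [flipVel] using hv1)
    (by simpa [flipVel] using hv0) ht n (measurableSet_reflect hA)
  rw [flip_meander_reflect S v t n hA] at h
  simp only [flip_maxProb, flip_passage, flip_meanderNeg, passageDensity_flip hv0 hv1,
    sub_self] at h
  rw [h, ← atEnd_reflect _ t hA]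
  simp only [← compound_reflect _ _ t hA]
  simp [flipRate, flipVel]

lemma minProb_one {t : ℝ} (ht : 0 < t) (n : ℕ) {A : Set (ℝ × ℝ × ℝ)} (hA : MeasurableSet A) :
    S.minProb v 1 t n A =
      (if n = 0 then ENNReal.ofReal (Real.exp (-lam 1 * t)) *
          Measure.dirac (t, v 1 * t, v 1 * t) A else 0)
      + atEnd (fun x => passageDensity lam v 1 n t x / (-v 1)) (Iio 0) t A
      + ENNReal.ofReal (lam 1 / (-v 1)) * ∑ k ∈ Finset.range ((n + 1) / 2),
          compound (fun y => S.passage v 1 y (2 * k))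
            (fun r => S.meanderPos v r (n - 2 * k - 1)) (Iio 0) t A := by
  have h := S.flip.maxProb_zero (v := flipVel v) (fun i => hlam _) (by simpa [flipVel] using hv1)
    (by simpa [flipVel] using hv0) ht n (measurableSet_reflect hA)
  simp only [flip_maxProb, flip_passage, flip_meanderNeg,
    passageDensity_flip hv0 hv1, sub_zero] at h
  rw [h, ← atEnd_reflect _ t hA, dirac_reflect t _ hA]
  simp only [← compound_reflect _ _ t hA]
  simp [flipRate, flipVel]

lemma minProbTotal_eq (i : Fin 2) {t : ℝ} (ht : 0 < t) {A : Set (ℝ × ℝ × ℝ)}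
    (hA : MeasurableSet A) : S.minProbTotal v i t A =
      (if i = 1 then ENNReal.ofReal (Real.exp (-lam 1 * t)) *
          Measure.dirac (t, v 1 * t, v 1 * t) A else 0)
      + atEnd (fun x => passageTotalDensity lam v i t x / (-v 1)) (Iio 0) t A
      + (if i = 0 then S.meanderPosTotal v t {x | (0, 0, x) ∈ A} else 0)
      + ENNReal.ofReal (lam 1 / (-v 1)) *
          compound (S.passageTotal v i) (S.meanderPosTotal v) (Iio 0) t A := by
  have h := S.flip.maxProbTotal_eq (v := flipVel v) (fun i => hlam _)
    (by simpa [flipVel] using hv1) (by simpa [flipVel] using hv0) (1 - i) ht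
    (measurableSet_reflect hA)
  have e1 : S.flip.passageTotal (flipVel v) (1 - i) = fun y => S.passageTotal v i (-y) := by
    ext1 y
    rw [flip_passageTotal, sub_sub_cancel]
  have e2 : S.flip.meanderNegTotal (flipVel v) = fun r => (S.meanderPosTotal v r).map Neg.neg :=
    funext fun r => S.flip_meanderNegTotal v r
  rw [flip_maxProbTotal, flip_meanderTotal_reflect S v t hA, e1, e2, compound_reflect _ _ t hA,
    sub_sub_cancel] at h
  simp only [passageTotalDensity_flip hv0 hv1, sub_sub_cancel] at h
  rw [h, ← atEnd_reflect _ t hA, dirac_reflect t _ hA]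
  rcases Fin.exists_fin_two.1 ⟨i, rfl⟩ with rfl | rfl <;>
    simp [flipRate, flipVel]

end

end SwitchingProcess

end Telegraph

end

theorem mainTheorem4 {Ω : Type*} [MeasurableSpace Ω] (P : Measure Ω) [IsProbabilityMeasure P]
    (lam v : Fin 2 → ℝ) (hlam : ∀ i, 0 < lam i) (hv0 : 0 < v 0) (hv1 : v 1 < 0)
    (S : Telegraph.SwitchingProcess P lam) :
    -- the first passage laws `F_i(·; n)` and `F_i`
    (∀ (i : Fin 2) (y : ℝ), y ≠ 0 →
      (∀ n : ℕ, S.passage v i y n =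
        (if n = 0 ∧ 0 < y / v i then
          ENNReal.ofReal (Real.exp (-lam i * (y / v i))) • Measure.dirac (y / v i) else 0)
        + volume.withDensity
            (fun t => ENNReal.ofReal (Telegraph.passageDensity lam v i n t y))) ∧
      S.passageTotal v i y =
        (if 0 < y / v i then
          ENNReal.ofReal (Real.exp (-lam i * (y / v i))) • Measure.dirac (y / v i) else 0)
        + volume.withDensity
            (fun t => ENNReal.ofReal (Telegraph.passageTotalDensity lam v i t y))) ∧
    -- the meander laws `G^±(·; n)` and `G^±`
    (∀ t : ℝ, 0 < t →
      (∀ n : ℕ,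
        S.meanderPos v t n =
          (if n = 0 then
            ENNReal.ofReal (Real.exp (-lam 0 * t)) • Measure.dirac (v 0 * t) else 0)
          + volume.withDensity
              (fun x => ENNReal.ofReal (Telegraph.meanderPosDensity lam v n t x)) ∧
        S.meanderNeg v t n =
          (if n = 0 then
            ENNReal.ofReal (Real.exp (-lam 1 * t)) • Measure.dirac (v 1 * t) else 0)
          + volume.withDensity
              (fun x => ENNReal.ofReal (Telegraph.meanderNegDensity lam v n t x))) ∧
      S.meanderPosTotal v t =
        ENNReal.ofReal (Real.exp (-lam 0 * t)) • Measure.dirac (v 0 * t)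
        + volume.withDensity
            (fun x => ENNReal.ofReal (Telegraph.meanderPosTotalDensity lam v t x)) ∧
      S.meanderNegTotal v t =
        ENNReal.ofReal (Real.exp (-lam 1 * t)) • Measure.dirac (v 1 * t)
        + volume.withDensity
            (fun x => ENNReal.ofReal (Telegraph.meanderNegTotalDensity lam v t x))) ∧
    -- the joint laws of (time of the extremum, extremum, terminal position), with `N(t) = n`
    (∀ (t : ℝ), 0 < t → ∀ (n : ℕ) (A : Set (ℝ × ℝ × ℝ)), MeasurableSet A →
      S.minProb v 0 t n A =
        S.meanderPos v t n {x | (0, 0, x) ∈ A}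
        + Telegraph.atEnd (fun x => Telegraph.passageDensity lam v 0 n t x / (-v 1)) (Iio 0) t A
        + ENNReal.ofReal (lam 1 / (-v 1)) * ∑ k ∈ Finset.Icc 1 (n / 2),
            Telegraph.compound (fun y => S.passage v 0 y (2 * k - 1))
              (fun r => S.meanderPos v r (n - 2 * k)) (Iio 0) t A ∧
      S.minProb v 1 t n A =
        (if n = 0 then ENNReal.ofReal (Real.exp (-lam 1 * t)) *
          Measure.dirac (t, v 1 * t, v 1 * t) A else 0)
        + Telegraph.atEnd (fun x => Telegraph.passageDensity lam v 1 n t x / (-v 1)) (Iio 0) t A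
        + ENNReal.ofReal (lam 1 / (-v 1)) * ∑ k ∈ Finset.range ((n + 1) / 2),
            Telegraph.compound (fun y => S.passage v 1 y (2 * k))
              (fun r => S.meanderPos v r (n - 2 * k - 1)) (Iio 0) t A ∧
      S.maxProb v 0 t n A =
        (if n = 0 then ENNReal.ofReal (Real.exp (-lam 0 * t)) *
          Measure.dirac (t, v 0 * t, v 0 * t) A else 0)
        + Telegraph.atEnd (fun x => Telegraph.passageDensity lam v 0 n t x / v 0) (Ioi 0) t A
        + ENNReal.ofReal (lam 0 / v 0) * ∑ k ∈ Finset.range ((n + 1) / 2),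
            Telegraph.compound (fun y => S.passage v 0 y (2 * k))
              (fun r => S.meanderNeg v r (n - 2 * k - 1)) (Ioi 0) t A ∧
      S.maxProb v 1 t n A =
        S.meanderNeg v t n {x | (0, 0, x) ∈ A}
        + Telegraph.atEnd (fun x => Telegraph.passageDensity lam v 1 n t x / v 0) (Ioi 0) t A
        + ENNReal.ofReal (lam 0 / v 0) * ∑ k ∈ Finset.Icc 1 (n / 2),
            Telegraph.compound (fun y => S.passage v 1 y (2 * k - 1))
              (fun r => S.meanderNeg v r (n - 2 * k)) (Ioi 0) t A) ∧
    -- the joint laws of (time of the extremum, extremum, terminal position)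
    (∀ (t : ℝ), 0 < t → ∀ A : Set (ℝ × ℝ × ℝ), MeasurableSet A →
      S.minProbTotal v 0 t A =
        S.meanderPosTotal v t {x | (0, 0, x) ∈ A}
        + Telegraph.atEnd
            (fun x => Telegraph.passageTotalDensity lam v 0 t x / (-v 1)) (Iio 0) t A
        + ENNReal.ofReal (lam 1 / (-v 1)) *
            Telegraph.compound (S.passageTotal v 0) (S.meanderPosTotal v) (Iio 0) t A ∧
      S.minProbTotal v 1 t A =
        ENNReal.ofReal (Real.exp (-lam 1 * t)) * Measure.dirac (t, v 1 * t, v 1 * t) A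
        + Telegraph.atEnd
            (fun x => Telegraph.passageTotalDensity lam v 1 t x / (-v 1)) (Iio 0) t A
        + ENNReal.ofReal (lam 1 / (-v 1)) *
            Telegraph.compound (S.passageTotal v 1) (S.meanderPosTotal v) (Iio 0) t A ∧
      S.maxProbTotal v 0 t A =
        ENNReal.ofReal (Real.exp (-lam 0 * t)) * Measure.dirac (t, v 0 * t, v 0 * t) A
        + Telegraph.atEnd
            (fun x => Telegraph.passageTotalDensity lam v 0 t x / v 0) (Ioi 0) t A
        + ENNReal.ofReal (lam 0 / v 0) *
            Telegraph.compound (S.passageTotal v 0) (S.meanderNegTotal v) (Ioi 0) t A ∧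
      S.maxProbTotal v 1 t A =
        S.meanderNegTotal v t {x | (0, 0, x) ∈ A}
        + Telegraph.atEnd
            (fun x => Telegraph.passageTotalDensity lam v 1 t x / v 0) (Ioi 0) t A
        + ENNReal.ofReal (lam 0 / v 0) *
            Telegraph.compound (S.passageTotal v 1) (S.meanderNegTotal v) (Ioi 0) t A) := by
  refine ⟨fun i y hy => ⟨fun n => S.passage_eq hlam hv0 hv1 i hy n,
      S.passageTotal_eq hlam hv0 hv1 i hy⟩,
    fun t ht => ⟨fun n => ⟨S.meanderPos_eq hlam hv0 hv1 ht n, S.meanderNeg_eq hlam hv0 hv1 ht n⟩,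
      S.meanderPosTotal_eq hlam hv0 hv1 ht, S.meanderNegTotal_eq hlam hv0 hv1 ht⟩,
    fun t ht n A hA => ⟨S.minProb_zero hlam hv0 hv1 ht n hA, S.minProb_one hlam hv0 hv1 ht n hA,
      S.maxProb_zero hlam hv0 hv1 ht n hA, S.maxProb_one hlam hv0 hv1 ht n hA⟩,
    fun t ht A hA => ⟨?_, ?_, ?_, ?_⟩⟩
  · rw [S.minProbTotal_eq hlam hv0 hv1 0 ht hA]
    simp [add_comm]
  · rw [S.minProbTotal_eq hlam hv0 hv1 1 ht hA]
    simp
  · rw [S.maxProbTotal_eq hlam hv0 hv1 0 ht hA]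
    simp
  · rw [S.maxProbTotal_eq hlam hv0 hv1 1 ht hA]
    simp [add_comm]
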